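/- A search problem is a relation $R\subseteq\{0,1\}^*\times\{0,1\}^*$; $y$ is a solution of $x$ if $(x,y)\in R$. $R$ is in $\mathrm{TFNP}$ if every $x$ has a solution, all solutions of $x$ have length at most $q(|x|)$ for some polynomial $q$, and $R$ is decidable in polynomial time. $R$ is \emph{downward self-reducible} if there is a polynomial-time oracle algorithm that, for every oracle returning solutions of $R$ and every input $x$, outputs a solution of $x$ while querying the oracle only on strings of length strictly less than $|x|$. \textsc{Sink-of-DAG} is the following problem: given a Boolean circuit $S:\{0,1\}^n\to\{0,1\}^n$ with $S(0^n)\neq 0^n$ and a Boolean circuit $V:\{0,1\}^n\to\{0,\dots,2^m-1\}$ (values written in binary), find $v\in\{0,1\}^n$ with $S(v)\ne v$ such that $S(S(v))=S(v)$ or $V(S(v))\le V(v)$ (strings that do not encode such an instance have the empty string as their only solution). $\mathrm{PLS}$ is the class of problems $R\in\mathrm{TFNP}$ that are polynomial-time reducible to \textsc{Sink-of-DAG}, i.e. there are polynomial-time computable $f,g$ such that whenever $y$ is a solution of the \textsc{Sink-of-DAG} instance $f(x)$, $g(x,y)$ is a solution of $x$ in $R$. $R$ is \emph{worst-case hard}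 if no polynomial-time algorithm outputs a solution of $x$ on every input $x$. $R$ is \emph{average-case hard} if there is an efficiently sampleable ensemble $(D_n)_{n\in\mathbb N}$ of distributions on $\{0,1\}^*$ ($D_n$ is the output distribution of a polynomial-time algorithm on input $1^n$ and polynomially many uniform random bits) such that for every probabilistic polynomial-time algorithm $B$ the probability, over $x\sim D_n$ and the coins of $B$, that $B(1^n,x)$ is a solution of $x$ is negligible in $n$ (it is $o(n^{-c})$ for every $c$). \textbf{Corollary.} (1) Some problem in $\mathrm{PLS}$ is worst-case hard if and only if some downward self-reducible problem in $\mathrm{TFNP}$ is worst-case hard. (2) Some problem in $\mathrm{PLS}$ is average-case hard if and only if some downward self-reducible problem in $\mathrm{TFNP}$ is average-case hard. -/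

import Mathlib

namespace DSR

/-- Binary strings. -/
abbrev Str := List Bool

/-! ### Machine model: oracle machines with finitely many stacks of bits, with a step count -/

/-- Contents of the stacks of a machine. A program mentions only finitely many of them. -/
abbrev Store := ℕ → Str

/-- Programs of (oracle) multi-stack machines. Every instruction inspects or changes at most
one bit on top of one stack, except `query r`, which replaces the content of stack `r` by the
oracle's answer to it. -/
inductive Prog
  | skip
  | push (r : ℕ) (b : Bool)
  | pop (r : ℕ)
  | query (r : ℕ)
  | seq (p q : Prog)
  /-- three-way branch: stack `r` is empty / has top bit `0` / has top bit `1` -/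
  | branch (r : ℕ) (pNil p0 p1 : Prog)
  /-- repeat `p` as long as stack `r` is not empty -/
  | loop (r : ℕ) (p : Prog)

/-- `p.Runs O s t s'`: started on the store `s`, program `p` halts after `t` steps with the
store `s'`, where the oracle answers `a` to a query `z` if `O z = some a`, and where no query
`z` with `O z = none` is made (there is no rule for such a query). -/
inductive Prog.Runs (O : Str → Option Str) : Prog → Store → ℕ → Store → Prop
  | skip (s : Store) : Runs O .skip s 1 s
  | push (r : ℕ) (b : Bool) (s : Store) :
      Runs O (.push r b) s 1 (Function.update s r (b :: s r))
  | pop (r : ℕ) (s : Store) : Runs O (.pop r) s 1 (Function.update s r (s r).tail)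
  | query (r : ℕ) (s : Store) (a : Str) (h : O (s r) = some a) :
      Runs O (.query r) s 1 (Function.update s r a)
  | seq {p q : Prog} {s s' s'' : Store} {t t' : ℕ} (h : Runs O p s t s')
      (h' : Runs O q s' t' s'') : Runs O (.seq p q) s (t + t') s''
  | branchNil {r : ℕ} {pNil p0 p1 : Prog} {s s' : Store} {t : ℕ} (hr : s r = [])
      (h : Runs O pNil s t s') : Runs O (.branch r pNil p0 p1) s (t + 1) s'
  | branch0 {r : ℕ} {pNil p0 p1 : Prog} {s s' : Store} {t : ℕ} {u : Str}
      (hr : s r = false :: u) (h : Runs O p0 s t s') :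
      Runs O (.branch r pNil p0 p1) s (t + 1) s'
  | branch1 {r : ℕ} {pNil p0 p1 : Prog} {s s' : Store} {t : ℕ} {u : Str}
      (hr : s r = true :: u) (h : Runs O p1 s t s') :
      Runs O (.branch r pNil p0 p1) s (t + 1) s'
  | loopDone {r : ℕ} {p : Prog} {s : Store} (hr : s r = []) : Runs O (.loop r p) s 1 s
  | loopStep {r : ℕ} {p : Prog} {s s' s'' : Store} {t t' : ℕ} (hr : s r ≠ [])
      (h : Runs O p s t s') (h' : Runs O (.loop r p) s' t' s'') :
      Runs O (.loop r p) s (t + t' + 1) s''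

/-- Initial store for `k` inputs: input `i` is on stack `i`, all other stacks are empty. -/
def initStore {k : ℕ} (v : Fin k → Str) : Store := fun i => if h : i < k then v ⟨i, h⟩ else []

/-- With oracle `O` and the inputs `v`, the program halts within `T` steps with `out` on
stack `0`. -/
def Prog.Outputs {k : ℕ} (O : Str → Option Str) (p : Prog) (v : Fin k → Str) (T : ℕ)
    (out : Str) : Prop :=
  ∃ t s', t ≤ T ∧ p.Runs O (initStore v) t s' ∧ s' 0 = out

/-- The function `F` of `k` strings is computable in time polynomial in the total length of the
inputs (by a program that makes no oracle query). -/
def PolyTime (k : ℕ) (F : (Fin k → Str) → Str) : Prop :=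
  ∃ (p : Prog) (T : Polynomial ℕ), ∀ v : Fin k → Str,
    p.Outputs (fun _ => none) v (T.eval (∑ i, (v i).length)) (F v)

/-! ### Search problems -/

/-- `R x y` says that `y` is a solution of the instance `x`. -/
abbrev SearchProblem := Str → Str → Prop

/-- NP search problems: solutions have polynomial length, and the relation is decidable in
polynomial time. -/
def FNP (R : SearchProblem) : Prop :=
  (∃ q : Polynomial ℕ, ∀ x y, R x y → y.length ≤ q.eval x.length) ∧
  ∃ F, PolyTime 2 F ∧ ∀ x y, F ![x, y] = [true] ↔ R x y

/-- Total NP search problems. -/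
def TFNP (R : SearchProblem) : Prop := FNP R ∧ ∀ x, ∃ y, R x y

/-- Polynomial-time reductions between (total) search problems: `f` maps instances of `R` to
instances of `S`, and `g` maps solutions back. -/
def PolyReducible (R S : SearchProblem) : Prop :=
  ∃ (f : Str → Str) (g : Str → Str → Str),
    PolyTime 1 (fun v => f (v 0)) ∧ PolyTime 2 (fun v => g (v 0) (v 1)) ∧
    ∀ x y, S (f x) y → R x (g x y)

/-- Downward self-reducibility: a polynomial-time oracle program solves `R` on every input `x`
with every oracle for `R`, where only queries of length less than `|x|` are answered. -/
def DownwardSelfReducible (R : SearchProblem) : Prop :=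
  ∃ (p : Prog) (T : Polynomial ℕ), ∀ O : Str → Str, (∀ z y, R z y → R z (O z)) →
    ∀ x, ∃ y, R x y ∧
      p.Outputs (fun z => if z.length < x.length then some (O z) else none)
        ![x] (T.eval x.length) y

/-! ### Boolean circuits -/

/-- Gates. Wires are numbered backwards: wire `0` is the one computed last. -/
inductive Gate
  | const (b : Bool)
  | not (i : ℕ)
  | and (i j : ℕ)
  | or (i j : ℕ)

/-- A circuit is a list of gates in topological order, each reading wires that exist before it. -/
abbrev Circuit := List Gate

/-- Value of a gate, given the values of the earlier wires (a wire that does not exist reads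
`0`). -/
def Gate.eval (w : List Bool) : Gate → Bool
  | .const b => b
  | .not i => !(w.getD i false)
  | .and i j => w.getD i false && w.getD j false
  | .or i j => w.getD i false || w.getD j false

/-- Values of all wires on input `x`; the input bits are the first wires. -/
def Circuit.wires (C : Circuit) (x : Str) : List Bool :=
  C.foldl (fun w g => g.eval w :: w) x

/-- The `m` output bits of the circuit on input `x`: the values of the wires `0, …, m - 1`. -/
def Circuit.eval (C : Circuit) (m : ℕ) (x : Str) : Str :=
  (List.range m).map fun i => (Circuit.wires C x).getD i false

/-- The number `n` in unary. -/
def unary (n : ℕ) : Str := List.replicate n true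

/-- Self-delimiting unary code. -/
def encodeNat (n : ℕ) : Str := unary n ++ [false]

def Gate.encode : Gate → Str
  | .const b => [false, false, b]
  | .not i => [false, true] ++ encodeNat i
  | .and i j => [true, false] ++ encodeNat i ++ encodeNat j
  | .or i j => [true, true] ++ encodeNat i ++ encodeNat j

def Circuit.encode : Circuit → Str
  | [] => [false]
  | g :: C => true :: (g.encode ++ Circuit.encode C)

/-! ### Sink-of-DAG and PLS -/

/-- The natural number with the given binary digits, most significant digit first. -/
def binVal (x : Str) : ℕ := x.foldl (fun a b => 2 * a + b.toNat) 0

/-- A successor circuit `{0,1}ⁿ → {0,1}ⁿ` and a valuation circuit `{0,1}ⁿ → {0,1}ᵐ`. -/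
structure DAGInstance where
  n : ℕ
  m : ℕ
  succCircuit : Circuit
  valCircuit : Circuit

namespace DAGInstance

def encode (I : DAGInstance) : Str :=
  encodeNat I.n ++ encodeNat I.m ++ Circuit.encode I.succCircuit ++ Circuit.encode I.valCircuit

def S (I : DAGInstance) (v : Str) : Str := Circuit.eval I.succCircuit I.n v

def V (I : DAGInstance) (v : Str) : ℕ := binVal (Circuit.eval I.valCircuit I.m v)

/-- The vertex `0ⁿ` is not isolated. -/
def Valid (I : DAGInstance) : Prop :=
  I.S (List.replicate I.n false) ≠ List.replicate I.n false

/-- `v` has a proper successor `S v`, and `S v` has no proper successor or the valuation does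
not increase from `v` to `S v`. -/
def IsSolution (I : DAGInstance) (v : Str) : Prop :=
  v.length = I.n ∧ I.S v ≠ v ∧ (I.S (I.S v) = I.S v ∨ I.V (I.S v) ≤ I.V v)

end DAGInstance

/-- The search problem Sink-of-DAG. A string that does not encode a valid instance has the
empty string as its only solution. -/
def SinkOfDAG : SearchProblem := fun x y =>
  (∃ I : DAGInstance, I.encode = x ∧ I.Valid ∧ I.IsSolution y) ∨
  ((¬ ∃ I : DAGInstance, I.encode = x ∧ I.Valid) ∧ y = [])

/-! The encoding of instances is injective, and Sink-of-DAG is total. -/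

theorem encodeNat_append_inj {a b : ℕ} {u v : Str}
    (h : encodeNat a ++ u = encodeNat b ++ v) : a = b ∧ u = v := by
  induction a generalizing b with
  | zero => cases b <;> simp_all [encodeNat, unary, List.replicate_succ]
  | succ a ih =>
    cases b with
    | zero => simp [encodeNat, unary, List.replicate_succ] at h
    | succ b =>
      have := ih (b := b) (by simpa [encodeNat, unary, List.replicate_succ] using h)
      simpa using this

theorem Gate.encode_append_inj {a b : Gate} {u v : Str}
    (h : a.encode ++ u = b.encode ++ v) : a = b ∧ u = v := by
  cases a <;> cases b <;> simp only [Gate.encode, List.cons_append, List.nil_append,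
    List.append_assoc, List.cons.injEq, true_and, reduceCtorEq, false_and] at h
  · simpa using h
  · obtain ⟨h1, h2⟩ := encodeNat_append_inj h
    simp [h1, h2]
  · obtain ⟨h1, h2⟩ := encodeNat_append_inj h
    obtain ⟨h2, h3⟩ := encodeNat_append_inj h2
    simp [h1, h2, h3]
  · obtain ⟨h1, h2⟩ := encodeNat_append_inj h
    obtain ⟨h2, h3⟩ := encodeNat_append_inj h2
    simp [h1, h2, h3]

theorem Circuit.encode_append_inj {a b : Circuit} {u v : Str}
    (h : Circuit.encode a ++ u = Circuit.encode b ++ v) : a = b ∧ u = v := by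
  induction a generalizing b with
  | nil => cases b <;> simp_all [Circuit.encode]
  | cons g a ih =>
    cases b with
    | nil => simp [Circuit.encode] at h
    | cons g' b =>
      simp only [Circuit.encode, List.cons_append, List.append_assoc, List.cons.injEq,
        true_and] at h
      obtain ⟨h1, h2⟩ := Gate.encode_append_inj h
      obtain ⟨h2, h3⟩ := ih h2
      simp [h1, h2, h3]

theorem DAGInstance.encode_injective : Function.Injective DAGInstance.encode := by
  rintro ⟨n, m, s, v⟩ ⟨n', m', s', v'⟩ h
  simp only [DAGInstance.encode, List.append_assoc] at h
  obtain ⟨h1, h⟩ := encodeNat_append_inj h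
  obtain ⟨h2, h⟩ := encodeNat_append_inj h
  obtain ⟨h3, h⟩ := Circuit.encode_append_inj h
  obtain ⟨h4, -⟩ := Circuit.encode_append_inj (u := []) (v := []) (by simpa using h)
  simp [h1, h2, h3, h4]

theorem binVal_lt (x : Str) : binVal x < 2 ^ x.length := by
  induction x using List.reverseRecOn with
  | nil => simp [binVal]
  | append_singleton x b ih =>
    simp only [binVal, List.foldl_append, List.foldl_cons, List.foldl_nil, List.length_append,
      List.length_singleton, pow_succ] at ih ⊢
    have := b.toNat_lt
    omega

theorem sinkOfDAG_total (x : Str) : ∃ y, SinkOfDAG x y := by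
  by_cases hx : ∃ I : DAGInstance, I.encode = x ∧ I.Valid
  · obtain ⟨I, hI, hv⟩ := hx
    have key : ∀ k v, v.length = I.n → I.S v ≠ v → 2 ^ I.m ≤ I.V v + k →
        ∃ y, I.IsSolution y := by
      intro k
      induction k with
      | zero =>
        intro v _ _ h
        have := binVal_lt (Circuit.eval I.valCircuit I.m v)
        simp only [Circuit.eval, List.length_map, List.length_range] at this
        simp only [DAGInstance.V, Circuit.eval] at h
        omega
      | succ k ih =>
        intro v hl hS h
        by_cases hs : I.IsSolution v
        · exact ⟨v, hs⟩
        · simp only [DAGInstance.IsSolution, not_and, not_or, not_le] at hs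
          have h2 := hs hl hS
          exact ih (I.S v) (by simp [DAGInstance.S, Circuit.eval]) h2.1 (by omega)
    obtain ⟨y, hy⟩ := key (2 ^ I.m) _ (by simp) hv (by omega)
    exact ⟨y, Or.inl ⟨I, hI, hv, hy⟩⟩
  · exact ⟨[], Or.inr ⟨hx, rfl⟩⟩

/-- Polynomial local search. -/
def PLS (R : SearchProblem) : Prop := TFNP R ∧ PolyReducible R SinkOfDAG

/-! ### Hardness -/

/-- No polynomial-time algorithm solves `R`. -/
def WorstCaseHard (R : SearchProblem) : Prop :=
  ¬ ∃ f : Str → Str, PolyTime 1 (fun v => f (v 0)) ∧ ∀ x, R x (f x)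

/-- A uniformly random string of length `ℓ`. -/
noncomputable def coins (ℓ : ℕ) : PMF Str :=
  (PMF.uniformOfFintype (Fin ℓ → Bool)).map List.ofFn

/-- Efficiently sampleable ensembles: a polynomial-time algorithm on input `1ⁿ` with
polynomially many coin tosses outputs a string with law `D n`. -/
def Sampleable (D : ℕ → PMF Str) : Prop :=
  ∃ (F : (Fin 2 → Str) → Str) (ℓ : Polynomial ℕ), PolyTime 2 F ∧
    ∀ n, D n = (coins (ℓ.eval n)).map fun ρ => F ![unary n, ρ]

/-- `B n x` is the law of the output of a probabilistic polynomial-time algorithm on the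
security parameter `1ⁿ` and the instance `x`. -/
def IsPPT (B : ℕ → Str → PMF Str) : Prop :=
  ∃ (F : (Fin 3 → Str) → Str) (ℓ : Polynomial ℕ), PolyTime 3 F ∧
    ∀ n x, B n x = (coins (ℓ.eval n)).map fun ρ => F ![unary n, x, ρ]

/-- The probability that `B x` is a solution of `x`, for `x` drawn from `D`. -/
noncomputable def successProb (R : SearchProblem) (D : PMF Str) (B : Str → PMF Str) : ℝ :=
  ((D.bind fun x => (B x).map fun y => (x, y)).toOuterMeasure {z | R z.1 z.2}).toReal

/-- For some efficiently sampleable ensemble, every probabilistic polynomial-time algorithm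
has negligible success probability. -/
def AverageCaseHard (R : SearchProblem) : Prop :=
  ∃ D : ℕ → PMF Str, Sampleable D ∧ ∀ B : ℕ → Str → PMF Str, IsPPT B →
    Asymptotics.SuperpolynomialDecay Filter.atTop (fun n : ℕ => (n : ℝ))
      fun n => successProb R (D n) (B n)

end DSR

/-! Hardness passes along polynomial-time reductions (`WorstCaseHard.of_polyReducible`,
`AverageCaseHard.of_polyReducible`). So it suffices that every downward self-reducible TFNP problem
lies in PLS (`pls_of_downwardSelfReducible`), and that every problem in PLS reduces to one fixed
downward self-reducible TFNP problem, `DAGCode.improvement`.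

From self-reducibility to PLS: run the self-reduction on x and answer each query by running it
recursively on that query. The recursion may take exponentially many steps, but its state is small.
Queries get strictly shorter, so the depth is at most |x|, and each level holds at most T(|x|)
answered queries and one pending one. A state is the list of these events. Since R is decidable in
polynomial time, a state can be tested for validity: every query must be the one the program really
asks next, and every recorded answer must be a solution. The self-reduction works with every oracle
for R, so any table of correct answers extends to a legitimate oracle (`tabRun_spec`). One step of
the search either opens a pending query or replaces the latest pending query, with everything after
it, by an answered one. Reading the events as base-4 digits, oldest first, with answered = 2,
pending = 1 and absent = 0, each proper step strictly increases the number (`progress_lt`). Hence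
the only local optima are the completed computations, from which a solution of x is read off
(`solution_of_next_eq`).

From PLS to self-reducibility: an instance of `improvement` is (k, w, u), with u the code of a DAG,
w a vertex with a proper successor, and k in unary. Wanted is a vertex that either solves
Sink-of-DAG or has a larger value than w after both values are divided by 2^k. For k = 0, either w
or its successor works. For k + 1, two improvements at level k in a row raise the quotient by at
least two, hence the halved quotient by at least one (`improves_succ`). The queries have a smaller k
and a vertex of the same length, so they are shorter strings. When k is the number of value bits all
quotients vanish, and only genuine solutions remain.

The rest of the proof supplies effectivity. `FP` is a class of polynomial-time functions between
coded types, closed under composition, pairing, branching and iteration with polynomially bounded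
states. Programs are simulated by circuits that can be generated in polynomial time
(`Circuit.exists_of_fp`); this turns polynomial-time successor and value functions into instances of
Sink-of-DAG (`polyReducible_sinkOfDAG`). Oracle programs are run on a finite table of answers by
`Prog.evalTab`. -/

namespace DSR

/-! ### Running programs -/

/-- `p` halts on `s` with the store `s'` within `T` steps. -/
def Prog.Exec (O : Str → Option Str) (p : Prog) (s : Store) (T : ℕ) (s' : Store) : Prop :=
  ∃ t ≤ T, p.Runs O s t s'

namespace Prog

variable {O : Str → Option Str}

theorem Exec.mono {p : Prog} {s s' : Store} {T T' : ℕ} (h : p.Exec O s T s') (hT : T ≤ T') :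
    p.Exec O s T' s' := by
  obtain ⟨t, ht, h⟩ := h
  exact ⟨t, ht.trans hT, h⟩

theorem Exec.to {p : Prog} {s s' s'' : Store} {T T' : ℕ} (h : p.Exec O s T s') (hT : T ≤ T')
    (hs : s' = s'') : p.Exec O s T' s'' := hs ▸ h.mono hT

theorem exec_skip (s : Store) : skip.Exec O s 1 s := ⟨1, le_rfl, .skip s⟩

theorem exec_push {r : ℕ} {b : Bool} {s s' : Store} (h : Function.update s r (b :: s r) = s') :
    (push r b).Exec O s 1 s' := h ▸ ⟨1, le_rfl, .push r b s⟩

theorem exec_pop {r : ℕ} {s s' : Store} (h : Function.update s r (s r).tail = s') :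
    (pop r).Exec O s 1 s' := h ▸ ⟨1, le_rfl, .pop r s⟩

theorem exec_query {r : ℕ} {s s' : Store} {a : Str} (ha : O (s r) = some a)
    (h : Function.update s r a = s') : (query r).Exec O s 1 s' :=
  h ▸ ⟨1, le_rfl, .query r s a ha⟩

theorem Exec.seq {p q : Prog} {s s' s'' : Store} {T T' : ℕ} (h : p.Exec O s T s')
    (h' : q.Exec O s' T' s'') : (seq p q).Exec O s (T + T') s'' := by
  obtain ⟨t, ht, h⟩ := h
  obtain ⟨t', ht', h'⟩ := h'
  exact ⟨t + t', by omega, .seq h h'⟩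

theorem Exec.branchNil {r : ℕ} {pNil p0 p1 : Prog} {s s' : Store} {T : ℕ}
    (h : pNil.Exec O s T s') (hr : s r = []) : (branch r pNil p0 p1).Exec O s (T + 1) s' := by
  obtain ⟨t, ht, h⟩ := h
  exact ⟨t + 1, by omega, .branchNil hr h⟩

theorem Exec.branchCons {r : ℕ} {pNil p0 p1 : Prog} {s s' : Store} {T : ℕ} {c : Bool} {u : Str}
    (h : (if c then p1 else p0).Exec O s T s') (hr : s r = c :: u) :
    (branch r pNil p0 p1).Exec O s (T + 1) s' := by
  obtain ⟨t, ht, h⟩ := h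
  cases c
  · exact ⟨t + 1, by omega, .branch0 hr h⟩
  · exact ⟨t + 1, by omega, .branch1 hr h⟩

theorem exec_loopDone {r : ℕ} {p : Prog} {s : Store} (hr : s r = []) :
    (loop r p).Exec O s 1 s := ⟨1, le_rfl, .loopDone hr⟩

theorem Exec.loopStep {r : ℕ} {p : Prog} {s s' s'' : Store} {T T' : ℕ} (h : p.Exec O s T s')
    (h' : (loop r p).Exec O s' T' s'') (hr : s r ≠ []) :
    (loop r p).Exec O s (T + T' + 1) s'' := by
  obtain ⟨t, ht, h⟩ := h
  obtain ⟨t', ht', h'⟩ := h'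
  exact ⟨t + t' + 1, by omega, .loopStep hr h h'⟩

/-- A larger oracle answers the same queries in the same way. With the empty oracle on the left,
query-free programs can be reused inside oracle programs (`Exec.of_none`). -/
theorem Runs.mono {O O' : Str → Option Str} (hO : ∀ z a, O z = some a → O' z = some a)
    {p : Prog} {s s' : Store} {t : ℕ} (h : p.Runs O s t s') : p.Runs O' s t s' := by
  induction h with
  | skip s => exact .skip s
  | push r b s => exact .push r b s
  | pop r s => exact .pop r s
  | query r s a h => exact .query r s a (hO _ _ h)
  | seq _ _ ih ih' => exact .seq ih ih'
  | branchNil hr _ ih => exact .branchNil hr ih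
  | branch0 hr _ ih => exact .branch0 hr ih
  | branch1 hr _ ih => exact .branch1 hr ih
  | loopDone hr => exact .loopDone hr
  | loopStep hr _ _ ih ih' => exact .loopStep hr ih ih'

theorem Exec.of_none {p : Prog} {s s' : Store} {T : ℕ} (h : p.Exec (fun _ => none) s T s') :
    p.Exec O s T s' := by
  obtain ⟨t, ht, h⟩ := h
  exact ⟨t, ht, h.mono (by simp)⟩

/-! ### Relocating programs, and bounds on what a run can change -/

/-- The program acting on the stacks `c, c + 1, …` instead of `0, 1, …`. -/
def shift (c : ℕ) : Prog → Prog
  | skip => skip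
  | push r b => push (r + c) b
  | pop r => pop (r + c)
  | query r => query (r + c)
  | seq p q => seq (p.shift c) (q.shift c)
  | branch r pNil p0 p1 => branch (r + c) (pNil.shift c) (p0.shift c) (p1.shift c)
  | loop r p => loop (r + c) (p.shift c)

/-- Put the stacks of `s` above the first `c` stacks of `S`. -/
def _root_.DSR.Store.above (c : ℕ) (S s : Store) : Store := fun i =>
  if i < c then S i else s (i - c)

theorem _root_.DSR.Store.above_add (c : ℕ) (S s : Store) (r : ℕ) :
    Store.above c S s (r + c) = s r := by simp [Store.above]

theorem _root_.DSR.Store.update_above (c : ℕ) (S s : Store) (r : ℕ) (u : Str) :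
    Function.update (Store.above c S s) (r + c) u = Store.above c S (Function.update s r u) := by
  funext i
  simp only [Store.above, Function.update_apply]
  split_ifs <;> first | rfl | omega

theorem Runs.shift {p : Prog} {s s' : Store} {t : ℕ} (h : p.Runs O s t s') (c : ℕ) (S : Store) :
    (p.shift c).Runs O (Store.above c S s) t (Store.above c S s') := by
  induction h with
  | skip s => exact .skip _
  | push r b s =>
    rw [← Store.update_above, ← Store.above_add c S s r]
    exact .push _ _ _
  | pop r s =>
    rw [← Store.update_above, ← Store.above_add c S s r]
    exact .pop _ _
  | query r s a h =>
    rw [← Store.update_above]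
    exact .query _ _ _ (by rwa [Store.above_add])
  | seq _ _ ih ih' => exact .seq ih ih'
  | branchNil hr _ ih => exact .branchNil (by rwa [Store.above_add]) ih
  | branch0 hr _ ih => exact .branch0 (by rwa [Store.above_add]) ih
  | branch1 hr _ ih => exact .branch1 (by rwa [Store.above_add]) ih
  | loopDone hr => exact .loopDone (by rwa [Store.above_add])
  | loopStep hr _ _ ih ih' => exact .loopStep (by rwa [Store.above_add]) ih ih'

/-- One step pushes at most one bit. This needs the empty oracle, since an answer may be long; it is
the reason why polynomial time implies polynomial output length. -/
theorem Runs.length_le {p : Prog} {s s' : Store} {t : ℕ} (h : p.Runs (fun _ => none) s t s')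
    (r : ℕ) : (s' r).length ≤ (s r).length + t := by
  induction h with
  | skip s => omega
  | push k b s =>
    simp only [Function.update_apply]
    split_ifs with h
    · simp [h]
    · omega
  | pop k s =>
    simp only [Function.update_apply]
    split_ifs with h
    · simp only [h, List.length_tail]; omega
    · omega
  | query r s a h => simp at h
  | seq _ _ ih ih' => omega
  | branchNil hr _ ih => omega
  | branch0 hr _ ih => omega
  | branch1 hr _ ih => omega
  | loopDone hr => omega
  | loopStep hr _ _ ih ih' => omega

/-- A bound for the stacks that the program mentions. -/
def regs : Prog → ℕ
  | skip => 0
  | push r _ => r + 1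
  | pop r => r + 1
  | query r => r + 1
  | seq p q => max p.regs q.regs
  | branch r pNil p0 p1 => max (r + 1) (max pNil.regs (max p0.regs p1.regs))
  | loop r p => max (r + 1) p.regs

theorem Runs.eq_of_regs_le {p : Prog} {s s' : Store} {t : ℕ} (h : p.Runs O s t s') {i : ℕ}
    (hi : p.regs ≤ i) : s' i = s i := by
  induction h with
  | skip s => rfl
  | push r b s => exact Function.update_of_ne (by simp only [regs] at hi; omega) _ _
  | pop r s => exact Function.update_of_ne (by simp only [regs] at hi; omega) _ _
  | query r s a h => exact Function.update_of_ne (by simp only [regs] at hi; omega) _ _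
  | seq _ _ ih ih' =>
    simp only [regs, max_le_iff] at hi
    rw [ih' hi.2, ih hi.1]
  | branchNil hr _ ih => simp only [regs, max_le_iff] at hi; exact ih hi.2.1
  | branch0 hr _ ih => simp only [regs, max_le_iff] at hi; exact ih hi.2.2.1
  | branch1 hr _ ih => simp only [regs, max_le_iff] at hi; exact ih hi.2.2.2
  | loopDone hr => rfl
  | loopStep hr _ _ ih ih' =>
    rw [ih' hi]
    simp only [regs, max_le_iff] at hi
    exact ih hi.2

/-- Empty stack `a`, running `q0` or `q1` for every bit. -/
def drain (a : ℕ) (q0 q1 : Prog) : Prog := loop a (branch a skip q0 q1)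

/-- `Φ d u` is the store when the bits `u` are still on stack `a` and the bits `d`, latest first,
have been processed. Each use only has to describe this family of stores and one round of the loop.
-/
theorem exec_drain {a k : ℕ} {q0 q1 : Prog} (Φ : Str → Str → Store)
    (ha : ∀ d u, Φ d u a = u)
    (h : ∀ (d : Str) (c : Bool) (u : Str),
      (if c then q1 else q0).Exec O (Φ d (c :: u)) k (Φ (c :: d) u)) :
    ∀ u d, (drain a q0 q1).Exec O (Φ d u) ((k + 2) * u.length + 1) (Φ (u.reverse ++ d) []) := by
  intro u
  induction u with
  | nil => exact fun d => (exec_loopDone (ha _ _)).mono (by simp)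
  | cons c u ih =>
    intro d
    refine (((h d c u).branchCons (ha _ _)).loopStep (ih (c :: d)) (by simp [ha])).to ?_ (by simp)
    simp only [List.length_cons]; ring_nf; omega

end Prog

/-! ### Stores given by the list of their stacks -/

/-- The store with the given stacks, followed by empty ones. -/
def St (l : List Str) : Store := fun i => l.getD i []

@[simp] theorem St_cons_zero (a : Str) (l : List Str) : St (a :: l) 0 = a := rfl

@[simp] theorem St_cons_succ (a : Str) (l : List Str) (i : ℕ) : St (a :: l) (i + 1) = St l i := rfl

@[simp] theorem St_nil (i : ℕ) : St [] i = [] := rfl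

theorem update_St (l : List Str) (i : ℕ) (u : Str) (hi : i < l.length) :
    Function.update (St l) i u = St (l.set i u) := by
  funext j
  rcases eq_or_ne j i with rfl | h
  · simp [St, hi]
  · simp [St, h, h.symm]

theorem St_append_nil (l : List Str) : St (l ++ [[]]) = St l := by
  funext j
  rcases lt_trichotomy j l.length with h | h | h
  · simp [St, List.getElem?_append, h]
  · simp [St, h]
  · simp only [St, List.getD_eq_getElem?_getD]
    rw [List.getElem?_eq_none (by simp; omega), List.getElem?_eq_none (by omega)]

theorem above_St (l l' : List Str) : Store.above l.length (St l) (St l') = St (l ++ l') := by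
  funext j
  simp only [Store.above, St, List.getD_eq_getElem?_getD, List.getElem?_append]
  split_ifs <;> rfl

theorem initStore_one (x : Str) : initStore ![x] = St [x] := by
  funext i
  rcases i with _ | i <;> simp [initStore, St]

theorem initStore_two (x y : Str) : initStore ![x, y] = St [x, y] := by
  funext i
  rcases i with _ | _ | i <;> simp [initStore, St]

theorem initStore_three (x y z : Str) : initStore ![x, y, z] = St [x, y, z] := by
  funext i
  rcases i with _ | _ | _ | i <;> simp [initStore, St]

namespace Prog

variable {O : Str → Option Str}

theorem Exec.shift_St {p : Prog} {l l' : List Str} {T : ℕ} (h : p.Exec O (St l) T (St l'))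
    (k : List Str) : (p.shift k.length).Exec O (St (k ++ l)) T (St (k ++ l')) := by
  obtain ⟨t, ht, h⟩ := h
  refine ⟨t, ht, ?_⟩
  rw [← above_St, ← above_St]
  exact h.shift _ _

/-- Empty stack `r`. -/
def clear (r : ℕ) : Prog := drain r (pop r) (pop r)

theorem exec_clear (r : ℕ) (s : Store) :
    (clear r).Exec O s (3 * (s r).length + 1) (Function.update s r []) := by
  have := exec_drain (O := O) (k := 1) (a := r) (q0 := pop r) (q1 := pop r)
    (fun _ u => Function.update s r u) (by simp)
    (fun d c u => by rw [ite_self]; exact exec_pop (by simp)) (s r) []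
  simpa [clear] using this

/-- Move the content of stack `a` to stack `b`, reversing it. -/
def moveRev (a b : ℕ) : Prog := drain a (seq (pop a) (push b false)) (seq (pop a) (push b true))

theorem exec_moveRev {a b : ℕ} (hab : a ≠ b) (s : Store) :
    (moveRev a b).Exec O s (4 * (s a).length + 1)
      (Function.update (Function.update s a []) b ((s a).reverse ++ s b)) := by
  have := exec_drain (O := O) (k := 2) (a := a) (q0 := seq (pop a) (push b false))
    (q1 := seq (pop a) (push b true))
    (fun d u => Function.update (Function.update s a u) b (d ++ s b)) (by simp [hab])
    (fun d c u => by
      have h : ∀ e, (if e = true then seq (pop a) (push b true) else seq (pop a) (push b false))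
          = seq (pop a) (push b e) := by simp
      rw [h]
      refine Exec.seq (T := 1) (T' := 1) (exec_pop rfl) (exec_push ?_)
      rw [Function.update_of_ne hab, Function.update_self, Function.update_of_ne hab.symm,
        Function.update_self, Function.update_comm hab.symm, Function.update_idem]
      simp [Function.update_comm hab]) (s a) []
  simpa [moveRev] using this

theorem exec_moveRev_St {a b : ℕ} {l l' : List Str} {u : Str} (hab : a ≠ b) (ha : a < l.length)
    (hb : b < l.length) (hu : l.getD a [] = u)
    (h : (l.set a []).set b (u.reverse ++ l.getD b []) = l') :
    (moveRev a b).Exec O (St l) (4 * u.length + 1) (St l') := by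
  have := exec_moveRev (O := O) hab (St l)
  rw [update_St _ _ _ ha, update_St _ _ _ (by simpa), ] at this
  rw [← h, ← hu]
  exact this

/-- Move the content of stack `0` to the stacks `0` and `2`. -/
def dup : Prog :=
  seq (moveRev 0 1) (drain 1 (seq (pop 1) (seq (push 0 false) (push 2 false)))
    (seq (pop 1) (seq (push 0 true) (push 2 true))))

theorem exec_dup (x : Str) : dup.Exec O (St [x]) (9 * x.length + 2) (St [x, [], x]) := by
  have h1 : (moveRev 0 1).Exec O (St [x]) (4 * x.length + 1) (St [[], x.reverse, []]) := by
    rw [← St_append_nil, ← St_append_nil]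
    exact exec_moveRev_St (by simp) (by simp) (by simp) rfl (by simp)
  have h2 := exec_drain (O := O) (k := 3) (a := 1)
    (q0 := seq (pop 1) (seq (push 0 false) (push 2 false)))
    (q1 := seq (pop 1) (seq (push 0 true) (push 2 true)))
    (fun d u => St [d, u, d]) (by simp [St])
    (fun d c u => by
      have h : ∀ e, (if e = true then seq (pop 1) (seq (push 0 true) (push 2 true)) else
          seq (pop 1) (seq (push 0 false) (push 2 false)))
          = seq (pop 1) (seq (push 0 e) (push 2 e)) := by simp
      rw [h]
      refine (exec_pop rfl).seq (T := 1) (T' := 2) ((exec_push rfl).seq (T := 1) (T' := 1)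
        (exec_push ?_))
      simp [update_St, St]) x.reverse []
  refine (h1.seq (by simpa using h2)).mono ?_
  omega

end Prog

/-! ### Pairs -/

/-- Self-delimiting code of a string. -/
def dbl : Str → Str
  | [] => [false]
  | b :: a => true :: b :: dbl a

@[simp] theorem length_dbl (a : Str) : (dbl a).length = 2 * a.length + 1 := by
  induction a with
  | nil => rfl
  | cons b a ih => simp only [dbl, List.length_cons, ih]; omega

namespace Prog

variable {O : Str → Option Str}

/-- Prepend the self-delimiting code of the reversal of stack `1` to stack `0`. -/
def pairUp : Prog :=
  seq (push 0 false) (drain 1 (seq (pop 1) (seq (push 0 false) (push 0 true)))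
    (seq (pop 1) (seq (push 0 true) (push 0 true))))

theorem exec_pairUp (a b : Str) :
    pairUp.Exec O (St [b, a.reverse]) (5 * a.length + 2) (St [dbl a ++ b]) := by
  have h1 : (push 0 false).Exec O (St [b, a.reverse]) 1 (St [dbl [] ++ b, a.reverse]) :=
    exec_push (by simp [update_St, dbl])
  have h2 := exec_drain (O := O) (k := 3) (a := 1)
    (q0 := seq (pop 1) (seq (push 0 false) (push 0 true)))
    (q1 := seq (pop 1) (seq (push 0 true) (push 0 true)))
    (fun d u => St [dbl d ++ b, u]) (by simp [St])
    (fun d c u => by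
      have h : ∀ e, (if e = true then seq (pop 1) (seq (push 0 true) (push 0 true)) else
          seq (pop 1) (seq (push 0 false) (push 0 true)))
          = seq (pop 1) (seq (push 0 e) (push 0 true)) := by simp
      rw [h]
      refine (exec_pop rfl).seq (T := 1) (T' := 2) ((exec_push rfl).seq (T := 1) (T' := 1)
        (exec_push ?_))
      simp [update_St, St, dbl]) a.reverse []
  refine (h1.seq h2).to (by simp; omega) ?_
  simpa using St_append_nil [dbl a ++ b]

/-- Inverse of `pairUp`. -/
def unpair : Prog :=
  seq (push 2 true) (loop 2 (branch 0 (pop 2) (seq (pop 0) (pop 2))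
    (seq (pop 0) (branch 0 skip (seq (pop 0) (push 1 false)) (seq (pop 0) (push 1 true))))))

theorem exec_unpair (a b : Str) :
    unpair.Exec O (St [dbl a ++ b]) (6 * a.length + 6) (St [b, a.reverse]) := by
  have h0 : (push 2 true).Exec O (St [dbl a ++ b]) 1 (St [dbl a ++ b, [], [true]]) := by
    rw [← St_append_nil, ← St_append_nil]
    exact exec_push (by simp [update_St, St])
  -- Stack 2 is a flag that keeps the loop alive; it is popped when the terminating 0 of the
  -- self-delimiting code is read. The decoded bits pile up on stack 1, hence reversed.
  have key : ∀ d, (loop 2 (branch 0 (pop 2) (seq (pop 0) (pop 2))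
    (seq (pop 0) (branch 0 skip (seq (pop 0) (push 1 false))
      (seq (pop 0) (push 1 true)))))).Exec O (St [dbl a ++ b, d, [true]]) (6 * a.length + 5)
        (St [b, a.reverse ++ d, []]) := by
    induction a with
    | nil =>
      intro d
      refine Exec.loopStep (T := 3) (T' := 1) (s' := St [b, d, []]) ?_ (exec_loopDone rfl)
        (by simp [St])
      refine Exec.branchCons (c := false) (u := b) (T := 2) ?_ rfl
      exact (exec_pop rfl).seq (T := 1) (T' := 1) (exec_pop (by simp [update_St, St, dbl]))
    | cons c a ih =>
      intro d
      have hstep := ih (h0 := exec_push (by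
        rw [← St_append_nil, ← St_append_nil]; simp [update_St, St])) (c :: d)
      refine (Exec.loopStep (T := 5) (s' := St [dbl a ++ b, c :: d, [true]]) ?_
        (by simpa using hstep) (by simp [St])).mono (by simp; omega)
      refine Exec.branchCons (c := true) (u := c :: (dbl a ++ b)) (T := 4) ?_ rfl
      refine Exec.seq (T := 1) (T' := 3) (s' := St [c :: (dbl a ++ b), d, [true]])
        (exec_pop (by simp [update_St, St, dbl])) ?_
      refine Exec.branchCons (c := c) (u := dbl a ++ b) (T := 2) ?_ rfl
      have h : ∀ e, (if e = true then seq (pop 0) (push 1 true) else seq (pop 0) (push 1 false))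
          = seq (pop 0) (push 1 e) := by simp
      rw [h]
      exact (exec_pop rfl).seq (T := 1) (T' := 1) (exec_push (by simp [update_St, St]))
  refine (h0.seq (key [])).to (by omega) ?_
  simpa using St_append_nil [b, a.reverse]

end Prog

/-! ### Polynomial bounds -/

theorem eval_poly_mono (P : Polynomial ℕ) {a b : ℕ} (h : a ≤ b) : P.eval a ≤ P.eval b := by
  rw [Polynomial.eval_eq_sum, Polynomial.eval_eq_sum]
  exact Finset.sum_le_sum fun i _ => Nat.mul_le_mul_left _ (Nat.pow_le_pow_left h i)

/-- Types whose elements are coded by strings. -/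
class Code (α : Type) where
  enc : α → Str

open Code (enc)

variable {α β γ δ σ : Type} [Code α] [Code β] [Code γ] [Code δ] [Code σ]

/-- The length of the code. -/
def size (a : α) : ℕ := (enc a).length

/-- Functions bounded by a polynomial in the length of the code. -/
@[fun_prop]
def PB (m : α → ℕ) : Prop := ∃ P : Polynomial ℕ, ∀ a, m a ≤ P.eval (size a)

theorem PB.mono {m m' : α → ℕ} (h : PB m) (hm : ∀ a, m' a ≤ m a) : PB m' := by
  obtain ⟨P, hP⟩ := h
  exact ⟨P, fun a => (hm a).trans (hP a)⟩

theorem PB.const (c : ℕ) : PB (fun _ : α => c) := ⟨Polynomial.C c, by simp⟩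

theorem PB.size : PB (fun a : α => size a) := ⟨Polynomial.X, by simp⟩

theorem PB.add {m m' : α → ℕ} (h : PB m) (h' : PB m') : PB (fun a => m a + m' a) := by
  obtain ⟨P, hP⟩ := h
  obtain ⟨Q, hQ⟩ := h'
  exact ⟨P + Q, fun a => by rw [Polynomial.eval_add]; exact Nat.add_le_add (hP a) (hQ a)⟩

theorem PB.mul {m m' : α → ℕ} (h : PB m) (h' : PB m') : PB (fun a => m a * m' a) := by
  obtain ⟨P, hP⟩ := h
  obtain ⟨Q, hQ⟩ := h'
  exact ⟨P * Q, fun a => by rw [Polynomial.eval_mul]; exact Nat.mul_le_mul (hP a) (hQ a)⟩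

theorem PB.eval {m : α → ℕ} (h : PB m) (P : Polynomial ℕ) : PB (fun a => P.eval (m a)) := by
  obtain ⟨Q, hQ⟩ := h
  exact ⟨P.comp Q, fun a => by rw [Polynomial.eval_comp]; exact eval_poly_mono _ (hQ a)⟩

theorem PB.comp {m : β → ℕ} {f : α → β} (h : PB m) (hf : PB fun a => DSR.size (f a)) :
    PB (fun a => m (f a)) := by
  obtain ⟨P, hP⟩ := h
  exact (hf.eval P).mono fun a => hP _

/-! ### Polynomial-time functions between coded types -/

instance : Code Str := ⟨id⟩
instance : Code Bool := ⟨fun b => [b]⟩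
-- Unary, so that polynomials of lengths are polynomial-time values and a code can serve as a loop
-- counter.
instance : Code ℕ := ⟨unary⟩
-- Only the first component is delimited. Hence a nonempty list has the same code as the pair of its
-- head and tail, and the code of `(a, v)` ends with `v` verbatim, so that `v` can be fed to a
-- circuit as input.
instance : Code (α × β) := ⟨fun a => dbl (enc a.1) ++ enc a.2⟩
instance : Code (Option α) := ⟨fun o => o.elim [] fun a => true :: enc a⟩
instance {P : α → Prop} : Code {a // P a} := ⟨fun a => enc a.1⟩

/-- Types which may be used as types of list elements. (Lists of bits have their own code.) -/
class Elem (α : Type) : Prop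

instance : Elem Str := ⟨⟩
instance : Elem (α × β) := ⟨⟩

instance [Elem α] : Code (List α) := ⟨fun l => l.foldr (fun a u => dbl (enc a) ++ u) []⟩

theorem enc_str (x : Str) : enc x = x := rfl
theorem enc_bool (b : Bool) : enc b = [b] := rfl
theorem enc_nat (n : ℕ) : enc n = unary n := rfl
theorem enc_pair (a : α) (b : β) : enc (a, b) = dbl (enc a) ++ enc b := rfl
theorem enc_some (a : α) : enc (some a) = true :: enc a := rfl
theorem enc_nil [Elem α] : enc ([] : List α) = [] := rfl
theorem enc_cons [Elem α] (a : α) (l : List α) : enc (a :: l) = dbl (enc a) ++ enc l := rfl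

theorem size_str (x : Str) : size x = x.length := rfl
theorem size_bool (b : Bool) : size b = 1 := rfl
theorem size_nat (n : ℕ) : size n = n := List.length_replicate
theorem size_pair (a : α) (b : β) : size (a, b) = 2 * size a + 1 + size b := by
  simp [size, enc_pair]
theorem size_none : size (none : Option α) = 0 := rfl
theorem size_some (a : α) : size (some a) = size a + 1 := rfl
theorem size_nil [Elem α] : size ([] : List α) = 0 := rfl
theorem size_cons [Elem α] (a : α) (l : List α) : size (a :: l) = 2 * size a + 1 + size l := by
  simp [size, enc_cons]

/-- `f` is computed by a polynomial-time program, working on the codes of its argument and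
value on stack `0`, and leaving no garbage on the other stacks. -/
@[fun_prop]
def FP (f : α → β) : Prop :=
  ∃ (p : Prog) (m : α → ℕ), PB m ∧
    ∀ a, p.Exec (fun _ => none) (St [enc a]) (m a) (St [enc (f a)])

/-- The value is at most as long as the argument plus the running time. -/
theorem FP.pb {f : α → β} (hf : FP f) : PB fun a => size (f a) := by
  obtain ⟨p, m, hm, h⟩ := hf
  refine (PB.size.add hm).mono fun a => ?_
  obtain ⟨t, ht, h⟩ := h a
  have := h.length_le 0
  simp only [St_cons_zero] at this
  simp only [size]
  omega

theorem FP.of_eq {f g : α → β} (hf : FP f) (h : ∀ a, f a = g a) : FP g := by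
  rwa [← funext h]

theorem FP.of_enc {f : α → β} (h : ∀ a, enc (f a) = enc a) : FP f :=
  ⟨.skip, fun _ => 1, PB.const 1, fun a => by rw [h]; exact Prog.exec_skip _⟩

theorem FP.id : FP (fun a : α => a) := .of_enc fun _ => rfl

theorem FP.comp {g : β → γ} {f : α → β} (hg : FP g) (hf : FP f) : FP fun a => g (f a) := by
  have hb := hf.pb
  obtain ⟨p, m, hm, h⟩ := hf
  obtain ⟨q, k, hk, h'⟩ := hg
  exact ⟨.seq p q, _, hm.add (hk.comp hb), fun a => (h a).seq (h' _)⟩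

theorem FP.val {P : α → Prop} : FP (fun a : {a // P a} => a.1) := .of_enc fun _ => rfl

theorem FP.cons (b : Bool) : FP fun x : Str => b :: x :=
  ⟨.push 0 b, fun _ => 1, PB.const 1, fun _ => Prog.exec_push (update_St _ _ _ (by simp))⟩

theorem FP.tail : FP fun x : Str => x.tail :=
  ⟨.pop 0, fun _ => 1, PB.const 1, fun _ => Prog.exec_pop (update_St _ _ _ (by simp))⟩

theorem FP.nil : FP fun _ : α => ([] : Str) := by
  refine ⟨.clear 0, _, (((PB.const 3).mul PB.size).add (PB.const 1)), fun a => ?_⟩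
  refine (Prog.exec_clear 0 (St [enc a])).to le_rfl ?_
  rw [update_St _ _ _ (by simp)]
  rfl

theorem FP.constStr (u : Str) : FP fun _ : α => u := by
  induction u with
  | nil => exact .nil
  | cons b u ih => exact (FP.cons b).comp ih

theorem FP.const (b : β) : FP fun _ : α => b := by
  obtain ⟨p, m, hm, h⟩ := FP.constStr (α := α) (enc b)
  exact ⟨p, m, hm, h⟩

theorem FP.isNil : FP fun x : Str => x.isEmpty := by
  refine ⟨.branch 0 (.push 0 true) (.seq (.clear 0) (.push 0 false))
    (.seq (.clear 0) (.push 0 false)), _, ((PB.const 3).mul PB.size).add (PB.const 3), fun x => ?_⟩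
  rcases x with _ | ⟨c, x⟩
  · exact (Prog.Exec.branchNil (Prog.exec_push (by simp [update_St, enc])) rfl).mono (by omega)
  · refine (Prog.Exec.branchCons (c := c) (u := x) (T := 3 * (c :: x).length + 1 + 1) ?_ rfl).mono
      le_rfl
    rw [ite_self]
    exact (Prog.exec_clear 0 _).seq (Prog.exec_push (by simp [update_St, enc]))

theorem FP.headD : FP fun x : Str => x.headD false := by
  refine ⟨.branch 0 (.push 0 false) (.seq (.clear 0) (.push 0 false))
    (.seq (.clear 0) (.push 0 true)), _, ((PB.const 3).mul PB.size).add (PB.const 3), fun x => ?_⟩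
  rcases x with _ | ⟨c, x⟩
  · exact (Prog.Exec.branchNil (Prog.exec_push (by simp [update_St, enc])) rfl).mono (by omega)
  · refine (Prog.Exec.branchCons (c := c) (u := x) (T := 3 * (c :: x).length + 1 + 1) ?_ rfl).mono
      le_rfl
    cases c
    · exact (Prog.exec_clear 0 _).seq (Prog.exec_push (by simp [update_St, enc]))
    · exact (Prog.exec_clear 0 _).seq (Prog.exec_push (by simp [update_St, enc]))

theorem FP.fst : FP fun a : α × β => a.1 := by
  refine ⟨.seq .unpair (.seq (.clear 0) (.moveRev 1 0)), _,
    ((PB.const 13).mul PB.size).add (PB.const 8), fun a => ?_⟩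
  refine ((Prog.exec_unpair (enc a.1) (enc a.2)).seq (((Prog.exec_clear 0 _).to le_rfl
    (update_St _ _ _ (by simp))).seq (Prog.exec_moveRev_St (by simp) (by simp) (by simp) rfl
      rfl))).to ?_ ?_
  · have : size a = _ := size_pair a.1 a.2
    simp only [size, St_cons_zero] at this ⊢
    simp
    omega
  · simpa using St_append_nil [enc a.1]

theorem FP.snd : FP fun a : α × β => a.2 := by
  refine ⟨.seq .unpair (.clear 1), _,
    ((PB.const 13).mul PB.size).add (PB.const 8), fun a => ?_⟩
  refine ((Prog.exec_unpair (enc a.1) (enc a.2)).seq ((Prog.exec_clear 1 _).to le_rfl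
    (update_St _ _ _ (by simp)))).to ?_ ?_
  · have : size a = _ := size_pair a.1 a.2
    simp only [size, St_cons_succ, St_cons_zero] at this ⊢
    simp
    omega
  · simpa using St_append_nil [enc a.2]

/-- The argument is duplicated. One copy waits below while the other becomes the first value, which
is then set aside reversed on stack 1, as `pairUp` expects; the waiting copy is moved up to compute
the second value. -/
theorem FP.pair {f : α → β} {g : α → γ} (hf : FP f) (hg : FP g) : FP fun a => (f a, g a) := by
  have bf := hf.pb
  have bg := hg.pb
  obtain ⟨p, m, hm, h⟩ := hf
  obtain ⟨q, k, hk, h'⟩ := hg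
  refine ⟨.seq .dup (.seq (p.shift 2) (.seq (.moveRev 2 1) (.seq (.moveRev 0 3) (.seq (.moveRev 3 2)
    (.seq (q.shift 2) (.seq (.moveRev 2 3) (.seq (.moveRev 3 0) .pairUp))))))),
    fun a => 17 * size a + 9 * size (f a) + 8 * size (g a) + m a + k a + 10, ?_, fun a => ?_⟩
  · exact ((((((PB.const 17).mul PB.size).add ((PB.const 9).mul bf)).add
      ((PB.const 8).mul bg)).add hm).add hk).add (PB.const 10)
  · have e1 := (h a).shift_St [enc a, []]
    have e2 : (Prog.moveRev 2 1).Exec (fun _ => none) (St [enc a, [], enc (f a)])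
        (4 * size (f a) + 1) (St [enc a, (enc (f a)).reverse, [], []]) :=
      (Prog.exec_moveRev_St (by simp) (by simp) (by simp) rfl rfl).to le_rfl
        (by simpa using (St_append_nil [enc a, (enc (f a)).reverse, []]).symm)
    have e3 : (Prog.moveRev 0 3).Exec (fun _ => none) (St [enc a, (enc (f a)).reverse, [], []])
        (4 * size a + 1) (St [[], (enc (f a)).reverse, [], (enc a).reverse]) :=
      Prog.exec_moveRev_St (by simp) (by simp) (by simp) rfl (by simp)
    have e4 : (Prog.moveRev 3 2).Exec (fun _ => none)
        (St [[], (enc (f a)).reverse, [], (enc a).reverse])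
        (4 * size a + 1) (St [[], (enc (f a)).reverse, enc a]) :=
      (Prog.exec_moveRev_St (by simp) (by simp) (by simp) rfl rfl).to (by simp [size])
        (by simpa using (St_append_nil [[], (enc (f a)).reverse, enc a]))
    have e5 := (h' a).shift_St [[], (enc (f a)).reverse]
    have e6 : (Prog.moveRev 2 3).Exec (fun _ => none)
        (St ([[], (enc (f a)).reverse] ++ [enc (g a)]))
        (4 * size (g a) + 1) (St [[], (enc (f a)).reverse, [], (enc (g a)).reverse]) := by
      rw [← St_append_nil]
      exact Prog.exec_moveRev_St (by simp) (by simp) (by simp) rfl (by simp)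
    have e7 : (Prog.moveRev 3 0).Exec (fun _ => none)
        (St [[], (enc (f a)).reverse, [], (enc (g a)).reverse])
        (4 * size (g a) + 1) (St [enc (g a), (enc (f a)).reverse]) := by
      refine (Prog.exec_moveRev_St (by simp) (by simp) (by simp) rfl rfl).to (by simp [size]) ?_
      simpa using (St_append_nil [enc (g a), (enc (f a)).reverse, []]).trans (St_append_nil [_, _])
    refine ((Prog.exec_dup _).seq (e1.seq (e2.seq (e3.seq (e4.seq (e5.seq (e6.seq (e7.seq
      (Prog.exec_pairUp _ _))))))))).to ?_ rfl
    simp only [size]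
    omega

/-- Each branch has to be computable only where it is taken. This allows programs that are right
only on part of the type, such as removing the tag of an `Option` or splitting a nonempty list. -/
theorem FP.ite {b : α → Bool} {f : α → β} (hb : FP b)
    (h1 : FP fun a : {a // b a = true} => f a.1) (h0 : FP fun a : {a // b a = false} => f a.1) :
    FP f := by
  obtain ⟨q, k, ⟨K, hk⟩, h⟩ := hb
  obtain ⟨p1, m1, ⟨M1, hm1⟩, h1⟩ := h1
  obtain ⟨p0, m0, ⟨M0, hm0⟩, h0⟩ := h0
  refine ⟨.seq .dup (.seq (q.shift 2) (.branch 2 .skip (.seq (.pop 2) p0) (.seq (.pop 2) p1))),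
    _, (((((PB.const 9).mul PB.size).add (PB.size.eval K)).add (PB.size.eval M1)).add
      (PB.size.eval M0)).add (PB.const 4), fun a => ?_⟩
  have e1 := (h a).shift_St [enc a, []]
  have e2 : (Prog.pop 2).Exec (fun _ => none) (St [enc a, [], [b a]]) 1 (St [enc a]) := by
    refine Prog.exec_pop ?_
    rw [update_St _ _ _ (by simp)]
    simpa using (St_append_nil [enc a, []]).trans (St_append_nil [_])
  have e3 : (Prog.branch 2 .skip (.seq (.pop 2) p0) (.seq (.pop 2) p1)).Exec (fun _ => none)
      (St [enc a, [], [b a]]) (M1.eval (size a) + M0.eval (size a) + 2) (St [enc (f a)]) := by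
    refine (Prog.Exec.branchCons (c := b a) (u := [])
      (T := M1.eval (size a) + M0.eval (size a) + 1) ?_ rfl)
    cases hba : b a with
    | true =>
      rw [hba] at e2
      refine (e2.seq ((h1 ⟨a, hba⟩).mono (hm1 ⟨a, hba⟩))).mono ?_
      simp only [size, enc]
      omega
    | false =>
      rw [hba] at e2
      refine (e2.seq ((h0 ⟨a, hba⟩).mono (hm0 ⟨a, hba⟩))).mono ?_
      simp only [size, enc]
      omega
  refine ((Prog.exec_dup _).seq (e1.seq e3)).to ?_ rfl
  have := hk a
  simp only [size] at *
  omega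

theorem FP.cond {b : α → Bool} {f g : α → β} (hb : FP b) (hf : FP f) (hg : FP g) :
    FP fun a => bif b a then f a else g a :=
  .ite hb ((hf.comp FP.val).of_eq fun a => by simp [a.2])
    ((hg.comp FP.val).of_eq fun a => by simp [a.2])

/-- Iteration, as often as the length of the code of `n a` says, of a polynomial-time function
on states of polynomial size. -/
theorem FP.iterate {n : α → β} {init : α → σ} {step : σ → σ} (hn : FP n) (hi : FP init)
    (hs : FP step) {B : α → ℕ} (hB : PB B)
    (hsize : ∀ a, ∀ i ≤ size (n a), size (step^[i] (init a)) ≤ B a) :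
    FP fun a => step^[size (n a)] (init a) := by
  have bn := hn.pb
  have hp := hi.pair hn
  obtain ⟨p, m, hm, h⟩ := hp
  obtain ⟨q, k, ⟨K, hk⟩, h'⟩ := hs
  refine ⟨.seq p (.seq .unpair (.seq (.moveRev 1 2) (.seq (.loop 0 (.seq (.pop 0) (q.shift 2)))
    (.seq (.moveRev 2 1) (.moveRev 1 0))))), _,
    ((((hm.add ((PB.const 18).mul hB)).add (bn.mul (hB.eval K))).add ((PB.const 2).mul bn)).add
      (PB.const 10)), fun a => ?_⟩
  have e1 : (Prog.moveRev 1 2).Exec (fun _ => none) (St [enc (n a), (enc (init a)).reverse])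
      (4 * size (init a) + 1) (St [enc (n a), [], enc (init a)]) := by
    rw [← St_append_nil]
    refine (Prog.exec_moveRev_St (by simp) (by simp) (by simp) rfl (by simp)).to (by simp [size])
      rfl
  -- The code of `n a` on stack 0 is the counter: one bit is popped per round, while the state is
  -- transformed on stack 2.
  have e2 : ∀ (u : Str) (i : ℕ), i + u.length = size (n a) →
      (Prog.loop 0 (.seq (.pop 0) (q.shift 2))).Exec (fun _ => none)
        (St [u, [], enc (step^[i] (init a))]) (u.length * (K.eval (B a) + 2) + 1)
        (St [[], [], enc (step^[size (n a)] (init a))]) := by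
    intro u
    induction u with
    | nil =>
      intro i hi
      simp only [List.length_nil, add_zero] at hi
      subst hi
      exact (Prog.exec_loopDone rfl).mono (by simp)
    | cons c u ih =>
      intro i hi
      have hlen : i + 1 + u.length = size (n a) := by simp only [List.length_cons] at hi; omega
      have e := ih (i + 1) hlen
      rw [Function.iterate_succ_apply'] at e
      have e0 : (Prog.pop 0).Exec (fun _ => none) (St [c :: u, [], enc (step^[i] (init a))]) 1
          (St ([u, []] ++ [enc (step^[i] (init a))])) := Prog.exec_pop (by simp [update_St])
      refine ((e0.seq ((h' (step^[i] (init a))).shift_St [u, []])).loopStep e (by simp)).mono ?_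
      have h1 := (hk (step^[i] (init a))).trans (eval_poly_mono K (hsize a i (by omega)))
      simp only [List.length_cons]
      have h2 : (u.length + 1) * (K.eval (B a) + 2) =
        u.length * (K.eval (B a) + 2) + K.eval (B a) + 2 := by ring
      omega
  have e3 : (Prog.moveRev 2 1).Exec (fun _ => none)
      (St [[], [], enc (step^[size (n a)] (init a))]) (4 * B a + 1)
      (St [[], (enc (step^[size (n a)] (init a))).reverse]) := by
    refine (Prog.exec_moveRev_St (by simp) (by simp) (by simp) rfl rfl).to ?_ ?_
    · have := hsize a _ le_rfl
      simp only [size] at this ⊢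
      simp
      omega
    · rw [← St_append_nil [_, _]]
      simp
  have e4 : (Prog.moveRev 1 0).Exec (fun _ => none)
      (St [[], (enc (step^[size (n a)] (init a))).reverse]) (4 * B a + 1)
      (St [enc (step^[size (n a)] (init a))]) := by
    refine (Prog.exec_moveRev_St (by simp) (by simp) (by simp) rfl rfl).to ?_ ?_
    · have := hsize a _ le_rfl
      simp only [size] at this ⊢
      simp
      omega
    · rw [← St_append_nil [_]]
      simp
  refine ((h a).seq ((Prog.exec_unpair _ _).seq (e1.seq ((e2 _ 0 (by simp [size])).seq
    (e3.seq e4))))).to ?_ rfl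
  have h0 := hsize a 0 (Nat.zero_le _)
  simp only [Function.iterate_zero_apply] at h0
  simp only [size] at *
  ring_nf
  omega

/-! ### Comparison with polynomial-time computability for several inputs -/

namespace Prog

/-- Empty the stacks `1, …, n`. -/
def clearUpTo : ℕ → Prog
  | 0 => skip
  | n + 1 => seq (clearUpTo n) (clear (n + 1))

theorem exec_clearUpTo {O : Str → Option Str} (n B : ℕ) (s : Store) (h : ∀ r, (s r).length ≤ B) :
    (clearUpTo n).Exec O s (n * (3 * B + 1) + 1)
      (fun i => if 0 < i ∧ i ≤ n then [] else s i) := by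
  induction n with
  | zero =>
    refine (exec_skip s).to (by simp) ?_
    funext i
    rw [if_neg (by omega)]
  | succ n ih =>
    refine (ih.seq (exec_clear _ _)).to ?_ ?_
    · have := h (n + 1)
      simp only [add_le_iff_nonpos_right, nonpos_iff_eq_zero, one_ne_zero, and_false, if_false]
      have e : (n + 1) * (3 * B + 1) = n * (3 * B + 1) + 3 * B + 1 := by ring
      omega
    · funext i
      simp only [Function.update_apply]
      split_ifs <;> first | rfl | omega

/-- From two stacks to the code of a pair. -/
def pack : Prog :=
  seq (moveRev 0 2) (seq (moveRev 1 3) (seq (moveRev 3 0) (seq (moveRev 2 3) (seq (moveRev 3 1)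
    pairUp))))

theorem exec_pack {O : Str → Option Str} (x y : Str) :
    pack.Exec O (St [x, y]) (17 * x.length + 8 * y.length + 7) (St [dbl x ++ y]) := by
  have hpad : St [x, y] = St [x, y, [], []] :=
    ((St_append_nil [x, y, []]).trans (St_append_nil [x, y])).symm
  have hpad' : St [y, x.reverse, [], []] = St [y, x.reverse] :=
    (St_append_nil [y, x.reverse, []]).trans (St_append_nil [y, x.reverse])
  rw [hpad]
  refine ((exec_moveRev_St (u := x) (l' := [[], y, x.reverse, []]) (by simp) (by simp) (by simp)
    rfl (by simp)).seq ((exec_moveRev_St (u := y) (l' := [[], [], x.reverse, y.reverse]) (by simp)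
    (by simp) (by simp) rfl (by simp)).seq ((exec_moveRev_St (u := y.reverse)
    (l' := [y, [], x.reverse, []]) (by simp) (by simp) (by simp) rfl (by simp)).seq
    ((exec_moveRev_St (u := x.reverse) (l' := [y, [], [], x]) (by simp) (by simp) (by simp) rfl
    (by simp)).seq ((exec_moveRev_St (u := x) (l' := [y, x.reverse, [], []]) (by simp) (by simp)
    (by simp) rfl (by simp)).seq (hpad' ▸ exec_pairUp x y)))))).to ?_ rfl
  simp only [List.length_reverse]
  omega

/-- From the code of a pair to two stacks. -/
def unpack : Prog :=
  seq unpair (seq (moveRev 0 2) (seq (moveRev 1 0) (moveRev 2 1)))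

theorem exec_unpack {O : Str → Option Str} (x y : Str) :
    unpack.Exec O (St [dbl x ++ y]) (10 * x.length + 8 * y.length + 9) (St [x, y]) := by
  have hpad : St [y, x.reverse, []] = St [y, x.reverse] := St_append_nil [y, x.reverse]
  refine ((exec_unpair x y).seq (hpad ▸ ((exec_moveRev_St (u := y)
    (l' := [[], x.reverse, y.reverse]) (by simp) (by simp) (by simp) rfl (by simp)).seq
    ((exec_moveRev_St (u := x.reverse) (l' := [x, [], y.reverse]) (by simp) (by simp) (by simp)
    rfl (by simp)).seq (exec_moveRev_St (u := y.reverse) (l' := [x, y, []]) (by simp) (by simp)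
    (by simp) rfl (by simp)))))).to ?_ (St_append_nil [x, y])
  simp only [List.length_reverse]
  omega

end Prog

theorem initStore_of_le {k : ℕ} (v : Fin k → Str) {i : ℕ} (hi : k ≤ i) : initStore v i = [] :=
  dif_neg (by omega)

theorem length_initStore_le {k : ℕ} (v : Fin k → Str) (i : ℕ) :
    (initStore v i).length ≤ ∑ j, (v j).length := by
  unfold initStore
  split_ifs with h
  · exact Finset.single_le_sum (f := fun j => (v j).length) (fun _ _ => Nat.zero_le _)
      (Finset.mem_univ (⟨i, h⟩ : Fin k))
  · simp

/-- `PolyTime` tolerates garbage on the other stacks, `FP` does not. Only stacks below `max k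
p.regs` can be nonempty, and their heights are bounded by input length plus time, so clearing them
is affordable. -/
theorem FP.of_polyTime {k : ℕ} {F : (Fin k → Str) → Str} (hF : PolyTime k F)
    {v : α → Fin k → Str} {u : Prog} {m : α → ℕ} (hm : PB m)
    (hu : ∀ a, u.Exec (fun _ => none) (St [enc a]) (m a) (initStore (v a)))
    (hv : PB fun a => ∑ i, (v a i).length) : FP fun a => F (v a) := by
  obtain ⟨p, T, h⟩ := hF
  refine ⟨.seq u (.seq p (.clearUpTo (max k p.regs))), _, hm.add ((hv.eval T).add
    (((PB.const (max k p.regs)).mul (((PB.const 3).mul (hv.add (hv.eval T))).add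
      (PB.const 1))).add (PB.const 1))), fun a => ?_⟩
  obtain ⟨t, s', ht, hr, ho⟩ := h (v a)
  have hlen : ∀ r, (s' r).length ≤ ∑ i, (v a i).length + T.eval (∑ i, (v a i).length) := fun r =>
    (hr.length_le r).trans (Nat.add_le_add (length_initStore_le _ _) ht)
  refine ((hu a).seq (Prog.Exec.seq ⟨t, ht, hr⟩ (Prog.exec_clearUpTo _ _ _ hlen))).to le_rfl ?_
  funext i
  rcases i with _ | i
  · simpa [enc_str] using ho
  · rw [St_cons_succ, St_nil]
    split_ifs with hi
    · rfl
    · simp only [not_and, not_le, Nat.zero_lt_succ, true_implies, max_lt_iff] at hi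
      rw [hr.eq_of_regs_le (by omega), initStore_of_le _ (by omega)]

theorem FP.of_polyTime_one {F : (Fin 1 → Str) → Str} (hF : PolyTime 1 F) :
    FP fun x : Str => F ![x] :=
  .of_polyTime hF (PB.const 1) (fun a => (Prog.exec_skip _).to le_rfl (initStore_one a).symm)
    (PB.size.mono fun a => by simp [size_str])

theorem FP.of_polyTime_two {F : (Fin 2 → Str) → Str} (hF : PolyTime 2 F) :
    FP fun a : Str × Str => F ![a.1, a.2] := by
  refine .of_polyTime hF (((PB.const 8).mul PB.size).add (PB.const 9)) (fun a =>
    (Prog.exec_unpack a.1 a.2).to ?_ (initStore_two _ _).symm)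
    (PB.size.mono fun a => ?_) <;> have : size a = _ := size_pair a.1 a.2
  · simp only [size_str] at this
    omega
  · simp only [Fin.sum_univ_two, size_str] at this ⊢
    simp
    omega

theorem FP.of_polyTime_three {F : (Fin 3 → Str) → Str} (hF : PolyTime 3 F) :
    FP fun a : Str × Str × Str => F ![a.1, a.2.1, a.2.2] := by
  have key : ∀ a : Str × Str × Str, (Prog.seq .unpack (Prog.unpack.shift 1)).Exec (fun _ => none)
      (St [enc a]) (8 * size a + 9 + (8 * size a + 9)) (initStore ![a.1, a.2.1, a.2.2]) := by
    intro a
    have h1 : size a = _ := size_pair a.1 a.2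
    have h2 : size a.2 = _ := size_pair a.2.1 a.2.2
    simp only [size_str] at h1 h2
    refine ((Prog.exec_unpack a.1 (enc a.2)).mono ?_).seq ?_
    · simp only [size] at h1 h2 ⊢
      omega
    · rw [initStore_three]
      refine ((Prog.exec_unpack a.2.1 a.2.2).shift_St [a.1]).mono ?_
      omega
  refine .of_polyTime hF ((((PB.const 8).mul PB.size).add (PB.const 9)).add
    (((PB.const 8).mul PB.size).add (PB.const 9))) key
    (PB.size.mono fun a => ?_)
  have h1 : size a = _ := size_pair a.1 a.2
  have h2 : size a.2 = _ := size_pair a.2.1 a.2.2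
  simp only [size_str] at h1 h2
  simp only [Fin.sum_univ_three]
  simp
  omega

theorem FP.polyTime {k : ℕ} {f : α → Str} (hf : FP f) {φ : (Fin k → Str) → α} {u : Prog} {c : ℕ}
    (hu : ∀ v, u.Exec (fun _ => none) (initStore v) (c * ∑ i, (v i).length + c) (St [enc (φ v)]))
    (hφ : ∀ v, size (φ v) ≤ c * ∑ i, (v i).length + c) : PolyTime k fun v => f (φ v) := by
  obtain ⟨p, m, ⟨M, hM⟩, h⟩ := hf
  refine ⟨.seq u p, Polynomial.C c * .X + Polynomial.C c +
    M.comp (Polynomial.C c * .X + Polynomial.C c),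
    fun v => ?_⟩
  obtain ⟨t, ht, hr⟩ := (hu v).seq (h (φ v))
  refine ⟨t, _, ht.trans ?_, hr, rfl⟩
  have := (hM (φ v)).trans (eval_poly_mono M (hφ v))
  simpa using this

theorem FP.polyTime_one {f : Str → Str} (hf : FP f) : PolyTime 1 fun v => f (v 0) := by
  refine hf.polyTime (φ := fun v : Fin 1 → Str => v 0) (u := .skip) (c := 1) (fun v => ?_)
    fun v => ?_
  · refine (Prog.exec_skip _).to (by omega) ?_
    have : v = ![v 0] := by funext i; fin_cases i; rfl
    rw [this]
    exact initStore_one _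
  · simp [size_str]

theorem FP.polyTime_two {f : Str × Str → Str} (hf : FP f) : PolyTime 2 fun v => f (v 0, v 1) := by
  refine hf.polyTime (φ := fun v : Fin 2 → Str => (v 0, v 1)) (u := .pack) (c := 17) (fun v => ?_)
    fun v => ?_
  · have : v = ![v 0, v 1] := by funext i; fin_cases i <;> rfl
    have h := Prog.exec_pack (O := fun _ => none) (v 0) (v 1)
    rw [← initStore_two, ← this] at h
    refine h.mono ?_
    simp only [Fin.sum_univ_two]
    omega
  · simp only [size_pair, size_str, Fin.sum_univ_two]
    omega

theorem FP.polyTime_three {f : Str × Str × Str → Str} (hf : FP f) :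
    PolyTime 3 fun v => f (v 0, v 1, v 2) := by
  refine hf.polyTime (φ := fun v : Fin 3 → Str => (v 0, v 1, v 2))
    (u := .seq (Prog.pack.shift 1) .pack) (c := 40) (fun v => ?_) fun v => ?_
  · have : v = ![v 0, v 1, v 2] := by funext i; fin_cases i <;> rfl
    have h := (Prog.exec_pack (O := fun _ => none) (v 1) (v 2)).shift_St [v 0]
    have e : St ([v 0] ++ [v 1, v 2]) = initStore v := by
      conv_rhs => rw [this]
      rw [initStore_three]
      rfl
    rw [e] at h
    refine (h.seq (Prog.exec_pack (v 0) (dbl (v 1) ++ v 2))).mono ?_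
    simp only [Fin.sum_univ_three, List.length_append, length_dbl]
    omega
  · simp only [size_pair, size_str, Fin.sum_univ_three]
    omega

/-! ### Polynomial-time library functions -/

attribute [fun_prop] FP.id FP.const FP.comp FP.cond

namespace FP

/-- A function given by a polynomial-time function on codes. -/
theorem of_str {f : α → β} {g : Str → Str} (hg : FP g) (h : ∀ a, enc (f a) = g (enc a)) :
    FP f := by
  obtain ⟨p, m, ⟨M, hM⟩, hp⟩ := hg
  exact ⟨p, _, PB.size.eval M, fun a => by rw [h]; exact (hp (enc a)).mono (hM (enc a))⟩

@[fun_prop] theorem prodMk {f : α → β} {g : α → γ} (hf : FP f) (hg : FP g) :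
    FP fun a => (f a, g a) := hf.pair hg

@[fun_prop] theorem comp_fst {f : α → β × γ} (hf : FP f) : FP fun a => (f a).1 := fst.comp hf

@[fun_prop] theorem comp_snd {f : α → β × γ} (hf : FP f) : FP fun a => (f a).2 := snd.comp hf

@[fun_prop] theorem enc_comp {f : α → β} (hf : FP f) : FP fun a => enc (f a) :=
  (of_enc fun _ => rfl : FP fun b : β => enc b).comp hf

@[fun_prop] theorem str_cons_const {f : α → Str} (hf : FP f) (b : Bool) : FP fun a => b :: f a :=
  (cons b).comp hf

@[fun_prop] theorem str_tail {f : α → Str} (hf : FP f) : FP fun a => (f a).tail :=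
  tail.comp hf

@[fun_prop] theorem str_isEmpty {f : α → Str} (hf : FP f) : FP fun a => (f a).isEmpty :=
  isNil.comp hf

@[fun_prop] theorem str_headD {f : α → Str} (hf : FP f) : FP fun a => (f a).headD false :=
  headD.comp hf

/-! #### Booleans -/

@[fun_prop] theorem not {f : α → Bool} (hf : FP f) : FP fun a => !f a :=
  (hf.cond (FP.const false) (FP.const true)).of_eq fun a => by cases f a <;> rfl

@[fun_prop] theorem and {f g : α → Bool} (hf : FP f) (hg : FP g) : FP fun a => f a && g a :=
  (hf.cond hg (FP.const false)).of_eq fun a => by cases f a <;> rfl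

@[fun_prop] theorem or {f g : α → Bool} (hf : FP f) (hg : FP g) : FP fun a => f a || g a :=
  (hf.cond (FP.const true) hg).of_eq fun a => by cases f a <;> rfl

@[fun_prop] theorem bool_beq {f g : α → Bool} (hf : FP f) (hg : FP g) : FP fun a => f a == g a :=
  (hf.cond hg hg.not).of_eq fun a => by cases f a <;> cases g a <;> rfl

@[fun_prop] theorem str_cons {f : α → Str} {b : α → Bool} (hb : FP b) (hf : FP f) :
    FP fun a => b a :: f a :=
  (hb.cond (hf.str_cons_const true) (hf.str_cons_const false)).of_eq fun a => by cases b a <;> rfl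

/-! #### Options -/

@[fun_prop] theorem opt_some {f : α → β} (hf : FP f) : FP fun a => some (f a) :=
  (of_str (f := fun b : β => some b) (cons true) fun _ => rfl).comp hf

@[fun_prop] theorem opt_isSome {f : α → Option β} (hf : FP f) : FP fun a => (f a).isSome :=
  (FP.not (str_isEmpty (enc_comp hf))).of_eq fun a => by cases f a <;> rfl

-- Where the option is defined, its code without the first bit is the code of the value, so the
-- program for the tail of a string does the work.
@[fun_prop] theorem opt_getD {f : α → Option β} {d : α → β} (hf : FP f) (hd : FP d) :
    FP fun a => (f a).getD (d a) := by
  refine ite (opt_isSome hf) ?_ ((hd.comp val).of_eq fun a => ?_)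
  · have h : FP fun a : {a // (f a).isSome = true} => enc (f a.1) := by
      exact enc_comp (hf.comp val)
    obtain ⟨p, m, hm, hp⟩ := tail.comp h
    refine ⟨p, m, hm, fun a => (hp a).to le_rfl ?_⟩
    obtain ⟨a, ha⟩ := a
    obtain ⟨b, hb⟩ := Option.isSome_iff_exists.mp ha
    simp [hb, enc_some, enc_str]
  · obtain ⟨a, ha⟩ := a
    simp only [Option.isSome_eq_false_iff, Option.isNone_iff_eq_none] at ha
    simp [ha]

/-! #### Lists -/

section List

variable [Elem β]

@[fun_prop] theorem list_cons {f : α → β} {l : α → List β} (hf : FP f) (hl : FP l) :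
    FP fun a => f a :: l a :=
  (of_enc fun _ => rfl : FP fun p : β × List β => p.1 :: p.2).comp (hf.pair hl)

@[fun_prop] theorem list_isEmpty {l : α → List β} (hl : FP l) : FP fun a => (l a).isEmpty :=
  (str_isEmpty (enc_comp hl)).of_eq fun a => by
    rcases l a with _ | ⟨b, l⟩
    · rfl
    · rw [enc_cons]
      cases enc b <;> rfl

/-- Nothing has to be computed, because head and tail as a pair have the same code as the list. -/
theorem uncons (d : β) : FP fun l : {l : List β // l.isEmpty = false} => (l.1.headD d, l.1.tail) :=
  of_enc fun l => by
    obtain ⟨_ | ⟨b, l⟩, h⟩ := l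
    · simp at h
    · rfl

@[fun_prop] theorem list_headD {l : α → List β} (hl : FP l) (d : β) :
    FP fun a => (l a).headD d := by
  refine (?_ : FP fun l : List β => l.headD d).comp hl
  refine ite (list_isEmpty FP.id) ((FP.const d).of_eq fun a => ?_) (comp_fst (uncons d))
  obtain ⟨_ | ⟨b, l⟩, h⟩ := a
  · rfl
  · simp at h

theorem list_tail_of [Inhabited β] {l : α → List β} (hl : FP l) : FP fun a => (l a).tail := by
  refine (?_ : FP fun l : List β => l.tail).comp hl
  refine ite (list_isEmpty FP.id) ((FP.const []).of_eq fun a => ?_) (comp_snd (uncons default))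
  obtain ⟨_ | ⟨b, l⟩, h⟩ := a
  · rfl
  · simp at h

@[fun_prop] theorem list_tail {l : α → List β} (hl : FP l) : FP fun a => (l a).tail := by
  by_cases h : Nonempty β
  · obtain ⟨b⟩ := h
    have : Inhabited β := ⟨b⟩
    exact list_tail_of hl
  · refine (FP.const ([] : List β)).of_eq fun a => ?_
    rcases l a with _ | ⟨b, l⟩
    · rfl
    · exact (h ⟨b⟩).elim

end List

/-! #### Iteration and folds -/

theorem iterate_nat {n : α → ℕ} {init : α → σ} {step : σ → σ} (hn : FP n) (hi : FP init)
    (hs : FP step) {B : α → ℕ} (hB : PB B)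
    (hsize : ∀ a, ∀ i ≤ n a, size (step^[i] (init a)) ≤ B a) :
    FP fun a => step^[n a] (init a) :=
  (iterate hn hi hs hB (fun a i hi => hsize a i (by rwa [size_nat] at hi))).of_eq
    fun a => by rw [size_nat]

theorem pb_nat {n : α → ℕ} (hn : FP n) : PB n := by
  simpa only [size_nat] using hn.pb

section Fold

variable {ι : Type} [Code ι]

/-- Folds over strings and over lists at once: `toL` is the list that an element of `ι` stands for.
The step consumes one entry and idles at the end, so iterating as often as the code is long is
enough. The parameter `a` travels with the state because `g` depends on it. -/
theorem foldl_aux {isE : ι → Bool} {hd : ι → β} {tl : ι → ι} {toL : ι → List β}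
    (hisE : FP isE) (hhd : FP hd) (htl : FP tl)
    (h1 : ∀ l, isE l = true → toL l = []) (h2 : ∀ l, isE l = false → toL l = hd l :: toL (tl l))
    (h3 : ∀ l, (toL l).length ≤ size l) (h4 : ∀ l, size (tl l) ≤ size l)
    {l : α → ι} (hl : FP l) {init : α → σ} (hi : FP init) {g : α → σ → β → σ}
    (hg : FP fun p : α × σ × β => g p.1 p.2.1 p.2.2) {B : α → ℕ} (hB : PB B)
    (hsize : ∀ a l₁ l₂, toL (l a) = l₁ ++ l₂ → size (l₁.foldl (g a) (init a)) ≤ B a) :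
    FP fun a => (toL (l a)).foldl (g a) (init a) := by
  set step : α × ι × σ → α × ι × σ := fun t =>
    bif isE t.2.1 then t else (t.1, tl t.2.1, g t.1 t.2.2 (hd t.2.1)) with hstep
  have hs : FP step := by
    have : FP fun t : α × ι × σ => g t.1 t.2.2 (hd t.2.1) :=
      hg.comp (f := fun t : α × ι × σ => (t.1, t.2.2, hd t.2.1)) (by fun_prop)
    fun_prop
  have key : ∀ i a l s, ∃ l₁ l', step^[i] (a, l, s) = (a, l', l₁.foldl (g a) s) ∧
      toL l = l₁ ++ toL l' ∧ size l' ≤ size l ∧ (l₁.length = i ∨ toL l' = []) := by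
    intro i
    induction i with
    | zero => exact fun a l s => ⟨[], l, rfl, rfl, le_rfl, Or.inl rfl⟩
    | succ i ih =>
      intro a l s
      cases he : isE l with
      | true =>
        obtain ⟨l₁, l', h, h', h'', h'''⟩ := ih a l s
        refine ⟨l₁, l', ?_, h', h'', Or.inr ?_⟩
        · rw [Function.iterate_succ_apply, hstep]
          simp only [he, cond_true]
          exact h
        · have := h1 l he
          simp_all
      | false =>
        obtain ⟨l₁, l', h, h', h'', h'''⟩ := ih a (tl l) (g a s (hd l))
        refine ⟨hd l :: l₁, l', ?_, ?_, h''.trans (h4 l), ?_⟩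
        · rw [Function.iterate_succ_apply, hstep]
          simp only [he, cond_false]
          exact h
        · simp [h2 l he, h']
        · simpa using h'''
  have hit : FP fun a => step^[size (l a)] (a, l a, init a) := by
    refine iterate (B := fun a => 2 * size a + 1 + (2 * size (l a) + 1 + B a)) hl (by fun_prop) hs
      ?_ fun a i _ => ?_
    · exact (((PB.const 2).mul PB.size).add (PB.const 1)).add
        ((((PB.const 2).mul hl.pb).add (PB.const 1)).add hB)
    · obtain ⟨l₁, l', h, h', h'', -⟩ := key i a (l a) (init a)
      have := hsize a _ _ h'
      rw [h, size_pair, size_pair]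
      omega
  refine (comp_snd (comp_snd hit)).of_eq fun a => ?_
  obtain ⟨l₁, l', h, h', -, h''⟩ := key (size (l a)) a (l a) (init a)
  rw [h, h']
  have h0 : toL l' = [] := by
    rcases h'' with h'' | h''
    · have := h3 (l a)
      rw [h', List.length_append] at this
      exact List.eq_nil_of_length_eq_zero (by omega)
    · exact h''
  simp [h0]

theorem str_foldl {l : α → Str} (hl : FP l) {init : α → σ} (hi : FP init) {g : α → σ → Bool → σ}
    (hg : FP fun p : α × σ × Bool => g p.1 p.2.1 p.2.2) {B : α → ℕ} (hB : PB B)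
    (hsize : ∀ a l₁ l₂, l a = l₁ ++ l₂ → size (l₁.foldl (g a) (init a)) ≤ B a) :
    FP fun a => (l a).foldl (g a) (init a) := by
  refine foldl_aux (toL := fun l : Str => l) isNil headD tail ?_ ?_ (fun _ => le_rfl)
    (fun l => ?_) hl hi hg hB hsize
  · simp
  · rintro (_ | ⟨b, l⟩) h
    · simp at h
    · rfl
  · simp [size_str]

theorem size_mem_list [Elem β] {b : β} {l : List β} (h : b ∈ l) : size b ≤ size l := by
  induction l with
  | nil => simp at h
  | cons c l ih =>
    rw [size_cons]
    rcases List.mem_cons.mp h with rfl | h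
    · omega
    · have := ih h
      omega

theorem length_le_size_list [Elem β] (l : List β) : l.length ≤ size l := by
  induction l with
  | nil => simp
  | cons c l ih => simp only [size_cons, List.length_cons]; omega

theorem list_foldl [Elem β] {l : α → List β} (hl : FP l) {init : α → σ} (hi : FP init)
    {g : α → σ → β → σ} (hg : FP fun p : α × σ × β => g p.1 p.2.1 p.2.2) {B : α → ℕ} (hB : PB B)
    (hsize : ∀ a l₁ l₂, l a = l₁ ++ l₂ → size (l₁.foldl (g a) (init a)) ≤ B a) :
    FP fun a => (l a).foldl (g a) (init a) := by
  by_cases h : Nonempty β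
  · obtain ⟨d⟩ := h
    refine foldl_aux (toL := fun l : List β => l) (list_isEmpty FP.id) (list_headD FP.id d)
      (list_tail FP.id) ?_ ?_ length_le_size_list (fun l => ?_) hl hi hg hB hsize
    · simp
    · rintro (_ | ⟨b, l⟩) h
      · simp at h
      · rfl
    · cases l
      · exact le_rfl
      · simp only [List.tail_cons, size_cons]
        omega
  · refine hi.of_eq fun a => ?_
    rcases l a with _ | ⟨b, l⟩
    · rfl
    · exact (h ⟨b⟩).elim

theorem size_foldl_le {τ : Type} {s : σ} {g : σ → τ → σ} {c : ℕ} (l : List τ)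
    (h : ∀ s, ∀ b ∈ l, size (g s b) ≤ size s + c) : size (l.foldl g s) ≤ size s + l.length * c := by
  induction l generalizing s with
  | nil => simp
  | cons b l ih =>
    have h1 := ih (s := g s b) fun s b hb => h s b (List.mem_cons_of_mem _ hb)
    have h2 := h s b (by simp)
    simp only [List.foldl_cons, List.length_cons, Nat.succ_mul]
    omega

theorem str_foldl_add {l : α → Str} (hl : FP l) {init : α → σ} (hi : FP init)
    {g : α → σ → Bool → σ} (hg : FP fun p : α × σ × Bool => g p.1 p.2.1 p.2.2) {C : α → ℕ}
    (hC : PB C) (h : ∀ a s b, size (g a s b) ≤ size s + C a) :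
    FP fun a => (l a).foldl (g a) (init a) := by
  refine str_foldl hl hi hg (hi.pb.add (hl.pb.mul hC)) fun a l₁ l₂ h12 => ?_
  refine (size_foldl_le l₁ fun s b _ => h a s b).trans ?_
  have : l₁.length ≤ size (l a) := by simp [h12, size_str]
  have := Nat.mul_le_mul_right (C a) this
  omega

theorem list_foldl_add [Elem β] {l : α → List β} (hl : FP l) {init : α → σ} (hi : FP init)
    {g : α → σ → β → σ} (hg : FP fun p : α × σ × β => g p.1 p.2.1 p.2.2) {C : α → ℕ}
    (hC : PB C) (h : ∀ a s, ∀ b ∈ l a, size (g a s b) ≤ size s + C a) :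
    FP fun a => (l a).foldl (g a) (init a) := by
  refine list_foldl hl hi hg (hi.pb.add (hl.pb.mul hC)) fun a l₁ l₂ h12 => ?_
  refine (size_foldl_le l₁ fun s b hb => h a s b (by simp [h12, hb])).trans ?_
  have : l₁.length ≤ size (l a) := by
    refine le_trans ?_ (length_le_size_list _)
    simp [h12]
  have := Nat.mul_le_mul_right (C a) this
  omega

end Fold

/-! #### Strings -/

theorem foldl_cons_eq {β : Type} (x acc : List β) :
    x.foldl (fun s b => b :: s) acc = x.reverse ++ acc := by
  induction x generalizing acc with
  | nil => rfl
  | cons b x ih => simp [ih]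

theorem str_reverse_append {f g : α → Str} (hf : FP f) (hg : FP g) :
    FP fun a => (f a).reverse ++ g a :=
  (str_foldl_add (g := fun _ s b => b :: s) hf hg (by fun_prop) (PB.const 1)
    (fun _ _ _ => by simp [size_str])).of_eq fun a => foldl_cons_eq _ _

@[fun_prop] theorem str_reverse {f : α → Str} (hf : FP f) : FP fun a => (f a).reverse :=
  (str_reverse_append hf (FP.const [])).of_eq fun a => by simp

@[fun_prop] theorem str_append {f g : α → Str} (hf : FP f) (hg : FP g) :
    FP fun a => f a ++ g a :=
  (str_reverse_append hf.str_reverse hg).of_eq fun a => by simp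

@[fun_prop] theorem str_length {f : α → Str} (hf : FP f) : FP fun a => (f a).length := by
  refine (?_ : FP fun x : Str => x.length).comp hf
  have h : FP fun x : Str => x.foldl (fun s _ => true :: s) ([] : Str) :=
    str_foldl_add (g := fun _ s _ => true :: s) FP.id (FP.const []) (by fun_prop) (PB.const 1)
      (fun _ _ _ => by simp [size_str])
  obtain ⟨p, m, hm, hp⟩ := h
  refine ⟨p, m, hm, fun x => (hp x).to le_rfl ?_⟩
  have : ∀ (x : Str) k, x.foldl (fun s _ => true :: s) (unary k) = unary (k + x.length) := by
    intro x
    induction x with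
    | nil => simp
    | cons b x ih =>
      intro k
      have := ih (k + 1)
      simp only [unary, List.replicate_succ] at this ⊢
      rw [List.foldl_cons, this, List.length_cons]
      congr 1
      ring
  have h0 := this x 0
  simp only [unary, List.replicate_zero, zero_add] at h0
  simp [h0, enc_nat, enc_str, unary]

@[fun_prop] theorem size_comp {f : α → β} (hf : FP f) : FP fun a => size (f a) :=
  str_length (enc_comp hf)

@[fun_prop] theorem unary_comp {f : α → ℕ} (hf : FP f) : FP fun a => unary (f a) :=
  enc_comp hf

/-! #### Natural numbers -/

@[fun_prop] theorem nat_succ {f : α → ℕ} (hf : FP f) : FP fun a => f a + 1 :=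
  (of_str (f := fun n : ℕ => n + 1) (cons true) fun n => by
    simp [enc_nat, unary, List.replicate_succ]).comp hf

@[fun_prop] theorem nat_pred {f : α → ℕ} (hf : FP f) : FP fun a => f a - 1 :=
  (of_str (f := fun n : ℕ => n - 1) tail fun n => by simp [enc_nat, unary]).comp hf

@[fun_prop] theorem nat_add {f g : α → ℕ} (hf : FP f) (hg : FP g) : FP fun a => f a + g a :=
  (str_length (str_append (unary_comp hf) (unary_comp hg))).of_eq fun a => by simp [unary]

@[fun_prop] theorem nat_sub {f g : α → ℕ} (hf : FP f) (hg : FP g) : FP fun a => f a - g a := by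
  have h : ∀ i x : ℕ, (fun n : ℕ => n - 1)^[i] x = x - i := by
    intro i
    induction i with
    | zero => simp
    | succ i ih =>
      intro x
      rw [Function.iterate_succ_apply, ih]
      omega
  refine (iterate_nat (B := f) hg hf (nat_pred FP.id) hf.pb_nat fun a i _ => ?_).of_eq fun a =>
    h _ _
  rw [h, size_nat]
  omega

@[fun_prop] theorem nat_eq_zero {f : α → ℕ} (hf : FP f) : FP fun a => decide (f a = 0) :=
  (str_isEmpty (unary_comp hf)).of_eq fun a => by cases f a <;> simp [unary, List.replicate_succ]

@[fun_prop] theorem nat_le {f g : α → ℕ} (hf : FP f) (hg : FP g) :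
    FP fun a => decide (f a ≤ g a) :=
  (nat_eq_zero (nat_sub hf hg)).of_eq fun a => by
    simp only [decide_eq_decide]
    omega

@[fun_prop] theorem nat_eq {f g : α → ℕ} (hf : FP f) (hg : FP g) :
    FP fun a => decide (f a = g a) :=
  (FP.and (nat_le hf hg) (nat_le hg hf)).of_eq fun a => by
    rw [← Bool.decide_and, decide_eq_decide]
    omega

/-- Repeating a string. -/
@[fun_prop] theorem str_repeat {n : α → ℕ} {u : α → Str} (hn : FP n) (hu : FP u) :
    FP fun a => (List.replicate (n a) (u a)).flatten := by
  have h : ∀ (i : ℕ) (u : Str), (fun p : Str × Str => (p.1, p.1 ++ p.2))^[i] (u, []) =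
      (u, (List.replicate i u).flatten) := by
    intro i u
    induction i with
    | zero => rfl
    | succ i ih => rw [Function.iterate_succ_apply', ih, List.replicate_succ, List.flatten_cons]
  have hl : ∀ (i : ℕ) (u : Str), (List.replicate i u).flatten.length = i * u.length := by
    simp
  refine (comp_snd (iterate_nat (B := fun a => 2 * size (u a) + 1 + n a * size (u a)) hn
    (init := fun a => (u a, ([] : Str))) (step := fun p : Str × Str => (p.1, p.1 ++ p.2))
    (by fun_prop) (by fun_prop) ?_ fun a i hi => ?_)).of_eq fun a => by rw [h]
  · exact (((PB.const 2).mul hu.pb).add (PB.const 1)).add (hn.pb_nat.mul hu.pb)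
  · rw [h, size_pair, size_str (List.flatten _), hl]
    have := Nat.mul_le_mul_right (size (u a)) hi
    rw [size_str] at this ⊢
    omega

@[fun_prop] theorem nat_mul {f g : α → ℕ} (hf : FP f) (hg : FP g) : FP fun a => f a * g a :=
  (str_length (str_repeat hf (unary_comp hg))).of_eq fun a => by simp [unary]

@[fun_prop] theorem nat_pow {f : α → ℕ} (hf : FP f) (k : ℕ) : FP fun a => f a ^ k := by
  induction k with
  | zero => exact (FP.const 1).of_eq fun a => by simp
  | succ k ih => exact (nat_mul ih hf).of_eq fun a => (pow_succ _ _).symm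

-- With unary numbers, sums, products and fixed powers have polynomial size.
@[fun_prop] theorem nat_eval {f : α → ℕ} (hf : FP f) (P : Polynomial ℕ) :
    FP fun a => P.eval (f a) := by
  induction P using Polynomial.induction_on' with
  | add P Q hP hQ => exact (nat_add hP hQ).of_eq fun a => by simp
  | monomial k c => exact (nat_mul (FP.const c) (nat_pow hf k)).of_eq fun a => by simp

@[fun_prop] theorem str_replicate {n : α → ℕ} {b : α → Bool} (hn : FP n) (hb : FP b) :
    FP fun a => (List.replicate (n a) (b a) : Str) :=
  (str_repeat hn (enc_comp hb)).of_eq fun a => by simp [enc_bool]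

@[fun_prop] theorem str_drop {f : α → Str} {n : α → ℕ} (hn : FP n) (hf : FP f) :
    FP fun a => (f a).drop (n a) := by
  have h : ∀ (i : ℕ) (u : Str), List.tail^[i] u = u.drop i := by
    intro i
    induction i with
    | zero => simp
    | succ i ih =>
      intro u
      rw [Function.iterate_succ_apply, ih, List.drop_tail]
  refine (iterate_nat (B := fun a => size (f a)) hn hf tail hf.pb fun a i _ => ?_).of_eq fun a =>
    h _ _
  rw [h]
  simp [size_str]

@[fun_prop] theorem str_take {f : α → Str} {n : α → ℕ} (hn : FP n) (hf : FP f) :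
    FP fun a => (f a).take (n a) :=
  (str_reverse (str_drop (nat_sub (str_length hf) hn) (str_reverse hf))).of_eq fun a => by
    rw [List.drop_reverse, List.reverse_reverse]
    rcases le_total (n a) (f a).length with h | h
    · congr 1
      omega
    · rw [List.take_of_length_le h, List.take_of_length_le (by omega)]

@[fun_prop] theorem str_getD {f : α → Str} {n : α → ℕ} (hn : FP n) (hf : FP f) :
    FP fun a => (f a).getD (n a) false :=
  (str_headD (str_drop hn hf)).of_eq fun a => by
    rw [List.headD_eq_head?_getD, List.head?_drop, List.getD_eq_getElem?_getD]

@[fun_prop] theorem str_beq {f g : α → Str} (hf : FP f) (hg : FP g) :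
    FP fun a => decide (f a = g a) := by
  refine (?_ : FP fun p : Str × Str => decide (p.1 = p.2)).comp (hf.pair hg)
  -- Comparing emptiness as well as heads distinguishes a string that has ended from one whose next
  -- bit is `false`, the default head.
  set step : Str × Str × Bool → Str × Str × Bool := fun t => (t.1.tail, t.2.1.tail,
    t.2.2 && ((t.1.isEmpty == t.2.1.isEmpty) && (t.1.headD false == t.2.1.headD false))) with hstep
  have hs : FP step := by fun_prop
  have key : ∀ i x y b, x.length ≤ i → y.length ≤ i →
      (step^[i] (x, y, b)).2.2 = (b && decide (x = y)) := by
    intro i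
    induction i with
    | zero =>
      intro x y b hx hy
      have h1 := List.eq_nil_of_length_eq_zero (Nat.le_zero.mp hx)
      have h2 := List.eq_nil_of_length_eq_zero (Nat.le_zero.mp hy)
      simp [h1, h2]
    | succ i ih =>
      intro x y b hx hy
      rw [Function.iterate_succ_apply, ih _ _ _ (by simp; omega) (by simp; omega)]
      rcases x with _ | ⟨c, x⟩ <;> rcases y with _ | ⟨d, y⟩ <;> simp
      · cases c <;> cases d <;> cases b <;> simp <;> congr
  have hsz : ∀ i x y b, size (step^[i] (x, y, b)) ≤ size (x, y, b) := by
    intro i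
    induction i with
    | zero => exact fun _ _ _ => le_rfl
    | succ i ih =>
      intro x y b
      rw [Function.iterate_succ_apply]
      refine (ih _ _ _).trans ?_
      simp only [size_pair, size_str, size_bool, List.length_tail]
      omega
  have hinit : FP fun p : Str × Str => (p.1, p.2, true) := by fun_prop
  refine (comp_snd (comp_snd (iterate_nat (n := fun p : Str × Str => p.1.length + p.2.length)
    (by fun_prop) hinit hs hinit.pb fun a i _ => hsz _ _ _ _))).of_eq fun a => ?_
  rw [key _ _ _ _ (by omega) (by omega), Bool.true_and]

end FP

/-! ### Building circuits -/

namespace Circuit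

theorem wires_nil (w : List Bool) : wires [] w = w := rfl

theorem wires_cons (g : Gate) (C : Circuit) (w : List Bool) :
    wires (g :: C) w = wires C (g.eval w :: w) := rfl

theorem wires_append (C D : Circuit) (w : List Bool) :
    wires (C ++ D) w = wires D (wires C w) := List.foldl_append

theorem exists_wires (C : Circuit) (w : List Bool) :
    ∃ e, e.length = C.length ∧ wires C w = e ++ w := by
  induction C generalizing w with
  | nil => exact ⟨[], rfl, rfl⟩
  | cons g C ih =>
    obtain ⟨e, he, h⟩ := ih (g.eval w :: w)
    exact ⟨e ++ [g.eval w], by simp [he], by rw [wires_cons, h]; simp⟩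

theorem getD_append_of_eq {e w : List Bool} {k i : ℕ} (h : k = e.length + i) :
    (e ++ w).getD k false = w.getD i false := by
  rw [List.getD_append_right _ _ _ _ (by omega)]
  congr 1
  omega

theorem getD_wires (C : Circuit) (w : List Bool) {k i : ℕ} (h : k = C.length + i) :
    (wires C w).getD k false = w.getD i false := by
  obtain ⟨e, he, h'⟩ := exists_wires C w
  rw [h', getD_append_of_eq (i := i) (by omega)]

/-- Wire numbers count back from the newest wire, so one and the same gate, repeated, reads an older
wire set entry by entry, from the last entry to the first. The copy made after `e` sees everything
in `w` shifted by `e.length`, so it produces entry `n - 1 - e.length`. This is why the blockwise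
gates below use the offset `n - 1 + d`, and why a block of gates is coded by repeating a string. -/
theorem wires_replicate (n : ℕ) (g : Gate) (w : List Bool) (h : ℕ → Bool)
    (hg : ∀ e : List Bool, e.length < n → g.eval (e ++ w) = h (n - 1 - e.length)) :
    wires (List.replicate n g) w = (List.range n).map h ++ w := by
  have key : ∀ k ≤ n, wires (List.replicate k g) w =
      (List.range k).map (fun i => h (n - k + i)) ++ w := by
    intro k
    induction k with
    | zero => simp [wires_nil]
    | succ k ih =>
      intro hk
      rw [List.replicate_succ', wires_append, ih (by omega), wires_cons, wires_nil,
        hg _ (by simpa using hk), List.range_succ_eq_map]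
      simp only [List.length_map, List.length_range, List.map_cons, List.map_map,
        List.cons_append, add_zero]
      rw [show n - 1 - k = n - (k + 1) by omega]
      congr 2
      · refine List.map_congr_left fun i _ => ?_
        simp only [Function.comp_apply]
        congr 1
        omega
  simpa using key n le_rfl

theorem getD_replicate (n : ℕ) (g : Gate) (w : List Bool) (h : ℕ → Bool)
    (hg : ∀ e : List Bool, e.length < n → g.eval (e ++ w) = h (n - 1 - e.length))
    {i : ℕ} (hi : i < n) : (wires (List.replicate n g) w).getD i false = h i := by
  rw [wires_replicate n g w h hg, List.getD_append _ _ _ _ (by simpa)]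
  simp [hi]

/-- `n` new wires with the values of the wires `d, …, d + n - 1`. -/
def copyB (n d : ℕ) : Circuit := List.replicate n (.or (n - 1 + d) (n - 1 + d))

/-- Bitwise negation of `n` wires. -/
def notB (n d : ℕ) : Circuit := List.replicate n (.not (n - 1 + d))

/-- Bitwise conjunction of `n` wires. -/
def andB (n d d' : ℕ) : Circuit := List.replicate n (.and (n - 1 + d) (n - 1 + d'))

/-- Bitwise disjunction of `n` wires. -/
def orB (n d d' : ℕ) : Circuit := List.replicate n (.or (n - 1 + d) (n - 1 + d'))

theorem getD_copyB {n d : ℕ} (w : List Bool) {i : ℕ} (hi : i < n) :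
    (wires (copyB n d) w).getD i false = w.getD (d + i) false :=
  getD_replicate n _ w (fun i => w.getD (d + i) false) (fun e he => by
    simp only [Gate.eval, Bool.or_self]
    exact getD_append_of_eq (by omega)) hi

theorem getD_notB {n d : ℕ} (w : List Bool) {i : ℕ} (hi : i < n) :
    (wires (notB n d) w).getD i false = !w.getD (d + i) false :=
  getD_replicate n _ w (fun i => !w.getD (d + i) false) (fun e he => by
    simp only [Gate.eval]
    rw [getD_append_of_eq (i := d + (n - 1 - e.length)) (by omega)]) hi

theorem getD_andB {n d d' : ℕ} (w : List Bool) {i : ℕ} (hi : i < n) :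
    (wires (andB n d d') w).getD i false = (w.getD (d + i) false && w.getD (d' + i) false) :=
  getD_replicate n _ w (fun i => w.getD (d + i) false && w.getD (d' + i) false) (fun e he => by
    simp only [Gate.eval]
    rw [getD_append_of_eq (i := d + (n - 1 - e.length)) (by omega),
      getD_append_of_eq (i := d' + (n - 1 - e.length)) (by omega)]) hi

theorem getD_orB {n d d' : ℕ} (w : List Bool) {i : ℕ} (hi : i < n) :
    (wires (orB n d d') w).getD i false = (w.getD (d + i) false || w.getD (d' + i) false) :=
  getD_replicate n _ w (fun i => w.getD (d + i) false || w.getD (d' + i) false) (fun e he => by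
    simp only [Gate.eval]
    rw [getD_append_of_eq (i := d + (n - 1 - e.length)) (by omega),
      getD_append_of_eq (i := d' + (n - 1 - e.length)) (by omega)]) hi

/-- Many copies of the wire `s`. -/
def bcast (n s : ℕ) : Circuit := .or s s :: List.replicate n (.or 0 0)

theorem getD_bcast {n s : ℕ} (w : List Bool) {i : ℕ} (hi : i < n) :
    (wires (bcast n s) w).getD i false = w.getD s false := by
  rw [bcast, wires_cons]
  have : ∀ n, ∀ b : Bool, wires (List.replicate n (.or 0 0)) (b :: w) =
      List.replicate (n + 1) b ++ w := by
    intro n b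
    induction n with
    | zero => rfl
    | succ n ih =>
      rw [List.replicate_succ', wires_append, ih]
      simp [wires_cons, wires_nil, Gate.eval, List.replicate_succ]
  rw [this, List.getD_append _ _ _ _ (by simp; omega), List.getD_replicate _ (by omega)]
  simp [Gate.eval]

/-- If wire `s` is set then the `n` wires from `a` on, else the `n` wires from `b` on. -/
def mux (n s a b : ℕ) : Circuit :=
  bcast n s ++ andB n 0 (a + n + 1) ++ notB n n ++ andB n 0 (b + 3 * n + 1) ++ orB n 0 (2 * n)

@[simp] theorem length_copyB (n d : ℕ) : (copyB n d).length = n := by simp [copyB]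
@[simp] theorem length_notB (n d : ℕ) : (notB n d).length = n := by simp [notB]
@[simp] theorem length_andB (n d d' : ℕ) : (andB n d d').length = n := by simp [andB]
@[simp] theorem length_orB (n d d' : ℕ) : (orB n d d').length = n := by simp [orB]
@[simp] theorem length_bcast (n s : ℕ) : (bcast n s).length = n + 1 := by simp [bcast]
@[simp] theorem length_mux (n s a b : ℕ) : (mux n s a b).length = 5 * n + 1 := by
  simp [mux]
  omega

/-- The output is the disjunction of `s ∧ a` and `¬ s ∧ b`, taken bitwise. The summands `n`, `2 *
n`, `3 * n` in `mux` skip the blocks written in the meantime. -/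
theorem getD_mux {n s a b : ℕ} (w : List Bool) {i : ℕ} (hi : i < n) :
    (wires (mux n s a b) w).getD i false =
      if w.getD s false then w.getD (a + i) false else w.getD (b + i) false := by
  simp only [mux, wires_append]
  rw [getD_orB _ hi, zero_add, getD_andB _ hi, zero_add, getD_notB _ hi,
    getD_wires (i := i) _ _ (by simp), getD_bcast _ hi,
    getD_wires (i := b + 2 * n + 1 + i) _ _ (by simp; omega),
    getD_wires (i := b + n + 1 + i) _ _ (by simp; omega),
    getD_wires (i := b + i) _ _ (by simp; omega),
    getD_wires (i := n + i) _ _ (by simp; omega),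
    getD_wires (i := i) _ _ (by simp), getD_andB _ hi, zero_add, getD_bcast _ hi,
    getD_wires (i := a + i) _ _ (by simp; omega)]
  cases w.getD s false <;> simp

/-- The circuits `c (n - 1), …, c 0`, one after the other. -/
def layer (c : ℕ → Circuit) : ℕ → Circuit
  | 0 => []
  | n + 1 => c n ++ layer c n

theorem length_layer {c : ℕ → Circuit} {L : ℕ} (hc : ∀ j, (c j).length = L) (n : ℕ) :
    (layer c n).length = n * L := by
  induction n with
  | zero => simp [layer]
  | succ n ih => simp only [layer, List.length_append, hc, ih]; ring

/-- Block `j` is written after the blocks with larger index, hence sees the old wires under `(n - 1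
- j) * L` new ones and ends up as block `j` of the result. -/
theorem getD_layer {c : ℕ → Circuit} {L : ℕ} (hc : ∀ j, (c j).length = L) (f : ℕ → ℕ → Bool)
    (n : ℕ) (w : List Bool)
    (h : ∀ j < n, ∀ e : List Bool, e.length = (n - 1 - j) * L → ∀ i < L,
      (wires (c j) (e ++ w)).getD i false = f j i) {j i : ℕ} (hj : j < n) (hi : i < L) :
    (wires (layer c n) w).getD (j * L + i) false = f j i := by
  induction n generalizing w with
  | zero => omega
  | succ n ih =>
    rw [layer, wires_append]
    rcases Nat.lt_succ_iff_lt_or_eq.mp hj with hj' | rfl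
    · refine ih _ (fun k hk e he i hi => ?_) hj'
      obtain ⟨p, hp, hw⟩ := exists_wires (c n) w
      rw [hw, ← List.append_assoc]
      refine h k (by omega) _ ?_ i hi
      rw [List.length_append, he, hp, hc, show n + 1 - 1 - k = (n - 1 - k) + 1 by omega]
      ring
    · rw [getD_wires (i := i) _ _ (by rw [length_layer hc])]
      simpa using h j (by omega) [] (by simp) i hi

/-! ### Circuits simulating programs -/

/-- Bit `i` of plane `j` of a store; every stack has a plane of values and a plane telling which
cells are occupied. -/
def cell (s : Store) (j i : ℕ) : Bool :=
  if j % 2 = 0 then (s (j / 2)).getD i false else decide (i < (s (j / 2)).length)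

/-- The first wires of `w` hold the first `L` cells of the first `K` stacks of `s`. -/
def Rep (K L : ℕ) (w : List Bool) (s : Store) : Prop :=
  ∀ j < 2 * K, ∀ i < L, w.getD (j * L + i) false = cell s j i

/-- Copy a plane, inserting a bit at the front. -/
def pushPlane (K l : ℕ) (b : Bool) : Circuit := copyB l ((2 * K - 1) * (l + 1)) ++ [.const b]

/-- Copy a plane without its first bit. -/
def popPlane (K l : ℕ) : Circuit := .const false :: copyB l ((2 * K - 1) * (l + 1) + 2)

def pushC (K l r : ℕ) (b : Bool) : Circuit :=
  layer (fun j => if j = 2 * r then pushPlane K l b else if j = 2 * r + 1 then pushPlane K l true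
    else copyB (l + 1) ((2 * K - 1) * (l + 1))) (2 * K)

def popC (K l r : ℕ) : Circuit :=
  layer (fun j => if j = 2 * r then popPlane K l else if j = 2 * r + 1 then popPlane K l
    else copyB (l + 1) ((2 * K - 1) * (l + 1))) (2 * K)

def branchC (K l r : ℕ) (cNil c0 c1 : Circuit) : Circuit :=
  let W := 2 * K * (l + 1)
  cNil ++ copyB W cNil.length ++ c0 ++ copyB W (c0.length + W + cNil.length) ++ c1 ++
  mux W (c1.length + W + c0.length + W + cNil.length + 2 * r * (l + 1)) 0 (c1.length + W) ++
  mux W (5 * W + 1 + c1.length + W + c0.length + W + cNil.length + (2 * r + 1) * (l + 1)) 0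
    (5 * W + 1 + c1.length + W + c0.length + W)

/-- A circuit simulating at most `T` steps of a program without queries, on stacks of height at
most `l + 1`. -/
def ofProg (K l T : ℕ) : Prog → Circuit
  | .skip => []
  | .push r b => pushC K l r b
  | .pop r => popC K l r
  | .query _ => []
  | .seq p q => ofProg K l T p ++ ofProg K l T q
  | .branch r pNil p0 p1 => branchC K l r (ofProg K l T pNil) (ofProg K l T p0) (ofProg K l T p1)
  | .loop r p => (List.replicate T (branchC K l r [] (ofProg K l T p) (ofProg K l T p))).flatten

variable {K l : ℕ}

theorem rep_layer {c : ℕ → Circuit} (hc : ∀ j, (c j).length = l + 1) {w : List Bool} {s : Store}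
    (h : ∀ j < 2 * K, ∀ e : List Bool, e.length = (2 * K - 1 - j) * (l + 1) → ∀ i < l + 1,
      (wires (c j) (e ++ w)).getD i false = cell s j i) :
    Rep K (l + 1) (wires (layer c (2 * K)) w) s :=
  fun _ hj _ hi => getD_layer hc (cell s) _ w h hj hi

/-- When plane `j` is rewritten, the new planes above it push the old plane `j` to an offset that
does not depend on `j`. One circuit therefore copies any plane. -/
theorem plane_offset {j : ℕ} (hj : j < 2 * K) :
    (2 * K - 1) * (l + 1) = (2 * K - 1 - j) * (l + 1) + j * (l + 1) := by
  rw [← Nat.add_mul]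
  congr 1
  omega

theorem rep_pushC {w : List Bool} {s : Store} (hw : Rep K (l + 1) w s) (r : ℕ) (b : Bool) :
    Rep K (l + 1) (wires (pushC K l r b) w) (Function.update s r (b :: s r)) := by
  refine rep_layer (fun j => by split_ifs <;> simp [pushPlane]) fun j hj e he i hi => ?_
  have ho := plane_offset (l := l) hj
  have hplane : ∀ c, (∀ i < l, cell s j i = cell (Function.update s r (b :: s r)) j (i + 1)) →
      c = cell (Function.update s r (b :: s r)) j 0 →
      (wires (pushPlane K l c) (e ++ w)).getD i false =
        cell (Function.update s r (b :: s r)) j i := by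
    intro c h hc0
    rw [pushPlane, wires_append, wires_cons, wires_nil]
    rcases i with _ | i
    · simpa [Gate.eval] using hc0
    · rw [List.getD_cons_succ, getD_copyB _ (by omega), ← h i (by omega), ← hw j hj i (by omega)]
      exact getD_append_of_eq (by omega)
  split_ifs with h1 h2
  · subst h1
    refine hplane _ (fun i _ => ?_) ?_ <;> simp [cell]
  · subst h2
    have h3 : (2 * r + 1) / 2 = r := by omega
    refine hplane _ (fun i _ => ?_) ?_ <;> simp [cell, h3, Nat.add_mod]
  · rw [getD_copyB _ hi, getD_append_of_eq (i := j * (l + 1) + i) (by omega), hw j hj i hi]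
    have : j / 2 ≠ r := by omega
    simp [cell, this]

theorem rep_popC {w : List Bool} {s : Store} (hw : Rep K (l + 1) w s) (r : ℕ)
    (hs : (s r).length ≤ l + 1) :
    Rep K (l + 1) (wires (popC K l r) w) (Function.update s r (s r).tail) := by
  refine rep_layer (fun j => by split_ifs <;> simp [popPlane]) fun j hj e he i hi => ?_
  have ho := plane_offset (l := l) hj
  have hplane : (∀ i < l, cell s j (i + 1) = cell (Function.update s r (s r).tail) j i) →
      false = cell (Function.update s r (s r).tail) j l →
      (wires (popPlane K l) (e ++ w)).getD i false =
        cell (Function.update s r (s r).tail) j i := by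
    intro h hc0
    rw [popPlane, wires_cons]
    rcases Nat.lt_succ_iff_lt_or_eq.mp hi with hi' | rfl
    -- The `+ 2` in `popPlane` is one for the constant just written at the far end and one for the
    -- dropped first bit.
    · rw [getD_copyB _ hi', ← h i hi', ← hw j hj (i + 1) (by omega), ← List.cons_append]
      exact getD_append_of_eq (by simp; omega)
    · rw [← hc0, getD_wires (i := 0) _ _ (by simp)]
      rfl
  split_ifs with h1 h2
  · subst h1
    refine hplane (fun i _ => ?_) ?_
    · rcases hsr : s r <;> simp [cell, hsr]
    · rcases hsr : s r with _ | ⟨c, u⟩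
      · simp [cell]
      · rw [hsr] at hs
        simp only [List.length_cons] at hs
        simp [cell, List.getElem?_eq_none (show u.length ≤ l by omega)]
  · subst h2
    have h3 : (2 * r + 1) / 2 = r := by omega
    refine hplane (fun i _ => ?_) ?_
    · simp [cell, h3, Nat.add_mod]
      omega
    · simp [cell, h3, Nat.add_mod]
      omega
  · rw [getD_copyB _ hi, getD_append_of_eq (i := j * (l + 1) + i) (by omega), hw j hj i hi]
    have : j / 2 ≠ r := by omega
    simp [cell, this]

theorem Rep.congr {L : ℕ} {w w' : List Bool} {s : Store} (h : Rep K L w s)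
    (hw : ∀ i < 2 * K * L, w'.getD i false = w.getD i false) : Rep K L w' s := by
  intro j hj i hi
  rw [hw, h j hj i hi]
  have : (j + 1) * L ≤ 2 * K * L := Nat.mul_le_mul_right _ hj
  rw [Nat.add_mul, one_mul] at this
  omega

/-- A circuit cannot branch, so all three branches are evaluated, each on a fresh copy of the
original store. The top value bit of stack `r` then selects between the results of `c0` and `c1`,
and its top occupancy bit between that and the result of `cNil`. Only the branch actually taken has
to be right. -/
theorem rep_branchC {w : List Bool} {s s' : Store} (hw : Rep K (l + 1) w s) {r : ℕ} (hr : r < K)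
    {cNil c0 c1 : Circuit}
    (h : (s r = [] ∧ Rep K (l + 1) (wires cNil w) s') ∨
      (∃ u, s r = false :: u ∧ ∀ w, Rep K (l + 1) w s → Rep K (l + 1) (wires c0 w) s') ∨
      (∃ u, s r = true :: u ∧ ∀ w, Rep K (l + 1) w s → Rep K (l + 1) (wires c1 w) s')) :
    Rep K (l + 1) (wires (branchC K l r cNil c0 c1) w) s' := by
  simp only [branchC, wires_append]
  set W := 2 * K * (l + 1) with hW
  set w1 := wires cNil w with hw1
  set w2 := wires (copyB W cNil.length) w1 with hw2
  set w3 := wires c0 w2 with hw3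
  set w4 := wires (copyB W (c0.length + W + cNil.length)) w3 with hw4
  set w5 := wires c1 w4 with hw5
  have e1 : ∀ i, w1.getD (cNil.length + i) false = w.getD i false := fun i => getD_wires _ _ rfl
  have e2 : ∀ i, w2.getD (W + i) false = w1.getD i false := fun i => getD_wires _ _ (by simp)
  have e3 : ∀ i, w3.getD (c0.length + i) false = w2.getD i false := fun i => getD_wires _ _ rfl
  have e4 : ∀ i, w4.getD (W + i) false = w3.getD i false := fun i => getD_wires _ _ (by simp)
  have e5 : ∀ i, w5.getD (c1.length + i) false = w4.getD i false := fun i => getD_wires _ _ rfl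
  have r2 : Rep K (l + 1) w2 s := hw.congr fun i hi => by rw [hw2, getD_copyB _ hi, e1]
  have r4 : Rep K (l + 1) w4 s := hw.congr fun i hi => by
    rw [hw4, getD_copyB _ hi, Nat.add_assoc, Nat.add_assoc, e3, e2, e1]
  have hnil : ∀ i, w5.getD (c1.length + W + c0.length + W + i) false = w1.getD i false := by
    intro i
    rw [Nat.add_assoc, Nat.add_assoc, Nat.add_assoc, e5, e4, e3, e2]
  have hold : ∀ i, w5.getD (c1.length + W + c0.length + W + cNil.length + i) false =
      w.getD i false := fun i => by
    rw [Nat.add_assoc _ cNil.length, hnil, e1]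
  have hval := hw (2 * r) (by omega) 0 (by omega)
  have hpres := hw (2 * r + 1) (by omega) 0 (by omega)
  have h3 : (2 * r + 1) / 2 = r := by omega
  simp only [add_zero, cell, Nat.mul_mod_right, if_true, Nat.mul_div_cancel_left r two_pos] at hval
  simp only [add_zero, cell, Nat.mul_add_mod, h3, Nat.one_mod, one_ne_zero, if_false] at hpres
  set w6 := wires (mux W (c1.length + W + c0.length + W + cNil.length + 2 * r * (l + 1)) 0
    (c1.length + W)) w5 with hw6
  have e6 : ∀ i, w6.getD (5 * W + 1 + i) false = w5.getD i false := fun i =>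
    getD_wires _ _ (by simp)
  have m6 : ∀ i < W, w6.getD i false =
      if (s r).getD 0 false then w5.getD i false else w3.getD i false := by
    intro i hi
    rw [hw6, getD_mux _ hi, hold, hval, zero_add, Nat.add_assoc, e5, e4]
  have m7 : ∀ i < W, (wires (mux W (5 * W + 1 + c1.length + W + c0.length + W + cNil.length +
      (2 * r + 1) * (l + 1)) 0 (5 * W + 1 + c1.length + W + c0.length + W)) w6).getD i false =
      if 0 < (s r).length then w6.getD i false else w1.getD i false := by
    intro i hi
    rw [getD_mux _ hi, zero_add]
    have t1 : 5 * W + 1 + c1.length + W + c0.length + W + cNil.length + (2 * r + 1) * (l + 1) =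
      5 * W + 1 + (c1.length + W + c0.length + W + cNil.length + (2 * r + 1) * (l + 1)) := by ring
    have t2 : 5 * W + 1 + c1.length + W + c0.length + W + i =
      5 * W + 1 + (c1.length + W + c0.length + W + i) := by ring
    rw [t1, t2, e6, e6, hold, hnil, hpres]
    simp
  rcases h with ⟨h, h'⟩ | ⟨u, h, h'⟩ | ⟨u, h, h'⟩
  · refine h'.congr fun i hi => ?_
    rw [m7 i hi, h]
    simp
  · have h'' := h' w2 r2
    rw [← hw3] at h''
    refine h''.congr fun i hi => ?_
    rw [m7 i hi, m6 i hi, h]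
    simp
  · have h'' := h' w4 r4
    rw [← hw5] at h''
    refine h''.congr fun i hi => ?_
    rw [m7 i hi, m6 i hi, h]
    simp

/-- Height plus remaining time never exceeds `l + 1`, so no push loses an occupied cell. A loop
becomes `T` conditional rounds; a run of `t ≤ T` steps makes fewer than `t` rounds, and the
superfluous ones take the empty branch and do nothing. -/
theorem rep_ofProg {T : ℕ} {p : Prog} (hK : p.regs ≤ K) {s s' : Store} {t : ℕ}
    (h : p.Runs (fun _ => none) s t s') (ht : t ≤ T) (hl : ∀ r, (s r).length + t ≤ l + 1)
    {w : List Bool} (hw : Rep K (l + 1) w s) : Rep K (l + 1) (wires (ofProg K l T p) w) s' := by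
  induction p generalizing s s' t w with
  | skip => cases h; exact hw
  | push r b => cases h; exact rep_pushC hw r b
  | pop r => cases h; exact rep_popC hw r ((Nat.le_add_right _ _).trans (hl r))
  | query r => cases h; contradiction
  | seq p q ihp ihq =>
    simp only [Prog.regs, max_le_iff] at hK
    cases h with
    | seq h h' =>
      rw [ofProg, wires_append]
      exact ihq hK.2 h' (by omega) (fun r => by have := h.length_le r; have := hl r; omega)
        (ihp hK.1 h (by omega) (fun r => by have := hl r; omega) hw)
  | branch r pNil p0 p1 ihn ih0 ih1 =>
    simp only [Prog.regs, max_le_iff] at hK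
    cases h with
    | branchNil hr h =>
      exact rep_branchC hw hK.1 (.inl ⟨hr, ihn hK.2.1 h (by omega)
        (fun r => by have := hl r; omega) hw⟩)
    | branch0 hr h =>
      exact rep_branchC hw hK.1 (.inr (.inl ⟨_, hr, fun w hw => ih0 hK.2.2.1 h (by omega)
        (fun r => by have := hl r; omega) hw⟩))
    | branch1 hr h =>
      exact rep_branchC hw hK.1 (.inr (.inr ⟨_, hr, fun w hw => ih1 hK.2.2.2 h (by omega)
        (fun r => by have := hl r; omega) hw⟩))
  | loop r p ih =>
    simp only [Prog.regs, max_le_iff] at hK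
    rw [ofProg]
    have key : ∀ n, ∀ k, n ≤ k → ∀ s t w, t ≤ n → t ≤ T → (∀ r, (s r).length + t ≤ l + 1) →
        (Prog.loop r p).Runs (fun _ => none) s t s' → Rep K (l + 1) w s →
        Rep K (l + 1) (wires (List.replicate k
          (branchC K l r [] (ofProg K l T p) (ofProg K l T p))).flatten w) s' := by
      intro n
      induction n with
      | zero =>
        intro k _ s t w ht _ _ h
        cases h <;> omega
      | succ n ihn =>
        intro k hk s t w htn htT hl h hw
        obtain ⟨k, rfl⟩ : ∃ m, k = m + 1 := ⟨k - 1, by omega⟩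
        cases h with
        | loopDone hr =>
          clear ihn hk
          generalize k + 1 = k
          induction k generalizing w with
          | zero => exact hw
          | succ k ihk =>
            rw [List.replicate_succ, List.flatten_cons, wires_append]
            exact ihk _ (rep_branchC hw hK.1 (cNil := []) (.inl ⟨hr, hw⟩))
        | loopStep hr h h' =>
          rw [List.replicate_succ, List.flatten_cons, wires_append]
          refine ihn k (by omega) _ _ _ (by omega) (by omega)
            (fun r => by have := h.length_le r; have := hl r; omega) h' ?_
          refine rep_branchC hw hK.1 (.inr ?_)
          rcases hsr : s r with _ | ⟨_ | _, u⟩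
          · exact absurd hsr hr
          · exact .inl ⟨u, rfl, fun w hw => ih hK.2 h (by omega)
              (fun r => by have := hl r; omega) hw⟩
          · exact .inr ⟨u, rfl, fun w hw => ih hK.2 h (by omega)
              (fun r => by have := hl r; omega) hw⟩
    exact key T T le_rfl s t w ht ht hl h hw

end Circuit

/-! ### Uniform families of circuits -/

namespace Circuit

/-- The code of a circuit without the end marker. -/
def body (C : Circuit) : Str := C.flatMap fun g => true :: g.encode

theorem encode_eq_body (C : Circuit) : encode C = body C ++ [false] := by
  induction C with
  | nil => rfl
  | cons g C ih => simp [encode, ih, body]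

/-- The end marker is left out precisely so that codes of composed circuits concatenate. -/
theorem body_append (C D : Circuit) : body (C ++ D) = body C ++ body D := List.flatMap_append

/-- Polynomial-time generated families of circuits. -/
@[fun_prop]
def UC (C : α → Circuit) : Prop := (FP fun a => body (C a)) ∧ FP fun a => (C a).length

@[fun_prop] theorem UC.nil : UC fun _ : α => ([] : Circuit) :=
  ⟨FP.const [], FP.const 0⟩

@[fun_prop] theorem UC.append {C D : α → Circuit} (hC : UC C) (hD : UC D) :
    UC fun a => C a ++ D a :=
  ⟨(hC.1.str_append hD.1).of_eq fun a => (body_append _ _).symm,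
    (hC.2.nat_add hD.2).of_eq fun a => by simp⟩

@[fun_prop] theorem UC.flatten_replicate {n : α → ℕ} {C : α → Circuit} (hn : FP n) (hC : UC C) :
    UC fun a => (List.replicate (n a) (C a)).flatten := by
  refine ⟨(FP.str_repeat hn hC.1).of_eq fun a => ?_, (FP.nat_mul hn hC.2).of_eq fun a => ?_⟩
  · change _ = body (List.replicate (n a) (C a)).flatten
    induction n a with
    | zero => rfl
    | succ n ih =>
      rw [List.replicate_succ, List.flatten_cons, List.replicate_succ, List.flatten_cons,
        body_append, ih]
  · simp

theorem UC.of_gate {g : α → Gate} (hg : FP fun a => (g a).encode) : UC fun a => [g a] :=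
  ⟨(hg.str_cons_const true).of_eq fun a => by simp [body], FP.const 1⟩

theorem UC.cons_of {g : α → Gate} {C : α → Circuit} (hg : FP fun a => (g a).encode) (hC : UC C) :
    UC fun a => g a :: C a := (UC.of_gate hg).append hC

theorem UC.replicate_of {n : α → ℕ} {g : α → Gate} (hn : FP n) (hg : FP fun a => (g a).encode) :
    UC fun a => List.replicate (n a) (g a) := by
  have h := UC.flatten_replicate hn (UC.of_gate hg)
  have e : (fun a => (List.replicate (n a) [g a]).flatten) = fun a =>
      List.replicate (n a) (g a) := by
    funext a
    simp
  rwa [e] at h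

@[fun_prop] theorem encodeNat_comp {n : α → ℕ} (hn : FP n) : FP fun a => encodeNat (n a) := by
  unfold encodeNat
  fun_prop

theorem encode_const (b : Bool) : FP fun _ : α => (Gate.const b).encode := FP.const _

theorem encode_not {n : α → ℕ} (hn : FP n) : FP fun a => (Gate.not (n a)).encode := by
  unfold Gate.encode
  fun_prop

theorem encode_and {n m : α → ℕ} (hn : FP n) (hm : FP m) :
    FP fun a => (Gate.and (n a) (m a)).encode := by
  unfold Gate.encode
  fun_prop

theorem encode_or {n m : α → ℕ} (hn : FP n) (hm : FP m) :
    FP fun a => (Gate.or (n a) (m a)).encode := by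
  unfold Gate.encode
  fun_prop

@[fun_prop] theorem UC.copyB {n d : α → ℕ} (hn : FP n) (hd : FP d) :
    UC fun a => copyB (n a) (d a) :=
  UC.replicate_of hn (encode_or (by fun_prop) (by fun_prop))

@[fun_prop] theorem UC.notB {n d : α → ℕ} (hn : FP n) (hd : FP d) :
    UC fun a => notB (n a) (d a) :=
  UC.replicate_of hn (encode_not (by fun_prop))

@[fun_prop] theorem UC.andB {n d d' : α → ℕ} (hn : FP n) (hd : FP d) (hd' : FP d') :
    UC fun a => andB (n a) (d a) (d' a) :=
  UC.replicate_of hn (encode_and (by fun_prop) (by fun_prop))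

@[fun_prop] theorem UC.orB {n d d' : α → ℕ} (hn : FP n) (hd : FP d) (hd' : FP d') :
    UC fun a => orB (n a) (d a) (d' a) :=
  UC.replicate_of hn (encode_or (by fun_prop) (by fun_prop))

@[fun_prop] theorem UC.bcast {n s : α → ℕ} (hn : FP n) (hs : FP s) :
    UC fun a => bcast (n a) (s a) :=
  UC.cons_of (encode_or hs hs) (UC.replicate_of hn (encode_or (by fun_prop) (by fun_prop)))

@[fun_prop] theorem UC.mux {n s c d : α → ℕ} (hn : FP n) (hs : FP s) (hc : FP c) (hd : FP d) :
    UC fun a => mux (n a) (s a) (c a) (d a) := by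
  unfold Circuit.mux
  fun_prop

/-- The number of layers is a constant, determined by the program being simulated, so no uniformity
in `j` is required. -/
theorem UC.layer {c : α → ℕ → Circuit} (hc : ∀ j, UC fun a => c a j) (n : ℕ) :
    UC fun a => layer (c a) n := by
  induction n with
  | zero => exact UC.nil
  | succ n ih => exact (hc n).append ih

theorem UC.pushPlane {l : α → ℕ} (hl : FP l) (K : ℕ) (b : Bool) :
    UC fun a => pushPlane K (l a) b := by
  refine UC.append ?_ (UC.of_gate (encode_const b))
  fun_prop

theorem UC.popPlane {l : α → ℕ} (hl : FP l) (K : ℕ) : UC fun a => popPlane K (l a) := by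
  refine UC.cons_of (encode_const false) ?_
  fun_prop

theorem UC.pushC {l : α → ℕ} (hl : FP l) (K r : ℕ) (b : Bool) :
    UC fun a => pushC K (l a) r b := by
  refine UC.layer (fun j => ?_) _
  split_ifs
  · exact UC.pushPlane hl K b
  · exact UC.pushPlane hl K true
  · fun_prop

theorem UC.popC {l : α → ℕ} (hl : FP l) (K r : ℕ) : UC fun a => popC K (l a) r := by
  refine UC.layer (fun j => ?_) _
  split_ifs
  · exact UC.popPlane hl K
  · exact UC.popPlane hl K
  · fun_prop

/-- The offsets of the copies and selectors depend on the lengths of the three parts; this is why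
`UC` demands that lengths be computable too. -/
theorem UC.branchC {l : α → ℕ} (hl : FP l) (K r : ℕ) {cNil c0 c1 : α → Circuit} (hn : UC cNil)
    (h0 : UC c0) (h1 : UC c1) : UC fun a => branchC K (l a) r (cNil a) (c0 a) (c1 a) := by
  have hn' := hn.2
  have h0' := h0.2
  have h1' := h1.2
  simp only [Circuit.branchC]
  fun_prop

theorem UC.ofProg {l T : α → ℕ} (hl : FP l) (hT : FP T) (K : ℕ) (p : Prog) :
    UC fun a => ofProg K (l a) (T a) p := by
  induction p with
  | skip => exact UC.nil
  | push r b => exact UC.pushC hl K r b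
  | pop r => exact UC.popC hl K r
  | query r => exact UC.nil
  | seq p q ihp ihq => exact ihp.append ihq
  | branch r pNil p0 p1 ihn ih0 ih1 => exact UC.branchC hl K r ihn ih0 ih1
  | loop r p ih => exact UC.flatten_replicate hT (UC.branchC hl K r UC.nil ih ih)

/-! ### Loading the input, and circuits for polynomial-time functions -/

/-- A circuit producing the wires `x`. -/
def bits (x : Str) : Circuit := x.reverse.map Gate.const

theorem wires_bits (x : Str) (w : List Bool) : wires (bits x) w = x ++ w := by
  have : ∀ (y : Str) (w : List Bool), wires (y.map Gate.const) w = y.reverse ++ w := by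
    intro y
    induction y with
    | nil => exact fun w => rfl
    | cons b y ih =>
      intro w
      rw [List.map_cons, wires_cons, ih]
      simp [Gate.eval]
  rw [bits, this, List.reverse_reverse]

theorem wires_copyB {n d : ℕ} {e v w : List Bool} (hd : d = e.length) (hn : n = v.length) :
    wires (copyB n d) (e ++ v ++ w) = v ++ (e ++ v ++ w) := by
  rw [copyB, wires_replicate n _ _ (fun i => (e ++ v ++ w).getD (d + i) false)]
  · congr 1
    refine List.ext_getElem (by simp [hn]) fun i h1 h2 => ?_
    simp only [List.length_map, List.length_range] at h1
    simp only [List.getElem_map, List.getElem_range, List.append_assoc]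
    rw [getD_append_of_eq (i := i) (by omega), List.getD_append _ _ _ _ h2,
      List.getD_eq_getElem _ _ h2]
  · intro e' he'
    simp only [Gate.eval, Bool.or_self]
    exact getD_append_of_eq (by omega)

/-- Set up the store with the single stack `x ++ v`, if the wires hold `v`. -/
def initC (K l n : ℕ) (x : Str) : Circuit :=
  List.replicate ((2 * K - 2) * (l + 1) + (l + 1 - (x.length + n))) (.const false) ++
  List.replicate (x.length + n) (.const true) ++
  List.replicate (l + 1 - (x.length + n)) (.const false) ++
  copyB n ((2 * K - 2) * (l + 1) + (l + 1) + (l + 1 - (x.length + n))) ++ bits x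

theorem wires_replicate_const (n : ℕ) (b : Bool) (w : List Bool) :
    wires (List.replicate n (.const b)) w = List.replicate n b ++ w := by
  rw [wires_replicate n _ w (fun _ => b) (fun _ _ => rfl)]
  simp

/-- The circuit builds the planes backwards: empty higher stacks and the vacant part of the
occupancy plane of stack 0, its occupied part, the vacant cells of the value plane, and finally the
content `x ++ v`. -/
theorem rep_initC {K l : ℕ} {x v : Str} (hl : x.length + v.length ≤ l + 1) :
    Rep K (l + 1) (wires (initC K l v.length x) v) (St [x ++ v]) := by
  have hw : wires (initC K l v.length x) v =
      (x ++ v ++ List.replicate (l + 1 - (x.length + v.length)) false) ++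
      ((List.replicate (x.length + v.length) true ++
      List.replicate (l + 1 - (x.length + v.length)) false) ++
      (List.replicate ((2 * K - 2) * (l + 1)) false ++ v)) := by
    simp only [initC, wires_append, wires_bits, wires_replicate_const]
    have := wires_copyB (n := v.length)
      (d := (2 * K - 2) * (l + 1) + (l + 1) + (l + 1 - (x.length + v.length)))
      (e := List.replicate (l + 1 - (x.length + v.length)) false ++
        (List.replicate (x.length + v.length) true ++
        (List.replicate ((2 * K - 2) * (l + 1) + (l + 1 - (x.length + v.length))) false)))
      (v := v) (w := []) (by simp; omega) rfl
    simp only [List.append_nil, List.append_assoc] at this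
    rw [this, Nat.add_comm ((2 * K - 2) * (l + 1)), List.replicate_add _ ((2 * K - 2) * (l + 1))]
    simp only [List.append_assoc]
  have h1 : (x ++ v ++ List.replicate (l + 1 - (x.length + v.length)) false).length = l + 1 := by
    simp
    omega
  have h2 : (List.replicate (x.length + v.length) true ++
      List.replicate (l + 1 - (x.length + v.length)) false).length = l + 1 := by
    simp
    omega
  intro j hj i hi
  rw [hw]
  rcases j with _ | _ | j
  · rw [List.getD_append _ _ _ _ (by omega)]
    rcases lt_or_ge i (x ++ v).length with h | h
    · rw [zero_mul, zero_add, List.getD_append _ _ _ _ h]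
      simp [cell]
    · rw [zero_mul, zero_add, List.getD_append_right _ _ _ _ h,
        List.getD_replicate _ (by simp at h ⊢; omega)]
      simp [cell, List.getElem?_eq_none h]
  · rw [getD_append_of_eq (i := i) (by rw [h1]; ring), List.getD_append _ _ _ _ (by omega)]
    rcases lt_or_ge i (x.length + v.length) with h | h
    · rw [List.getD_append _ _ _ _ (by simpa), List.getD_replicate _ h]
      simp [cell, h]
    · rw [List.getD_append_right _ _ _ _ (by simpa), List.getD_replicate _ (by simp; omega)]
      simp [cell]
      omega
  · rw [getD_append_of_eq (i := l + 1 + (j * (l + 1) + i)) (by rw [h1]; ring),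
      getD_append_of_eq (i := j * (l + 1) + i) (by rw [h2])]
    have h3 : (j + 1 + 1) / 2 = j / 2 + 1 := by omega
    have h4 : j * (l + 1) + i < (2 * K - 2) * (l + 1) := by
      have : (j + 1) * (l + 1) ≤ (2 * K - 2) * (l + 1) := Nat.mul_le_mul_right _ (by omega)
      rw [Nat.add_mul, one_mul] at this
      omega
    rw [List.getD_append _ _ _ _ (by simpa), List.getD_replicate _ h4]
    simp [cell, h3]

theorem UC.bits {x : α → Str} (hx : FP x) : UC fun a => bits (x a) := by
  refine ⟨?_, (FP.str_length hx).of_eq fun a => by simp [Circuit.bits]⟩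
  have h : FP fun a => (x a).reverse.foldl
      (fun (s : Str) b => s ++ (true :: false :: false :: b :: [])) ([] : Str) :=
    FP.str_foldl_add (g := fun _ (s : Str) b => s ++ (true :: false :: false :: b :: []))
      (by fun_prop) (FP.const []) (by fun_prop) (PB.const 4)
      (fun _ _ _ => by simp [size_str])
  refine h.of_eq fun a => ?_
  simp only [Circuit.bits, body]
  generalize (x a).reverse = y
  have : ∀ s : Str, y.foldl (fun (s : Str) b => s ++ (true :: false :: false :: b :: [])) s =
      s ++ (y.map Gate.const).flatMap fun g => true :: g.encode := by
    induction y with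
    | nil => simp
    | cons b y ih =>
      intro s
      rw [List.foldl_cons, ih]
      simp [Gate.encode]
  simpa using this []

theorem UC.initC {l n : α → ℕ} {x : α → Str} (hl : FP l) (hn : FP n) (hx : FP x) (K : ℕ) :
    UC fun a => initC K (l a) (n a) (x a) := by
  unfold Circuit.initC
  refine ((((UC.replicate_of ?_ (encode_const _)).append
    (UC.replicate_of ?_ (encode_const _))).append
    (UC.replicate_of ?_ (encode_const _))).append (UC.copyB hn ?_)).append (UC.bits hx) <;> fun_prop

/-- Polynomial-time functions of an instance and a string of given length are computed by
polynomial-time generated circuits. -/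
theorem exists_of_fp {f : α × Str → Str} (hf : FP f) {n : α → ℕ} (hn : FP n) :
    ∃ C : α → Circuit, (FP fun a => encode (C a)) ∧
      ∀ a v, v.length = n a → eval (C a) (f (a, v)).length v = f (a, v) := by
  obtain ⟨p, m, ⟨M, hM⟩, hp⟩ := hf
  -- The code of `(a, v)` is this prefix followed by `v`: the prefix is hardwired and `v` is the
  -- input of the circuit.
  let x : α → Str := fun a => dbl (enc a)
  have hx : FP x := (FP.prodMk FP.id (FP.const ([] : Str))).enc_comp.of_eq fun a => by
    simp [x, enc_pair, enc_str]
  let T : α → ℕ := fun a => M.eval ((x a).length + n a)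
  have hT : FP T := by fun_prop
  -- Input length plus time, which bounds the heights of all stacks throughout the run.
  let l : α → ℕ := fun a => (x a).length + n a + T a
  have hl : FP l := by fun_prop
  let C : α → Circuit := fun a => Circuit.initC (p.regs + 1) (l a) (n a) (x a) ++
    Circuit.ofProg (p.regs + 1) (l a) (T a) p
  have hC : UC C := (UC.initC hl hn hx _).append (UC.ofProg hl hT _ p)
  refine ⟨C, (hC.1.str_append (FP.const [false])).of_eq fun a => (encode_eq_body _).symm,
    fun a v hv => ?_⟩
  obtain ⟨t, ht, hr⟩ := hp (a, v)
  have ht' : t ≤ T a := by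
    have hsize : size (a, v) = (x a).length + n a := by simp [x, size, enc_pair, enc_str, hv]
    exact (ht.trans (hM _)).trans (by rw [hsize])
  have hlen : (x a).length + v.length + T a ≤ l a := by simp [l, hv]
  have hrep : Rep (p.regs + 1) (l a + 1) (wires (C a) v) (St [f (a, v)]) := by
    rw [wires_append, ← hv]
    refine rep_ofProg (Nat.le_succ _) hr ht' (fun r => ?_) (rep_initC (by omega))
    rcases r with _ | r
    · rw [St_cons_zero]
      have : (enc (a, v)).length = (x a).length + v.length := by simp [x, enc_pair, enc_str]
      omega
    · simp
      omega
  have hout := hr.length_le 0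
  simp only [St_cons_zero] at hout
  have hin : (enc (a, v)).length = (x a).length + v.length := by simp [x, enc_pair, enc_str]
  refine List.ext_getElem (by simp [eval]) fun i h1 h2 => ?_
  have h3 := hrep 0 (by omega) i (by rw [enc_str] at hout; omega)
  simp only [zero_mul, zero_add, cell, Nat.zero_mod, if_true, Nat.zero_div, St_cons_zero] at h3
  simp only [eval, List.getElem_map, List.getElem_range]
  rw [h3, List.getD_eq_getElem _ _ h2]

end Circuit

/-! ### Local search problems given by polynomial-time functions -/

theorem binVal_append (x y : Str) : binVal (x ++ y) = binVal x * 2 ^ y.length + binVal y := by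
  induction y using List.reverseRecOn with
  | nil => simp [binVal]
  | append_singleton y b ih =>
    simp only [binVal, ← List.append_assoc, List.foldl_append, List.foldl_cons, List.foldl_nil,
      List.length_append, List.length_singleton, pow_succ] at ih ⊢
    rw [ih]
    ring

theorem binVal_cons (b : Bool) (x : Str) : binVal (b :: x) = b.toNat * 2 ^ x.length + binVal x := by
  rw [← List.singleton_append, binVal_append]
  simp [binVal]

theorem binVal_replicate_false (n : ℕ) : binVal (List.replicate n false) = 0 := by
  induction n with
  | zero => rfl
  | succ n ih => simp [List.replicate_succ, binVal_cons, ih]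

/-- Remove the leading zeros. -/
def stripZeros (x : Str) : Str := (fun x : Str => bif x.headD false then x else x.tail)^[x.length] x

theorem iterate_stripZeros (u : Str) (k j : ℕ) (h : k ≤ j) :
    (fun x : Str => bif x.headD false then x else x.tail)^[j]
      (List.replicate k false ++ true :: u) =
      true :: u := by
  induction j generalizing k with
  | zero =>
    obtain rfl : k = 0 := by omega
    rfl
  | succ j ih =>
    rw [Function.iterate_succ_apply]
    rcases k with _ | k
    · exact ih 0 (by omega)
    · exact ih k (by omega)

theorem stripZeros_append (u : Str) (k : ℕ) :
    stripZeros (List.replicate k false ++ true :: u) = true :: u :=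
  iterate_stripZeros _ _ _ (by simp)

theorem stripZeros_replicate (k : ℕ) : stripZeros (List.replicate k false) = [] := by
  rw [stripZeros, List.length_replicate]
  induction k with
  | zero => rfl
  | succ k ih =>
    rw [Function.iterate_succ_apply]
    exact ih

theorem eq_zeros_or (x : Str) : x = List.replicate x.length false ∨
    ∃ k u, x = List.replicate k false ++ true :: u := by
  induction x with
  | nil => exact .inl rfl
  | cons b x ih =>
    cases b with
    | true => exact .inr ⟨0, x, rfl⟩
    | false =>
      rcases ih with h | ⟨k, u, h⟩
      · refine .inl ?_
        rw [List.length_cons, List.replicate_succ, ← h]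
      · exact .inr ⟨k + 1, u, by rw [h]; rfl⟩

@[fun_prop] theorem FP.stripZeros {α : Type} [Code α] {f : α → Str} (hf : FP f) :
    FP fun a => stripZeros (f a) := by
  refine (?_ : FP fun x : Str => DSR.stripZeros x).comp hf
  refine FP.iterate_nat (B := fun x : Str => size x) (by fun_prop) FP.id (by fun_prop) PB.size
    fun x i hi => ?_
  clear hi
  induction i with
  | zero => exact le_rfl
  | succ i ih =>
    rw [Function.iterate_succ_apply']
    refine le_trans ?_ ih
    generalize (fun x : Str => bif x.headD false then x else x.tail)^[i] x = y
    cases h : y.headD false <;> simp [size_str]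

/-- Code strings of length at most `n` by strings of length `n + 1`. -/
def pad (n : ℕ) (u : Str) : Str := List.replicate (n - u.length) false ++ true :: u

theorem length_pad {n : ℕ} {u : Str} (h : u.length ≤ n) : (pad n u).length = n + 1 := by
  simp [pad]
  omega

theorem stripZeros_pad (n : ℕ) (u : Str) : stripZeros (pad n u) = true :: u :=
  stripZeros_append _ _

theorem pad_injective (n : ℕ) : Function.Injective (pad n) := fun u v h => by
  have := congrArg stripZeros h
  simpa [stripZeros_pad] using this

theorem pad_ne_zeros (n k : ℕ) (u : Str) : pad n u ≠ List.replicate k false := fun h => by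
  have := congrArg stripZeros h
  simp [stripZeros_pad, stripZeros_replicate] at this

theorem eq_zeros_or_pad {n : ℕ} {v : Str} (hv : v.length = n + 1) :
    v = List.replicate (n + 1) false ∨ ∃ u, u.length ≤ n ∧ v = pad n u := by
  rcases eq_zeros_or v with h | ⟨k, u, h⟩
  · exact .inl (hv ▸ h)
  · refine .inr ⟨u, ?_, ?_⟩
    · rw [h] at hv
      simp at hv
      omega
    · rw [h, pad]
      congr 2
      rw [h] at hv
      simp at hv
      omega

/-- Sink-of-DAG prescribes the source 0…0 and demands that it have a proper successor. States `u` of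
length at most `n x` therefore become the nonzero strings `pad (n x) u`, and the zero string is an
extra source leading to `init x`. Values of states get a leading 1 and the source has value 0, so
the extra edge always increases. A solution at the source thus means that `init x` is a fixed point,
which is `sol_init`; every other solution is covered by `sol`. -/
theorem polyReducible_sinkOfDAG {R : SearchProblem} {n m : Str → ℕ} {init : Str → Str}
    {succ val out : Str × Str → Str} (hn : FP n) (hm : FP m) (hinit : FP init) (hsucc : FP succ)
    (hval : FP val) (hout : FP out) (init_le : ∀ x, (init x).length ≤ n x)
    (succ_le : ∀ x u, u.length ≤ n x → (succ (x, u)).length ≤ n x)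
    (length_val : ∀ x u, u.length ≤ n x → (val (x, u)).length = m x)
    (sol_init : ∀ x, succ (x, init x) = init x → R x (out (x, init x)))
    (sol : ∀ x u, u.length ≤ n x → succ (x, u) ≠ u →
      (succ (x, succ (x, u)) = succ (x, u) ∨
        binVal (val (x, succ (x, u))) ≤ binVal (val (x, u))) → R x (out (x, u))) :
    PolyReducible R SinkOfDAG := by
  let S : Str × Str → Str := fun a => pad (n a.1) (bif (stripZeros a.2).isEmpty then init a.1
    else succ (a.1, (stripZeros a.2).tail))
  let V : Str × Str → Str := fun a => bif (stripZeros a.2).isEmpty then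
    List.replicate (m a.1 + 1) false else true :: val (a.1, (stripZeros a.2).tail)
  let g : Str × Str → Str := fun a => out (a.1, bif (stripZeros a.2).isEmpty then init a.1
    else (stripZeros a.2).tail)
  have hS : FP S := by
    unfold S pad
    fun_prop
  have hV : FP V := by fun_prop
  have hg : FP g := by fun_prop
  have S_zero : ∀ x k, S (x, List.replicate k false) = pad (n x) (init x) := fun x k => by
    simp [S, stripZeros_replicate]
  have S_pad : ∀ x u, S (x, pad (n x) u) = pad (n x) (succ (x, u)) := fun x u => by
    simp [S, stripZeros_pad]
  have V_zero : ∀ x k, V (x, List.replicate k false) = List.replicate (m x + 1) false :=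
    fun x k => by simp [V, stripZeros_replicate]
  have V_pad : ∀ x u, V (x, pad (n x) u) = true :: val (x, u) := fun x u => by
    simp [V, stripZeros_pad]
  have S_len : ∀ x v, v.length = n x + 1 → (S (x, v)).length = n x + 1 := by
    intro x v hv
    rcases eq_zeros_or_pad hv with rfl | ⟨u, hu, rfl⟩
    · rw [S_zero, length_pad (init_le x)]
    · rw [S_pad, length_pad (succ_le x u hu)]
  have V_len : ∀ x v, v.length = n x + 1 → (V (x, v)).length = m x + 1 := by
    intro x v hv
    rcases eq_zeros_or_pad hv with rfl | ⟨u, hu, rfl⟩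
    · rw [V_zero, List.length_replicate]
    · rw [V_pad, List.length_cons, length_val x u hu]
  clear_value S V
  obtain ⟨CS, hCS, hS'⟩ := Circuit.exists_of_fp hS (n := fun x => n x + 1) (by fun_prop)
  obtain ⟨CV, hCV, hV'⟩ := Circuit.exists_of_fp hV (n := fun x => n x + 1) (by fun_prop)
  let I : Str → DAGInstance := fun x => ⟨n x + 1, m x + 1, CS x, CV x⟩
  have IS : ∀ x v, v.length = n x + 1 → (I x).S v = S (x, v) := fun x v hv => by
    have := hS' x v hv
    rwa [S_len x v hv] at this
  have IV : ∀ x v, v.length = n x + 1 → (I x).V v = binVal (V (x, v)) := fun x v hv => by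
    have := hV' x v hv
    rw [V_len x v hv] at this
    exact congrArg binVal this
  have hI : FP fun x => (I x).encode := by
    simp only [DAGInstance.encode, I]
    fun_prop
  refine ⟨fun x => (I x).encode, fun x y => g (x, y), hI.polyTime_one, hg.polyTime_two, ?_⟩
  intro x y hy
  change R x (g (x, y))
  have hvalid : (I x).Valid := by
    change (I x).S (List.replicate (n x + 1) false) ≠ List.replicate (n x + 1) false
    rw [IS _ _ (by simp), S_zero]
    exact pad_ne_zeros _ _ _
  rcases hy with ⟨J, hJ, -, hlen, hne, h⟩ | ⟨h, -⟩
  swap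
  · exact absurd ⟨I x, rfl, hvalid⟩ h
  obtain rfl := DAGInstance.encode_injective hJ
  have hl : y.length = n x + 1 := hlen
  have hl' : ((I x).S y).length = n x + 1 := by rw [IS x y hl, S_len x y hl]
  rw [IS x _ hl', IV x _ hl', IS x y hl, IV x y hl] at h
  rw [IS x y hl] at hne
  rcases eq_zeros_or_pad hl with rfl | ⟨u, hu, rfl⟩
  · rw [S_zero, S_pad, V_pad, V_zero, binVal_replicate_false, binVal_cons] at h
    have : g (x, List.replicate (n x + 1) false) = out (x, init x) := by
      simp [g, stripZeros_replicate]
    rw [this]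
    refine sol_init x (pad_injective _ (h.resolve_right ?_))
    simp
  · have : g (x, pad (n x) u) = out (x, u) := by
      simp [g, stripZeros_pad]
    rw [this]
    rw [S_pad, S_pad, V_pad, V_pad, binVal_cons, binVal_cons, length_val x u hu,
      length_val x _ (succ_le x u hu)] at h
    rw [S_pad] at hne
    refine sol x u hu (fun h => hne (by rw [h])) (h.imp (fun h => pad_injective _ h) fun h => ?_)
    omega

/-! ### Running an oracle program with a table of answers -/

/-- Tables of queries and answers. -/
abbrev Table := List (Str × Str)

/-- The answer to the query `z`. -/
def lookup (z : Str) (tab : Table) : Option Str :=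
  tab.foldl (fun o e => bif o.isSome then o else bif decide (e.1 = z) then some e.2 else none) none

theorem lookup_nil (z : Str) : lookup z [] = none := rfl

theorem lookup_cons (z : Str) (e : Str × Str) (tab : Table) :
    lookup z (e :: tab) = if e.1 = z then some e.2 else lookup z tab := by
  have : ∀ (tab : Table) (y : Str), tab.foldl (fun o e => bif o.isSome then o else
      bif decide (e.1 = z) then some e.2 else none) (some y) = some y := by
    intro tab y
    induction tab with
    | nil => rfl
    | cons e tab ih => exact ih
  by_cases h : e.1 = z
  · simp [lookup, h, this]
  · simp [lookup, h]

theorem mem_of_lookup {z y : Str} {tab : Table} (h : lookup z tab = some y) : (z, y) ∈ tab := by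
  induction tab with
  | nil => simp [lookup_nil] at h
  | cons e tab ih =>
    rw [lookup_cons] at h
    split_ifs at h with hz
    · obtain rfl := hz
      obtain rfl : e.2 = y := by simpa using h
      exact List.mem_cons_self
    · exact List.mem_cons_of_mem _ (ih h)

theorem size_lookup_le (z : Str) (tab : Table) : ((lookup z tab).getD []).length ≤ size tab := by
  cases h : lookup z tab with
  | none => simp
  | some y =>
    have h1 := FP.size_mem_list (mem_of_lookup h)
    rw [size_pair, size_str y] at h1
    simp only [Option.getD_some]
    omega

/-! ### Stores as coded data -/

/-- Stores of which the first `K` stacks matter. -/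
structure KStore (K : ℕ) where
  stack : Store

/-- Replace the content of a stack. -/
def KStore.set {K : ℕ} (s : KStore K) (r : ℕ) (u : Str) : KStore K :=
  ⟨Function.update s.stack r u⟩

theorem KStore.stack_set {K : ℕ} (s : KStore K) (r : ℕ) (u : Str) :
    (s.set r u).stack r = u := Function.update_self ..

theorem KStore.stack_set_of_ne {K : ℕ} (s : KStore K) {r i : ℕ} (h : i ≠ r) (u : Str) :
    (s.set r u).stack i = s.stack i := Function.update_of_ne h ..

instance (K : ℕ) : Code (KStore K) := ⟨fun s => enc (List.map s.stack (List.range K))⟩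

section

variable {K : ℕ}

theorem FP.kstore_get {s : α → KStore K} (hs : FP s) {r : ℕ} (hr : r < K) :
    FP fun a => (s a).stack r := by
  refine (?_ : FP fun s : KStore K => s.stack r).comp hs
  have h0 : FP fun s : KStore K => (List.range K).map s.stack := .of_enc fun _ => rfl
  have h1 : ∀ r, FP fun s : KStore K => ((List.range K).map s.stack).drop r := by
    intro r
    induction r with
    | zero => exact h0
    | succ r ih => exact ih.list_tail.of_eq fun s => by rw [List.tail_drop]
  refine ((h1 r).list_headD []).of_eq fun s => ?_
  rw [List.headD_eq_head?_getD, List.head?_drop]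
  simp [hr]

theorem FP.kstore_mk {f : α → KStore K} (hf : ∀ i < K, FP fun a => (f a).stack i) : FP f := by
  have h : ∀ l : List ℕ, (∀ i ∈ l, i < K) → FP fun a => l.map (f a).stack := by
    intro l
    induction l with
    | nil => exact fun _ => FP.const []
    | cons i l ih =>
      exact fun h => (hf i (h i (by simp))).list_cons (ih fun j hj => h j (by simp [hj]))
  obtain ⟨p, m, hm, hp⟩ := h (List.range K) fun i hi => List.mem_range.mp hi
  exact ⟨p, m, hm, hp⟩

theorem FP.kstore_set {s : α → KStore K} (hs : FP s) {u : α → Str} (hu : FP u) (r : ℕ) :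
    FP fun a => (s a).set r (u a) := by
  refine FP.kstore_mk fun i hi => ?_
  by_cases h : i = r
  · subst h
    exact hu.of_eq fun a => (KStore.stack_set ..).symm
  · exact (FP.kstore_get hs hi).of_eq fun a => (KStore.stack_set_of_ne _ h _).symm

theorem size_kstore (s : KStore K) :
    size s = ∑ i ∈ Finset.range K, (2 * (s.stack i).length + 1) := by
  have h : ∀ l : List ℕ, size (l.map s.stack) =
      (l.map fun i => 2 * (s.stack i).length + 1).sum := by
    intro l
    induction l with
    | nil => rfl
    | cons i l ih => rw [List.map_cons, size_cons, ih, List.map_cons, List.sum_cons, size_str]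
  exact h (List.range K)

theorem size_set {s : KStore K} {r : ℕ} (hr : r < K) (u : Str) :
    size (s.set r u) + 2 * (s.stack r).length = size s + 2 * u.length := by
  rw [size_kstore, size_kstore, ← Finset.add_sum_erase _ _ (Finset.mem_range.mpr hr),
    ← Finset.add_sum_erase (Finset.range K) (fun i => 2 * (s.stack i).length + 1)
      (Finset.mem_range.mpr hr), KStore.stack_set]
  rw [Finset.sum_congr rfl (g := fun i => 2 * (s.stack i).length + 1) fun i hi => by
    rw [KStore.stack_set_of_ne _ (Finset.ne_of_mem_erase hi)]]
  omega

end

namespace Prog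

/-- Outcome of a program on a store: either an unanswered query has been met, or a store is
reached. Loops are iterated `fuel` times only. -/
def evalTab {K : ℕ} (fuel : ℕ) (tab : Table) : Prog → Option Str × KStore K → Option Str × KStore K
  | skip, t => t
  | push r b, t => bif t.1.isSome then t else (none, t.2.set r (b :: t.2.stack r))
  | pop r, t => bif t.1.isSome then t else (none, t.2.set r (t.2.stack r).tail)
  | query r, t => bif t.1.isSome then t else
      bif (lookup (t.2.stack r) tab).isSome then
        (none, t.2.set r ((lookup (t.2.stack r) tab).getD []))
      else (some (t.2.stack r), t.2.set r [])
  | seq p q, t => q.evalTab fuel tab (p.evalTab fuel tab t)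
  | branch r pNil p0 p1, t => bif (t.2.stack r).isEmpty then pNil.evalTab fuel tab t else
      bif (t.2.stack r).headD false then p1.evalTab fuel tab t else p0.evalTab fuel tab t
  | loop r p, t => (fun t => bif t.1.isSome || (t.2.stack r).isEmpty then t
      else p.evalTab fuel tab t)^[fuel] t

/-- The number of instructions executed at most by `evalTab`. -/
def cost (fuel : ℕ) : Prog → ℕ
  | skip => 0
  | push _ _ => 1
  | pop _ => 1
  | query _ => 1
  | seq p q => p.cost fuel + q.cost fuel
  | branch _ pNil p0 p1 => pNil.cost fuel + (p0.cost fuel + p1.cost fuel)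
  | loop _ p => fuel * p.cost fuel

variable {K : ℕ}

theorem fp_cost {fuel : α → ℕ} (hf : FP fuel) (p : Prog) : FP fun a => p.cost (fuel a) := by
  induction p with
  | skip => exact FP.const 0
  | push r b => exact FP.const 1
  | pop r => exact FP.const 1
  | query r => exact FP.const 1
  | seq p q ihp ihq => exact ihp.nat_add ihq
  | branch r pNil p0 p1 ihn ih0 ih1 => exact ihn.nat_add (ih0.nat_add ih1)
  | loop r p ih => exact hf.nat_mul ih

theorem size_iterate_le {σ : Type} [Code σ] {f : σ → σ} {c : ℕ} (h : ∀ s, size (f s) ≤ size s + c)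
    (i : ℕ) (s : σ) : size (f^[i] s) ≤ size s + i * c := by
  induction i generalizing s with
  | zero => simp
  | succ i ih =>
    rw [Function.iterate_succ_apply, Nat.succ_mul]
    have h1 := ih (f s)
    have h2 := h s
    omega

/-- An instruction lengthens the code by at most `2 + 2 * size tab`. An unanswered query keeps to
this because `evalTab` moves the query out of its stack instead of copying it. The bound must hold
for all states and tables, since it justifies the iteration behind `loop`. -/
theorem size_evalTab (p : Prog) (hp : p.regs ≤ K) (fuel : ℕ) (tab : Table)
    (t : Option Str × KStore K) :
    size (p.evalTab fuel tab t) ≤ size t + p.cost fuel * (2 + 2 * size tab) := by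
  induction p generalizing t with
  | skip => simp [evalTab]
  | push r b =>
    obtain ⟨_ | z, s⟩ := t
    · have := size_set (s := s) (show r < K from hp) (b :: s.stack r)
      simp only [evalTab, cost, Option.isSome_none, cond_false, size_pair,
        List.length_cons] at this ⊢
      omega
    · simp [evalTab]
  | pop r =>
    obtain ⟨_ | z, s⟩ := t
    · have := size_set (s := s) (show r < K from hp) (s.stack r).tail
      simp only [evalTab, cost, Option.isSome_none, cond_false, size_pair,
        List.length_tail] at this ⊢
      omega
    · simp [evalTab]
  | query r =>
    obtain ⟨_ | z, s⟩ := t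
    · have h1 := size_set (s := s) (show r < K from hp) ((lookup (s.stack r) tab).getD [])
      have h2 := size_set (s := s) (show r < K from hp) []
      have h3 := size_lookup_le (s.stack r) tab
      simp only [evalTab, cost, Option.isSome_none, cond_false]
      cases (lookup (s.stack r) tab).isSome
      · simp only [cond_false, size_pair, size_some, size_none, size_str, List.length_nil] at h2 ⊢
        omega
      · simp only [cond_true, size_pair]
        omega
    · simp [evalTab]
  | seq p q ihp ihq =>
    simp only [regs, max_le_iff] at hp
    simp only [evalTab, cost]
    have h1 := ihp hp.1 t
    have h2 := ihq hp.2 (p.evalTab fuel tab t)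
    rw [Nat.add_mul]
    omega
  | branch r pNil p0 p1 ihn ih0 ih1 =>
    simp only [regs, max_le_iff] at hp
    simp only [evalTab, cost]
    have h1 := ihn hp.2.1 t
    have h2 := ih0 hp.2.2.1 t
    have h3 := ih1 hp.2.2.2 t
    rw [Nat.add_mul, Nat.add_mul]
    cases (t.2.stack r).isEmpty <;> cases (t.2.stack r).headD false <;>
      simp only [cond_true, cond_false] <;>
      omega
  | loop r p ih =>
    simp only [regs, max_le_iff] at hp
    simp only [evalTab, cost]
    rw [Nat.mul_assoc]
    refine size_iterate_le (fun t => ?_) _ _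
    have := ih hp.2 t
    cases t.1.isSome || (t.2.stack r).isEmpty <;> simp only [cond_true, cond_false] <;> omega

theorem fp_lookup {z : α → Str} {tab : α → Table} (hz : FP z) (ht : FP tab) :
    FP fun a => lookup (z a) (tab a) := by
  refine FP.list_foldl_add (g := fun a (o : Option Str) (e : Str × Str) => bif o.isSome then o else
    bif decide (e.1 = z a) then some e.2 else none) (C := fun a => size (tab a) + 1) ht
    (FP.const none) (by fun_prop) (ht.pb.add (PB.const 1)) fun a o e he => ?_
  cases o with
  | some o => simp
  | none =>
    have h := FP.size_mem_list he
    rw [size_pair] at h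
    cases decide (e.1 = z a)
    · simp
    · simp only [Option.isSome_none, cond_false, cond_true, size_some]
      omega

theorem fp_evalTab_aux (p : Prog) (hp : p.regs ≤ K) :
    FP fun a : (ℕ × Table) × (Option Str × KStore K) => p.evalTab a.1.1 a.1.2 a.2 := by
  induction p with
  | skip => simp only [evalTab]; fun_prop
  | push r b =>
    have hg : FP fun a : (ℕ × Table) × (Option Str × KStore K) => a.2.2.stack r :=
      FP.kstore_get (by fun_prop) hp
    have hu := FP.kstore_set (K := K) (s := fun a : (ℕ × Table) × (Option Str × KStore K) =>
      a.2.2) (by fun_prop) (hg.str_cons_const b) r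
    simp only [evalTab]
    fun_prop
  | pop r =>
    have hg : FP fun a : (ℕ × Table) × (Option Str × KStore K) => a.2.2.stack r :=
      FP.kstore_get (by fun_prop) hp
    have hu := FP.kstore_set (K := K) (s := fun a : (ℕ × Table) × (Option Str × KStore K) =>
      a.2.2) (by fun_prop) hg.str_tail r
    simp only [evalTab]
    fun_prop
  | query r =>
    have hg : FP fun a : (ℕ × Table) × (Option Str × KStore K) => a.2.2.stack r :=
      FP.kstore_get (by fun_prop) hp
    have hl := fp_lookup hg (tab := fun a : (ℕ × Table) × (Option Str × KStore K) => a.1.2)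
      (by fun_prop)
    have hu := FP.kstore_set (K := K) (s := fun a : (ℕ × Table) × (Option Str × KStore K) =>
      a.2.2) (by fun_prop) (hl.opt_getD (FP.const [])) r
    have hu' := FP.kstore_set (K := K) (s := fun a : (ℕ × Table) × (Option Str × KStore K) =>
      a.2.2) (by fun_prop) (FP.const []) r
    simp only [evalTab]
    fun_prop
  | seq p q ihp ihq =>
    simp only [regs, max_le_iff] at hp
    exact (ihq hp.2).comp (f := fun a : (ℕ × Table) × (Option Str × KStore K) =>
      (a.1, p.evalTab a.1.1 a.1.2 a.2)) (FP.fst.pair (ihp hp.1))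
  | branch r pNil p0 p1 ihn ih0 ih1 =>
    simp only [regs, max_le_iff] at hp
    have hg : FP fun a : (ℕ × Table) × (Option Str × KStore K) => a.2.2.stack r :=
      FP.kstore_get (by fun_prop) hp.1
    exact hg.str_isEmpty.cond (ihn hp.2.1) (hg.str_headD.cond (ih1 hp.2.2.2) (ih0 hp.2.2.1))
  | loop r p ih =>
    simp only [regs, max_le_iff] at hp
    have hg : FP fun a : (ℕ × Table) × (Option Str × KStore K) => a.2.2.stack r :=
      FP.kstore_get (by fun_prop) hp.1
    set step : (ℕ × Table) × (Option Str × KStore K) → (ℕ × Table) × (Option Str × KStore K) :=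
      fun a => (a.1, bif a.2.1.isSome || (a.2.2.stack r).isEmpty then a.2
        else p.evalTab a.1.1 a.1.2 a.2) with hstep
    have hs : FP step := FP.fst.pair ((FP.or (FP.opt_isSome (by fun_prop)) hg.str_isEmpty).cond
      FP.snd (ih hp.2))
    have key : ∀ i (c : ℕ × Table) t, step^[i] (c, t) = (c, (fun t : Option Str × KStore K =>
        bif t.1.isSome || (t.2.stack r).isEmpty then t else p.evalTab c.1 c.2 t)^[i] t) := by
      intro i c
      induction i with
      | zero => exact fun t => rfl
      | succ i ih =>
        intro t
        rw [Function.iterate_succ_apply, Function.iterate_succ_apply]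
        exact ih _
    have hc : FP fun a : (ℕ × Table) × (Option Str × KStore K) => p.cost a.1.1 :=
      fp_cost (by fun_prop) p
    have hf : FP fun a : (ℕ × Table) × (Option Str × KStore K) => a.1.1 := by fun_prop
    have ht : FP fun a : (ℕ × Table) × (Option Str × KStore K) => a.1.2 := by fun_prop
    refine (FP.comp_snd (FP.iterate_nat (B := fun a : (ℕ × Table) × (Option Str × KStore K) =>
      size a + a.1.1 * (p.cost a.1.1 * (2 + 2 * size a.1.2))) hf FP.id hs ?_
      fun a i hi => ?_)).of_eq fun a => ?_
    · exact PB.size.add (hf.pb_nat.mul (hc.pb_nat.mul ((PB.const 2).add ((PB.const 2).mul ht.pb))))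
    · obtain ⟨c, t⟩ := a
      have h0 := size_pair c t
      simp only
      rw [key, size_pair, h0]
      have h1 := size_iterate_le (f := fun t : Option Str × KStore K =>
        bif t.1.isSome || (t.2.stack r).isEmpty then t else p.evalTab c.1 c.2 t)
        (c := p.cost c.1 * (2 + 2 * size c.2)) (fun t => by
          have := size_evalTab p hp.2 c.1 c.2 t
          cases t.1.isSome || (t.2.stack r).isEmpty <;>
            simp only [cond_true, cond_false] <;> omega) i t
      have h2 := Nat.mul_le_mul_right (p.cost c.1 * (2 + 2 * size c.2)) hi
      simp only at h2 hi
      omega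
    · rw [key]
      rfl

theorem fp_evalTab (p : Prog) (hp : p.regs ≤ K) {fuel : α → ℕ} {tab : α → Table}
    {t : α → Option Str × KStore K} (hf : FP fuel) (hta : FP tab) (ht : FP t) :
    FP fun a => p.evalTab (fuel a) (tab a) (t a) :=
  (fp_evalTab_aux p hp).comp (f := fun a => ((fuel a, tab a), t a)) (by fun_prop)

/-- An unanswered query freezes the state, so the rest of the program can be evaluated without
testing for it. -/
theorem evalTab_some (p : Prog) (fuel : ℕ) (tab : Table) (z : Str) (s : KStore K) :
    p.evalTab fuel tab (some z, s) = (some z, s) := by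
  induction p with
  | skip => rfl
  | push r b => rfl
  | pop r => rfl
  | query r => rfl
  | seq p q ihp ihq => rw [evalTab, ihp, ihq]
  | branch r pNil p0 p1 ihn ih0 ih1 =>
    rw [evalTab, ihn, ih0, ih1]
    simp
  | loop r p ih =>
    rw [evalTab]
    exact Function.iterate_fixed (by simp) _

/-- The outcome of `evalTab` compared to a run with oracle. -/
def Outcome (K : ℕ) (Q : List Str) (tab : Table) (s' : Store) (o : Option Str × KStore K) : Prop :=
  o = (none, ⟨s'⟩) ∨ ∃ z ∈ Q, lookup z tab = none ∧ o.1 = some z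

/-- `Q` lists the queries of the run with oracle, before any table is chosen. With a table agreeing
with the oracle, the evaluation follows the run until it meets a query missing from the table, and
that query is in `Q`. That one `Q` serves all such tables is what bounds the number of answers later
on. -/
theorem evalTab_of_runs {O : Str → Option Str} {p : Prog} {s s' : Store} {t : ℕ}
    (h : p.Runs O s t s') :
    ∃ Q : List Str, Q.length ≤ t ∧ (∀ z ∈ Q, O z ≠ none) ∧ ∀ fuel ≥ t, ∀ tab : Table,
      (∀ z y a, lookup z tab = some y → O z = some a → y = a) →
      Outcome K Q tab s' (p.evalTab fuel tab ((none, ⟨s⟩) : Option Str × KStore K)) := by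
  have mono : ∀ {Q Q' : List Str} {tab s'} {o : Option Str × KStore K}, Q ⊆ Q' →
      Outcome K Q tab s' o → Outcome K Q' tab s' o := by
    rintro Q Q' tab s' o hQ (h | ⟨z, hz, h⟩)
    · exact .inl h
    · exact .inr ⟨z, hQ hz, h⟩
  have comp : ∀ {Q : List Str} {tab : Table} {s₁ s₂ : Store} {o : Option Str × KStore K}
      {f : Option Str × KStore K → Option Str × KStore K}, (∀ z s, f (some z, s) = (some z, s)) →
      Outcome K Q tab s₁ o → Outcome K Q tab s₂ (f (none, ⟨s₁⟩)) → Outcome K Q tab s₂ (f o) := by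
    rintro Q tab s₁ s₂ ⟨o, s⟩ f hf (h | ⟨z, hz, h, h'⟩) h₂
    · rwa [h]
    · simp only at h'
      subst h'
      rw [hf]
      exact .inr ⟨z, hz, h, rfl⟩
  induction p generalizing s s' t with
  | skip => cases h; exact ⟨[], by simp, by simp, fun _ _ _ _ => .inl rfl⟩
  | push r b => cases h; exact ⟨[], by simp, by simp, fun _ _ _ _ => .inl rfl⟩
  | pop r => cases h; exact ⟨[], by simp, by simp, fun _ _ _ _ => .inl rfl⟩
  | query r =>
    cases h with
    | query _ _ a ha =>
      refine ⟨[s r], le_rfl, by simp [ha], fun _ _ tab htab => ?_⟩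
      simp only [evalTab, Option.isSome_none, cond_false]
      cases hl : lookup (s r) tab with
      | none => exact .inr ⟨s r, by simp, hl, rfl⟩
      | some y =>
        obtain rfl := htab _ _ _ hl ha
        exact .inl rfl
  | seq p q ihp ihq =>
    cases h with
    | seq h h' =>
      obtain ⟨Q, hQ, hO, H⟩ := ihp h
      obtain ⟨Q', hQ', hO', H'⟩ := ihq h'
      refine ⟨Q ++ Q', by simp; omega, ?_, fun fuel hf tab htab => ?_⟩
      · simp only [List.mem_append]
        rintro z (hz | hz)
        exacts [hO z hz, hO' z hz]
      · exact comp (f := q.evalTab fuel tab) (fun z s => evalTab_some q fuel tab z s)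
          (mono (List.subset_append_left _ _) (H fuel (by omega) tab htab))
          (mono (List.subset_append_right _ _) (H' fuel (by omega) tab htab))
  | branch r pNil p0 p1 ihn ih0 ih1 =>
    cases h with
    | branchNil hr h =>
      obtain ⟨Q, hQ, hO, H⟩ := ihn h
      refine ⟨Q, by omega, hO, fun fuel hf tab htab => ?_⟩
      simp only [evalTab, hr]
      exact H fuel (by omega) tab htab
    | branch0 hr h =>
      obtain ⟨Q, hQ, hO, H⟩ := ih0 h
      refine ⟨Q, by omega, hO, fun fuel hf tab htab => ?_⟩
      simp only [evalTab, hr]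
      exact H fuel (by omega) tab htab
    | branch1 hr h =>
      obtain ⟨Q, hQ, hO, H⟩ := ih1 h
      refine ⟨Q, by omega, hO, fun fuel hf tab htab => ?_⟩
      simp only [evalTab, hr]
      exact H fuel (by omega) tab htab
  | loop r p ih =>
    have key : ∀ n, ∀ s t, t ≤ n → (Prog.loop r p).Runs O s t s' →
        ∃ Q : List Str, Q.length ≤ t ∧ (∀ z ∈ Q, O z ≠ none) ∧ ∀ fuel ≥ t, ∀ k ≥ t, ∀ tab : Table,
        (∀ z y a, lookup z tab = some y → O z = some a → y = a) →
        Outcome K Q tab s' ((fun t : Option Str × KStore K =>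
          bif t.1.isSome || (t.2.stack r).isEmpty then t
            else p.evalTab fuel tab t)^[k] (none, ⟨s⟩)) := by
      intro n
      induction n with
      | zero =>
        intro s t ht h
        cases h <;> omega
      | succ n ihn =>
        intro s t ht h
        cases h with
        | loopDone hr =>
          refine ⟨[], by simp, by simp, fun fuel hf k hk tab htab => ?_⟩
          rw [Function.iterate_fixed (by simp [hr])]
          exact .inl rfl
        | @loopStep _ _ _ s₁ _ t₁ t₂ hr h h' =>
          obtain ⟨Q, hQ, hO, H⟩ := ih h
          obtain ⟨Q', hQ', hO', H'⟩ := ihn s₁ t₂ (by omega) h'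
          refine ⟨Q ++ Q', by simp; omega, ?_, fun fuel hf k hk tab htab => ?_⟩
          · simp only [List.mem_append]
            rintro z (hz | hz)
            exacts [hO z hz, hO' z hz]
          · obtain ⟨k, rfl⟩ : ∃ m, k = m + 1 := ⟨k - 1, by omega⟩
            rw [Function.iterate_succ_apply]
            simp only [Option.isSome_none, Bool.false_or, List.isEmpty_eq_false_iff.mpr hr,
              cond_false]
            exact comp (f := (fun t : Option Str × KStore K =>
                bif t.1.isSome || (t.2.stack r).isEmpty then t else p.evalTab fuel tab t)^[k])
              (fun z s => Function.iterate_fixed (by simp) _)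
              (mono (List.subset_append_left _ _) (H fuel (by omega) tab htab))
              (mono (List.subset_append_right _ _) (H' fuel (by omega) k (by omega) tab htab))
    obtain ⟨Q, hQ, hO, H⟩ := key t s t le_rfl h
    exact ⟨Q, hQ, hO, fun fuel hf tab htab => H fuel hf fuel hf tab htab⟩

end Prog

/-! ### Decoding strings -/

/-- One step of reading a self-delimiting code; the components are the remaining string, the
reversal of what has been read, and whether the end has been reached. -/
def undblStep (t : Str × Str × Bool) : Str × Str × Bool :=
  bif t.2.2 then t else bif t.1.headD false && !t.1.tail.isEmpty then
    (t.1.tail.tail, t.1.tail.headD false :: t.2.1, false) else (t.1.tail, t.2.1, true)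

/-- Split a string into a self-delimiting code and the rest. -/
def undbl (u : Str) : Str × Str :=
  ((undblStep^[u.length] (u, [], false)).2.1.reverse, (undblStep^[u.length] (u, [], false)).1)

/-- Decoding is total on strings and inverse to coding on codes. A string is later recognised as a
code by decoding and encoding it again. -/
theorem undbl_dbl_append (a b : Str) : undbl (dbl a ++ b) = (a, b) := by
  have h1 : ∀ k c, undblStep^[k] (b, c, true) = (b, c, true) := fun k c =>
    Function.iterate_fixed rfl k
  have h : ∀ (a : Str) k c, a.length + 1 ≤ k →
      undblStep^[k] (dbl a ++ b, c, false) = (b, a.reverse ++ c, true) := by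
    intro a
    induction a with
    | nil =>
      intro k c hk
      obtain ⟨k, rfl⟩ : ∃ m, k = m + 1 := ⟨k - 1, by omega⟩
      rw [Function.iterate_succ_apply]
      exact h1 k c
    | cons d a ih =>
      intro k c hk
      obtain ⟨k, rfl⟩ : ∃ m, k = m + 1 := ⟨k - 1, by omega⟩
      rw [Function.iterate_succ_apply]
      have : undblStep (dbl (d :: a) ++ b, c, false) = (dbl a ++ b, d :: c, false) := rfl
      rw [this, ih k _ (by simpa using hk)]
      simp
  rw [undbl, h a _ _ (by simp; omega)]
  simp

theorem length_undblStep (t : Str × Str × Bool) :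
    (undblStep t).1.length + 2 * (undblStep t).2.1.length ≤ t.1.length + 2 * t.2.1.length := by
  obtain ⟨r, c, f⟩ := t
  cases f
  · rcases r with _ | ⟨_ | _, _ | ⟨b, r⟩⟩ <;> simp [undblStep]
    omega
  · simp [undblStep]

theorem length_undblStep_iterate (t : Str × Str × Bool) (k : ℕ) :
    (undblStep^[k] t).1.length + 2 * (undblStep^[k] t).2.1.length ≤
      t.1.length + 2 * t.2.1.length := by
  induction k with
  | zero => exact le_rfl
  | succ k ih =>
    rw [Function.iterate_succ_apply']
    exact (length_undblStep _).trans ih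

theorem length_undbl (u : Str) : 2 * (undbl u).1.length + (undbl u).2.length ≤ u.length := by
  have := length_undblStep_iterate (u, [], false) u.length
  simp only [undbl, List.length_reverse, List.length_nil] at this ⊢
  omega

@[fun_prop] theorem FP.undbl {f : α → Str} (hf : FP f) : FP fun a => undbl (f a) := by
  refine (?_ : FP fun u : Str => DSR.undbl u).comp hf
  have hs : FP undblStep := by
    unfold undblStep
    fun_prop
  have h : FP fun u : Str => undblStep^[u.length] (u, [], false) := by
    refine FP.iterate_nat (B := fun u : Str => 4 * size u + 6) (by fun_prop) (by fun_prop) hs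
      (((PB.const 4).mul PB.size).add (PB.const 6)) fun u i hi => ?_
    have := length_undblStep_iterate (u, [], false) i
    have e1 : size (undblStep^[i] (u, [], false)) = _ :=
      size_pair (undblStep^[i] (u, [], false)).1 (undblStep^[i] (u, [], false)).2
    have e2 : size (undblStep^[i] (u, [], false)).2 = _ :=
      size_pair (undblStep^[i] (u, [], false)).2.1 (undblStep^[i] (u, [], false)).2.2
    rw [size_str, size_bool] at e2
    rw [size_str] at e1
    simp only [size_str, List.length_nil] at this ⊢
    omega
  unfold DSR.undbl
  fun_prop

attribute [irreducible] undbl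

@[fun_prop] theorem FP.list_reverse [Elem β] {l : α → List β} (hl : FP l) :
    FP fun a => (l a).reverse := by
  have h := FP.list_foldl_add (g := fun _ (s : List β) b => b :: s)
    (C := fun a => 2 * size (l a) + 1) hl (FP.const []) (by fun_prop)
    (((PB.const 2).mul hl.pb).add (PB.const 1)) fun a s b hb => by
      have := FP.size_mem_list hb
      rw [size_cons]
      omega
  exact h.of_eq fun a => by rw [FP.foldl_cons_eq, List.append_nil]

theorem FP.list_foldr_add [Elem β] {l : α → List β} (hl : FP l) {init : α → σ} (hi : FP init)
    {g : α → σ → β → σ} (hg : FP fun p : α × σ × β => g p.1 p.2.1 p.2.2) {C : α → ℕ}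
    (hC : PB C) (h : ∀ a s, ∀ b ∈ l a, size (g a s b) ≤ size s + C a) :
    FP fun a => (l a).foldr (fun b s => g a s b) (init a) :=
  (FP.list_foldl_add hl.list_reverse hi hg hC fun a s b hb => h a s b (by simpa using hb)).of_eq
    fun a => by rw [List.foldl_reverse]

/-- A query, together with its answer, unless the answer is still to be found. -/
abbrev Event := Str × Option Str

def decodeEvent (u : Str) : Event :=
  ((undbl u).1, bif (undbl u).2.isEmpty then none else some (undbl u).2.tail)

theorem decodeEvent_enc (e : Event) : decodeEvent (enc e) = e := by
  obtain ⟨z, o⟩ := e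
  rw [decodeEvent, enc_pair, enc_str, undbl_dbl_append]
  cases o <;> rfl

theorem size_decodeEvent (u : Str) : size (decodeEvent u) ≤ u.length + 1 := by
  have h := length_undbl u
  rw [decodeEvent, size_pair, size_str]
  generalize (undbl u).2 = w at h ⊢
  rcases w with _ | ⟨b, v⟩
  · simp only [List.isEmpty_nil, cond_true, size_none, List.length_nil] at h ⊢
    omega
  · simp only [List.isEmpty_cons, cond_false, size_some, size_str, List.tail_cons,
      List.length_cons] at h ⊢
    omega

def decodeEventsStep (t : Str × List Event) : Str × List Event :=
  bif t.1.isEmpty then t else ((undbl t.1).2, decodeEvent (undbl t.1).1 :: t.2)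

def decodeEvents (u : Str) : List Event := (decodeEventsStep^[u.length] (u, [])).2.reverse

theorem decodeEvents_enc (l : List Event) : decodeEvents (enc l) = l := by
  have h1 : ∀ k acc, decodeEventsStep^[k] ([], acc) = ([], acc) := fun k acc =>
    Function.iterate_fixed rfl k
  have h : ∀ (l : List Event) k acc, l.length ≤ k →
      decodeEventsStep^[k] (enc l, acc) = ([], l.reverse ++ acc) := by
    intro l
    induction l with
    | nil => exact fun k acc _ => h1 k acc
    | cons e l ih =>
      intro k acc hk
      simp only [List.length_cons] at hk
      obtain ⟨k, rfl⟩ : ∃ m, k = m + 1 := ⟨k - 1, by omega⟩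
      have h2 : (enc (e :: l)).isEmpty = false := by
        rw [enc_cons]
        cases enc e <;> rfl
      rw [Function.iterate_succ_apply, decodeEventsStep, h2, cond_false, enc_cons,
        undbl_dbl_append, decodeEvent_enc, ih k _ (by omega)]
      simp
  rw [decodeEvents, h l _ _ (show l.length ≤ (enc l).length from FP.length_le_size_list l)]
  simp

theorem fp_decodeEvents : FP decodeEvents := by
  have hs : FP decodeEventsStep := by
    unfold decodeEventsStep decodeEvent
    fun_prop
  have h : FP fun u : Str => decodeEventsStep^[u.length] (u, []) := by
    refine FP.iterate_nat (B := fun u : Str => 2 * size u + 1 + size u * 3) (by fun_prop)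
      (by fun_prop) hs ((((PB.const 2).mul PB.size).add (PB.const 1)).add
      (PB.size.mul (PB.const 3))) fun u i hi => ?_
    refine (Prog.size_iterate_le (c := 3) (fun t => ?_) i _).trans ?_
    · obtain ⟨r, l⟩ := t
      rw [decodeEventsStep]
      have h1 := length_undbl r
      have h2 := size_decodeEvent (undbl r).1
      cases r.isEmpty
      · simp only [cond_false, size_pair, size_cons, size_str]
        omega
      · simp
    · simp only [size_pair, size_nil, size_str]
      omega
  unfold decodeEvents
  fun_prop

/-! ### Depth-first search for the answers to the queries of a self-reduction -/

section Search

variable (p : Prog) (T : Polynomial ℕ)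

/-- Run `p` on the input `c.1` with the answers in `c.2`. -/
def tabRun (c : Str × Table) : Option Str × Str :=
  ((p.evalTab (T.eval c.1.length) c.2 (none, (⟨St [c.1]⟩ : KStore (p.regs + 1)))).1,
    (p.evalTab (T.eval c.1.length) c.2 (none, (⟨St [c.1]⟩ : KStore (p.regs + 1)))).2.stack 0)

theorem fp_tabRun : FP (tabRun p T) := by
  have h0 : FP fun c : Str × Table => (⟨St [c.1]⟩ : KStore (p.regs + 1)) := by
    refine FP.kstore_mk fun i _ => ?_
    rcases i with _ | i
    · exact FP.fst
    · exact FP.const []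
  have h := Prog.fp_evalTab (K := p.regs + 1) p (Nat.le_succ _)
    (fuel := fun c : Str × Table => T.eval c.1.length) (by fun_prop) FP.snd
    (t := fun c : Str × Table => (none, (⟨St [c.1]⟩ : KStore (p.regs + 1)))) (by fun_prop)
  exact (FP.comp_fst h).pair (FP.kstore_get (FP.comp_snd h) (by omega))

/-- All answers in the table are correct. -/
def Table.Correct (R : SearchProblem) (tab : Table) : Prop := ∀ e ∈ tab, R e.1 e.2

/-- The table arises from answering one query of `p` on input `x` after the other. -/
def Table.Genuine (R : SearchProblem) (x : Str) : Table → Prop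
  | [] => True
  | e :: tab => (tabRun p T (x, tab)).1 = some e.1 ∧ R e.1 e.2 ∧ Table.Genuine R x tab

theorem lookup_eq_none {z : Str} {tab : Table} (h : lookup z tab = none) :
    z ∉ tab.map Prod.fst := by
  induction tab with
  | nil => simp
  | cons e tab ih =>
    rw [lookup_cons] at h
    split_ifs at h with hz
    simp only [List.map_cons, List.mem_cons, not_or]
    exact ⟨Ne.symm hz, ih h⟩

variable {p T} {R : SearchProblem}

theorem Table.Genuine.correct {x : Str} {tab : Table} (h : Table.Genuine p T R x tab) :
    Table.Correct R tab := by
  induction tab with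
  | nil => simp [Table.Correct]
  | cons e tab ih =>
    intro e' he'
    rcases List.mem_cons.mp he' with rfl | he'
    · exact h.2.1
    · exact ih h.2.2 e' he'

/-- `p` solves `R` with every oracle for `R`, in time `T`, asking for shorter strings only. -/
def Reduces (p : Prog) (T : Polynomial ℕ) (R : SearchProblem) : Prop :=
  ∀ O : Str → Str, (∀ z y, R z y → R z (O z)) → ∀ x, ∃ y, R x y ∧
    p.Outputs (fun z => if z.length < x.length then some (O z) else none) ![x] (T.eval x.length) y

/-- The table is completed to an oracle by arbitrary solutions, and the program is run with that
oracle. Evaluations with `tab` or with a part `tab'` of it follow this one run, so they end with the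
same solution `y` or stop at one of its polynomially many short queries. -/
theorem tabRun_spec (hR : ∀ x, ∃ y, R x y) (hp : Reduces p T R) {tab : Table}
    (htab : Table.Correct R tab) (x : Str) :
    ∃ Q : List Str, Q.length ≤ T.eval x.length ∧ (∀ z ∈ Q, z.length < x.length) ∧
      ∃ y, R x y ∧ ∀ tab', (∀ z a, lookup z tab' = some a → lookup z tab = some a) →
        tabRun p T (x, tab') = (none, y) ∨
          ∃ z ∈ Q, lookup z tab' = none ∧ (tabRun p T (x, tab')).1 = some z := by
  choose sol hsol using hR
  have hO : ∀ z y, R z y → R z ((lookup z tab).getD (sol z)) := by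
    intro z y _
    cases h : lookup z tab with
    | none => exact hsol z
    | some a => exact htab _ (mem_of_lookup h)
  obtain ⟨y, hy, t, s', ht, hr, rfl⟩ := hp _ hO x
  rw [initStore_one] at hr
  obtain ⟨Q, hQ, hQO, H⟩ := Prog.evalTab_of_runs (K := p.regs + 1) hr
  refine ⟨Q, hQ.trans ht, fun z hz => ?_, _, hy, fun tab' h' => ?_⟩
  · have := hQO z hz
    by_contra h
    exact this (if_neg h)
  · rcases H (T.eval x.length) ht tab' (fun z a b hz hb => by
      split_ifs at hb
      simpa [h' z a hz] using hb) with h | ⟨z, hz, hl, h⟩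
    · exact .inl (by rw [tabRun, h])
    · exact .inr ⟨z, hz, hl, h⟩

theorem tabRun_none (hR : ∀ x, ∃ y, R x y) (hp : Reduces p T R) {tab : Table}
    (htab : Table.Correct R tab) {x : Str} (h : (tabRun p T (x, tab)).1 = none) :
    R x (tabRun p T (x, tab)).2 := by
  obtain ⟨Q, -, -, y, hy, H⟩ := tabRun_spec hR hp htab x
  rcases H tab (fun _ _ h => h) with h' | ⟨z, -, -, h'⟩
  · rwa [h']
  · simp [h] at h'

theorem tabRun_some (hR : ∀ x, ∃ y, R x y) (hp : Reduces p T R) {tab : Table}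
    (htab : Table.Correct R tab) {x z : Str} (h : (tabRun p T (x, tab)).1 = some z) :
    z.length < x.length ∧ lookup z tab = none := by
  obtain ⟨Q, -, hQ, y, hy, H⟩ := tabRun_spec hR hp htab x
  rcases H tab (fun _ _ h => h) with h' | ⟨z', hz', hl, h'⟩
  · simp [h'] at h
  · rw [h] at h'
    obtain rfl : z = z' := by simpa using h'
    exact ⟨hQ z hz', hl⟩

/-- All partial tables are compared with the single run for the full table. Each recorded query
stopped the evaluation with the older answers, hence occurs in the list `Q` of that run; no query is
recorded twice, because it was missing when asked. So there are at most `|Q|` entries. -/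
theorem Table.Genuine.length_le (hR : ∀ x, ∃ y, R x y) (hp : Reduces p T R) {x : Str} {tab : Table}
    (h : Table.Genuine p T R x tab) : tab.length ≤ T.eval x.length := by
  obtain ⟨Q, hQ, -, y, -, H⟩ := tabRun_spec hR hp h.correct x
  have key : ∀ tab', Table.Genuine p T R x tab' →
      (∀ z a, lookup z tab' = some a → lookup z tab = some a) →
      (tab'.map Prod.fst).Nodup ∧ tab'.map Prod.fst ⊆ Q := by
    intro tab'
    induction tab' with
    | nil => simp
    | cons e tab' ih =>
      intro hg hl
      have hz := (tabRun_some hR hp hg.2.2.correct hg.1).2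
      -- The newest entry does not shadow an older one, as its query was not yet in the table.
      have hl' : ∀ z a, lookup z tab' = some a → lookup z tab = some a := by
        intro z a hza
        refine hl z a ?_
        rw [lookup_cons, if_neg, hza]
        rintro rfl
        simp [hz] at hza
      obtain ⟨h1, h2⟩ := ih hg.2.2 hl'
      refine ⟨List.nodup_cons.mpr ⟨lookup_eq_none hz, h1⟩, ?_⟩
      rw [List.map_cons, List.cons_subset]
      refine ⟨?_, h2⟩
      rcases H tab' hl' with h' | ⟨z', hz', -, h'⟩
      · have := hg.1
        simp [h'] at this
      · have := hg.1
        rw [h'] at this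
        obtain rfl : z' = e.1 := by simpa using this
        exact hz'
  obtain ⟨h1, h2⟩ := key tab h fun _ _ h => h
  have := (h1.subperm h2).length_le
  rw [List.length_map] at this
  exact this.trans hQ

end Search

attribute [irreducible] tabRun

/-! ### States of the depth-first search and the step function -/

section Search

variable (p : Prog) (T : Polynomial ℕ)

/-- The instance under consideration and its table of answers, after one more event. -/
def nextFrame (c : Str × Table) (e : Event) : Str × Table :=
  bif e.2.isSome then (c.1, (e.1, e.2.getD []) :: c.2) else (e.1, [])

/-- The innermost instance under consideration, with its table of answers; the events are listed
with the latest one first. -/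
def frame (x : Str) (l : List Event) : Str × Table := l.foldr (fun e c => nextFrame c e) (x, [])

/-- The event is about the next query, and the answer, if there is one, is correct. -/
def checkEvent (D : Str × Str → Bool) (c : Str × Table) (e : Event) : Bool :=
  ((tabRun p T c).1.isSome && decide ((tabRun p T c).1.getD [] = e.1)) &&
    (!e.2.isSome || D (e.1, e.2.getD []))

/-- The current frame, and whether all events are as they should be. -/
def scan (D : Str × Str → Bool) (x : Str) (l : List Event) : (Str × Table) × Bool :=
  l.foldr (fun e s => (nextFrame s.1 e, s.2 && checkEvent p T D s.1 e)) ((x, []), true)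

/-- Drop the answered queries of the innermost instance. -/
def dropAnswered (l : List Event) : List Event :=
  (fun l : List Event => bif (l.headD ([], none)).2.isSome then l.tail else l)^[size l] l

/-- Answer the latest pending query. -/
def answer (l : List Event) (y : Str) : List Event :=
  bif (dropAnswered l).isEmpty then l else
    (((dropAnswered l).headD ([], none)).1, some y) :: (dropAnswered l).tail

/-- One step of the depth-first search. -/
def next (D : Str × Str → Bool) (x : Str) (l : List Event) : List Event :=
  bif (scan p T D x l).2 then
    bif (tabRun p T (scan p T D x l).1).1.isSome then
      ((tabRun p T (scan p T D x l).1).1.getD [], none) :: l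
    else answer l (tabRun p T (scan p T D x l).1).2
  else l

/-- The list of events as a number in base 4. -/
def progress (l : List Event) : Str :=
  l.foldr (fun e s => s ++ bif e.2.isSome then [true, false] else [false, true]) []

variable {p T} {D : Str × Str → Bool}

theorem fp_nextFrame : FP fun a : (Str × Table) × Event => nextFrame a.1 a.2 := by
  unfold nextFrame
  fun_prop

theorem fp_checkEvent (hD : FP D) :
    FP fun a : (Str × Table) × Event => checkEvent p T D a.1 a.2 := by
  have h := fp_tabRun p T
  unfold checkEvent
  fun_prop

theorem fp_scan (hD : FP D) : FP fun a : Str × List Event => scan p T D a.1 a.2 := by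
  have h1 := fp_nextFrame
  have h2 := fp_checkEvent (p := p) (T := T) hD
  refine FP.list_foldr_add (l := fun a : Str × List Event => a.2)
    (init := fun a : Str × List Event => ((a.1, ([] : Table)), true))
    (g := fun (_ : Str × List Event) (s : (Str × Table) × Bool) (e : Event) =>
      (nextFrame s.1 e, s.2 && checkEvent p T D s.1 e))
    (C := fun a : Str × List Event => 4 * size a.2 + 2)
    (by fun_prop) (by fun_prop) ?_
    (((PB.const 4).mul (FP.snd (α := Str) (β := List Event)).pb).add (PB.const 2)) ?_
  · have h1' : FP fun a : (Str × List Event) × ((Str × Table) × Bool) × Event =>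
        nextFrame a.2.1.1 a.2.2 :=
      h1.comp (f := fun a : (Str × List Event) × ((Str × Table) × Bool) × Event =>
        (a.2.1.1, a.2.2)) (by fun_prop)
    have h2' : FP fun a : (Str × List Event) × ((Str × Table) × Bool) × Event =>
        checkEvent p T D a.2.1.1 a.2.2 :=
      h2.comp (f := fun a : (Str × List Event) × ((Str × Table) × Bool) × Event =>
        (a.2.1.1, a.2.2)) (by fun_prop)
    fun_prop
  · rintro ⟨x, l⟩ ⟨⟨i, tab⟩, ok⟩ ⟨z, o⟩ he
    have h := FP.size_mem_list he
    simp only at h ⊢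
    cases o with
    | none =>
      simp only [nextFrame, Option.isSome_none, cond_false, size_pair, size_none, size_nil,
        size_bool] at h ⊢
      omega
    | some y =>
      simp only [nextFrame, Option.isSome_some, cond_true, size_pair, size_some, size_cons,
        size_bool, Option.getD_some] at h ⊢
      omega

theorem size_tail_le (l : List Event) : size l.tail ≤ size l := by
  cases l
  · exact le_rfl
  · simp only [List.tail_cons, size_cons]
    omega

theorem fp_dropAnswered : FP dropAnswered := by
  refine FP.iterate_nat (n := fun l : List Event => size l) (B := fun l : List Event => size l)
    (by fun_prop) FP.id (by fun_prop) PB.size fun l i _ => ?_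
  refine (Prog.size_iterate_le (c := 0) (fun l => ?_) i l).trans (by simp)
  cases (l.headD ([], none)).2.isSome
  · simp
  · simpa using size_tail_le l

theorem fp_next (hD : FP D) : FP fun a : Str × List Event => next p T D a.1 a.2 := by
  have h1 := fp_scan (p := p) (T := T) hD
  have h2 := fp_tabRun p T
  have h3 := fp_dropAnswered
  unfold next answer
  fun_prop

theorem fp_progress : FP progress := by
  refine FP.list_foldr_add (l := fun l : List Event => l) (init := fun _ => ([] : Str))
    (g := fun _ (s : Str) (e : Event) =>
      s ++ bif e.2.isSome then [true, false] else [false, true]) (C := fun _ => 2) FP.id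
    (by fun_prop) (by fun_prop) (PB.const 2) fun _ s e _ => ?_
  cases e.2.isSome <;> simp [size_str]

theorem scan_fst (x : Str) (l : List Event) : (scan p T D x l).1 = frame x l := by
  induction l with
  | nil => rfl
  | cons e l ih =>
    change nextFrame (scan p T D x l).1 e = nextFrame (frame x l) e
    rw [ih]

theorem scan_cons (x : Str) (e : Event) (l : List Event) :
    (scan p T D x (e :: l)).2 = ((scan p T D x l).2 && checkEvent p T D (frame x l) e) := by
  rw [← scan_fst]
  rfl

theorem frame_pending (x z : Str) (l : List Event) : frame x ((z, none) :: l) = (z, []) := rfl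

theorem frame_answered (x z y : Str) (l : List Event) :
    frame x ((z, some y) :: l) = ((frame x l).1, (z, y) :: (frame x l).2) := rfl

theorem frame_nil (x : Str) : frame x [] = (x, []) := rfl

attribute [irreducible] frame

variable {R : SearchProblem}

theorem checkEvent_pending {c : Str × Table} {z : Str} :
    checkEvent p T D c (z, none) = true ↔ (tabRun p T c).1 = some z := by
  simp only [checkEvent, Option.isSome_none, Bool.not_false, Bool.true_or, Bool.and_true,
    Bool.and_eq_true, decide_eq_true_eq]
  cases (tabRun p T c).1 <;> simp

theorem checkEvent_answered (hDR : ∀ z y, D (z, y) = true ↔ R z y) {c : Str × Table} {z y : Str} :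
    checkEvent p T D c (z, some y) = true ↔ (tabRun p T c).1 = some z ∧ R z y := by
  simp only [checkEvent, Option.isSome_some, Bool.not_true, Bool.false_or, Option.getD_some,
    Bool.and_eq_true, decide_eq_true_eq, hDR]
  cases (tabRun p T c).1 <;> simp

/-- Either no query is pending, or the latest pending query is followed by answered ones. -/
theorem events_cases (x : Str) (l : List Event) :
    (dropAnswered l = [] ∧ (frame x l).1 = x) ∨
    ∃ (A : List Event) (z : Str) (l' : List Event), l = A ++ (z, none) :: l' ∧
      dropAnswered l = (z, none) :: l' ∧ (frame x l).1 = z := by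
  have key : ∀ l : List Event, ∀ k, l.length ≤ k →
      ((fun l : List Event => bif (l.headD ([], none)).2.isSome then l.tail else l)^[k] l = [] ∧
        (frame x l).1 = x) ∨
      ∃ (A : List Event) (z : Str) (l' : List Event), l = A ++ (z, none) :: l' ∧
        (fun l : List Event => bif (l.headD ([], none)).2.isSome then l.tail else l)^[k] l =
          (z, none) :: l' ∧ (frame x l).1 = z := by
    intro l
    induction l with
    | nil => exact fun k _ => .inl ⟨Function.iterate_fixed rfl k, by rw [frame_nil]⟩
    | cons e l ih =>
      intro k hk
      obtain ⟨z, _ | y⟩ := e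
      · exact .inr ⟨[], z, l, rfl, Function.iterate_fixed rfl k, by rw [frame_pending]⟩
      · simp only [List.length_cons] at hk
        obtain ⟨k, rfl⟩ : ∃ m, k = m + 1 := ⟨k - 1, by omega⟩
        rw [frame_answered, Function.iterate_succ_apply]
        rcases ih k (by omega) with h | ⟨A, z', l', rfl, h, h'⟩
        · exact .inl h
        · exact .inr ⟨(z, some y) :: A, z', l', rfl, h, h'⟩
  exact key l _ (FP.length_le_size_list l)

/-- All events are as they should be. -/
def Valid (p : Prog) (T : Polynomial ℕ) (D : Str × Str → Bool) (x : Str) (l : List Event) : Prop :=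
  (scan p T D x l).2 = true

theorem valid_cons {x : Str} {e : Event} {l : List Event} :
    Valid p T D x (e :: l) ↔ Valid p T D x l ∧ checkEvent p T D (frame x l) e = true := by
  rw [Valid, scan_cons, Bool.and_eq_true, Valid]

theorem Valid.of_append {x : Str} {A l : List Event} (h : Valid p T D x (A ++ l)) :
    Valid p T D x l := by
  induction A with
  | nil => exact h
  | cons e A ih => exact ih (valid_cons.mp h).1

/-! ### Correctness and size of valid states -/

variable (hDR : ∀ z y, D (z, y) = true ↔ R z y) (hR : ∀ x, ∃ y, R x y) (hp : Reduces p T R)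

include hDR in
-- A pending query restarts with an empty table, and an answered one is recorded only after both its
-- order and its answer have been checked.
theorem Valid.genuine {x : Str} {l : List Event} (h : Valid p T D x l) :
    Table.Genuine p T R (frame x l).1 (frame x l).2 := by
  induction l with
  | nil => rw [frame_nil]; trivial
  | cons e l ih =>
    rw [valid_cons] at h
    obtain ⟨z, _ | y⟩ := e
    · rw [frame_pending]; trivial
    · rw [frame_answered]
      have := (checkEvent_answered hDR).mp h.2
      exact ⟨this.1, this.2, ih h.1⟩

include hDR hR hp in
-- Opening a pending query makes the current instance shorter by at least one, and leaves behind at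
-- most `T.eval x.length` answers and the new event itself. This gives one factor `T.eval x.length +
-- 1` per unit of lost length.
theorem Valid.length_le {x : Str} {l : List Event} (h : Valid p T D x l) :
    (frame x l).1.length ≤ x.length ∧ l.length ≤
      (x.length - (frame x l).1.length) * (T.eval x.length + 1) + (frame x l).2.length := by
  induction l with
  | nil => simp [frame_nil]
  | cons e l ih =>
    have hv := h
    rw [valid_cons] at h
    obtain ⟨h1, h2⟩ := ih h.1
    obtain ⟨z, _ | y⟩ := e
    · have hz := (tabRun_some hR hp (h.1.genuine hDR).correct (checkEvent_pending.mp h.2)).1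
      have hl := (h.1.genuine hDR).length_le hR hp
      have hm := eval_poly_mono T h1
      rw [frame_pending]
      refine ⟨by simp only; omega, ?_⟩
      have e1 : x.length - (frame x l).1.length + 1 ≤ x.length - z.length := by omega
      have e2 := Nat.mul_le_mul_right (T.eval x.length + 1) e1
      rw [Nat.add_mul, one_mul] at e2
      simp only [List.length_cons, List.length_nil]
      omega
    · rw [frame_answered]
      simp only [List.length_cons]
      omega

/-- A bound for the number of events. -/
def maxEvents (T : Polynomial ℕ) (x : Str) : ℕ :=
  x.length * (T.eval x.length + 1) + T.eval x.length

include hDR hR hp in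
theorem Valid.length_le_maxEvents {x : Str} {l : List Event} (h : Valid p T D x l) :
    l.length ≤ maxEvents T x := by
  obtain ⟨h1, h2⟩ := h.length_le hDR hR hp
  have h3 := (h.genuine hDR).length_le hR hp
  have h4 := eval_poly_mono T h1
  have h5 := Nat.mul_le_mul_right (T.eval x.length + 1)
    (Nat.sub_le x.length (frame x l).1.length)
  rw [maxEvents]
  omega

include hDR hR hp in
-- An event with query `z` and answer `y` adds `4 * |z| + 2 * |y| + 5` bits, and the query is no
-- longer than `x`. Thus `Valid.length_le_maxEvents` finishes the bound.
theorem Valid.size_le {q : Polynomial ℕ} (hq : ∀ x y, R x y → y.length ≤ q.eval x.length)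
    {x : Str} {l : List Event} (h : Valid p T D x l) :
    size l ≤ maxEvents T x * (4 * x.length + 2 * q.eval x.length + 5) := by
  refine le_trans ?_ (Nat.mul_le_mul_right _ (h.length_le_maxEvents hDR hR hp))
  induction l with
  | nil => simp [size_nil]
  | cons e l ih =>
    have hv := h
    rw [valid_cons] at h
    have hl := ih h.1
    have h1 := (h.1.length_le hDR hR hp).1
    rw [size_cons, List.length_cons, Nat.add_mul l.length 1, one_mul]
    obtain ⟨z, _ | y⟩ := e
    · have hz := (tabRun_some hR hp (h.1.genuine hDR).correct (checkEvent_pending.mp h.2)).1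
      rw [size_pair, size_none, size_str]
      omega
    · have hc := (checkEvent_answered hDR).mp h.2
      have hz := (tabRun_some hR hp (h.1.genuine hDR).correct hc.1).1
      have hy := (hq _ _ hc.2).trans (eval_poly_mono q (show z.length ≤ x.length by omega))
      rw [size_pair, size_some, size_str, size_str]
      omega

include hDR hR hp in
/-- What a step does to a valid list of events. -/
theorem next_cases {x : Str} {l : List Event} (h : Valid p T D x l) :
    (∃ z, next p T D x l = (z, none) :: l ∧ Valid p T D x ((z, none) :: l)) ∨
    (∃ A z y l', l = A ++ (z, none) :: l' ∧ next p T D x l = (z, some y) :: l' ∧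
      Valid p T D x ((z, some y) :: l')) ∨
    (next p T D x l = l ∧ R x (tabRun p T (frame x l)).2) := by
  have hv : (scan p T D x l).2 = true := h
  have hg := (h.genuine hDR).correct
  simp only [next, hv, cond_true, scan_fst]
  cases hr : (tabRun p T (frame x l)).1 with
  | some z => exact .inl ⟨z, rfl, valid_cons.mpr ⟨h, checkEvent_pending.mpr hr⟩⟩
  | none =>
    have hy : ∀ z, (frame x l).1 = z → R z (tabRun p T (frame x l)).2 := by
      rintro _ rfl
      exact tabRun_none hR hp hg hr
    refine .inr ?_
    rcases events_cases x l with ⟨h1, h2⟩ | ⟨A, z, l', h1, h2, h3⟩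
    · refine .inr ⟨by simp [answer, h1], ?_⟩
      exact hy _ h2
    · refine .inl ⟨A, z, (tabRun p T (frame x l)).2, l', h1, by simp [answer, h2], ?_⟩
      rw [h1] at h
      have hl := valid_cons.mp h.of_append
      refine valid_cons.mpr ⟨hl.1, (checkEvent_answered hDR).mpr ⟨checkEvent_pending.mp hl.2, ?_⟩⟩
      exact hy _ h3

include hDR hR hp in
theorem Valid.next {x : Str} {l : List Event} (h : Valid p T D x l) :
    Valid p T D x (next p T D x l) := by
  rcases next_cases hDR hR hp h with ⟨z, h1, h2⟩ | ⟨A, z, y, l', -, h1, h2⟩ | ⟨h1, -⟩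
  · rwa [h1]
  · rwa [h1]
  · rwa [h1]

theorem next_of_not_valid {x : Str} {l : List Event} (h : ¬ Valid p T D x l) :
    next p T D x l = l := by
  rw [Valid, Bool.not_eq_true] at h
  simp [DSR.next, h]

include hDR hR hp in
-- Opening a query lengthens the list and answering one changes it, so a valid state is fixed only
-- when no query is pending and the program has finished on `x` itself.
theorem solution_of_next_eq {x : Str} {l : List Event} (h : Valid p T D x l)
    (hn : next p T D x l = l) : R x (tabRun p T (frame x l)).2 := by
  rcases next_cases hDR hR hp h with ⟨z, h1, -⟩ | ⟨A, z, y, l', h1, h2, -⟩ | ⟨-, h1⟩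
  · rw [hn] at h1
    simpa using congrArg List.length h1
  · rw [hn] at h2
    rw [h2] at h1
    rcases A with _ | ⟨a, A⟩
    · simp at h1
    · have := congrArg List.length h1
      simp at this
      omega
  · exact h1

/-! ### Strict growth of the progress measure -/

theorem progress_cons (e : Event) (l : List Event) :
    progress (e :: l) = progress l ++ bif e.2.isSome then [true, false] else [false, true] := rfl

theorem length_progress (l : List Event) : (progress l).length = 2 * l.length := by
  induction l with
  | nil => rfl
  | cons e l ih =>
    rw [progress_cons, List.length_append, ih, List.length_cons]
    cases e.2.isSome <;> simp <;> omega

theorem progress_append (A l : List Event) : ∃ u, progress (A ++ l) = progress l ++ u := by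
  induction A with
  | nil => exact ⟨[], by simp⟩
  | cons e A ih =>
    obtain ⟨u, hu⟩ := ih
    exact ⟨_, by rw [List.cons_append, progress_cons, hu, List.append_assoc]⟩

theorem binVal_lt_of_prefix (c w w' : Str) (h : w.length = w'.length) :
    binVal (c ++ false :: w) < binVal (c ++ true :: w') := by
  rw [binVal_append, binVal_append, binVal_cons, binVal_cons]
  have := binVal_lt w
  simp only [List.length_cons, h, Bool.toNat_false, Bool.toNat_true] at this ⊢
  omega

/-- Progress padded to a fixed length. -/
def paddedProgress (n : ℕ) (l : List Event) : Str :=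
  (progress l ++ List.replicate (2 * n) false).take (2 * n)

theorem length_paddedProgress (n : ℕ) (l : List Event) : (paddedProgress n l).length = 2 * n := by
  simp [paddedProgress]

theorem paddedProgress_eq {n : ℕ} {l : List Event} (h : l.length ≤ n) :
    paddedProgress n l = progress l ++ List.replicate (2 * n - 2 * l.length) false := by
  have := length_progress l
  rw [paddedProgress, List.take_append, List.take_of_length_le (by omega), this,
    List.take_replicate]
  congr 2
  omega

include hDR hR hp in
-- Opening a query turns the first padding digit 00 into 01. Answering one turns its digit 01 into
-- 10 and may erase all later digits, which are less significant. Padding to a common length makes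
-- the two numbers comparable.
theorem progress_lt {x : Str} {l : List Event} (h : Valid p T D x l) (hn : next p T D x l ≠ l) :
    binVal (paddedProgress (maxEvents T x) l) <
      binVal (paddedProgress (maxEvents T x) (next p T D x l)) := by
  have hl := h.length_le_maxEvents hDR hR hp
  have hl' := (h.next hDR hR hp).length_le_maxEvents hDR hR hp
  rw [paddedProgress_eq hl, paddedProgress_eq hl']
  rcases next_cases hDR hR hp h with ⟨z, h1, -⟩ | ⟨A, z, y, l', h1, h2, -⟩ | ⟨h1, -⟩
  · rw [h1] at hl' ⊢
    simp only [List.length_cons] at hl'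
    have e : 2 * maxEvents T x - 2 * l.length =
        2 * maxEvents T x - 2 * (l.length + 1) + 1 + 1 := by omega
    rw [progress_cons, e, List.replicate_succ, List.replicate_succ, List.length_cons]
    have := binVal_lt_of_prefix (progress l ++ [false])
      (List.replicate (2 * maxEvents T x - 2 * (l.length + 1)) false)
      (List.replicate (2 * maxEvents T x - 2 * (l.length + 1)) false) rfl
    simpa using this
  · obtain ⟨u, hu⟩ := progress_append A ((z, none) :: l')
    have hlen := length_progress l
    rw [h2] at hl' ⊢
    rw [h1] at hl hlen ⊢
    rw [hu, progress_cons] at hlen ⊢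
    rw [progress_cons]
    simp only [List.length_append, List.length_cons, Option.isSome_none, cond_false,
      Option.isSome_some, cond_true, length_progress, List.length_nil] at hl hl' hlen ⊢
    have := binVal_lt_of_prefix (progress l')
      (true :: (u ++ List.replicate (2 * maxEvents T x - 2 * (A.length + (l'.length + 1))) false))
      (false :: List.replicate (2 * maxEvents T x - 2 * (l'.length + 1)) false)
      (by simp; omega)
    simpa using this
  · exact absurd h1 hn

end Search

/-! ### From downward self-reducibility to PLS -/

/-- A downward self-reducible problem is a local search problem. -/
theorem pls_of_downwardSelfReducible {R : SearchProblem} (hR : TFNP R)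
    (hd : DownwardSelfReducible R) : PLS R := by
  refine ⟨hR, ?_⟩
  obtain ⟨⟨⟨q, hq⟩, F, hF, hFR⟩, htot⟩ := hR
  obtain ⟨p, T, hp⟩ := hd
  have hp : Reduces p T R := hp
  let D : Str × Str → Bool := fun a => decide (F ![a.1, a.2] = [true])
  have hD : FP D := (FP.of_polyTime_two hF).str_beq (FP.const [true])
  have hDR : ∀ z y, D (z, y) = true ↔ R z y := fun z y => by simp [D, hFR]
  -- Strings that are not codes of lists, and codes of invalid lists, are fixed points. They have no
  -- proper successor, so they are never solutions.
  let succ : Str × Str → Str := fun a => bif decide (enc (decodeEvents a.2) = a.2) then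
    enc (next p T D a.1 (decodeEvents a.2)) else a.2
  let val : Str × Str → Str := fun a => paddedProgress (maxEvents T a.1) (decodeEvents a.2)
  -- A solution of Sink-of-DAG is the vertex before the sink, so one more step is made before the
  -- output is read.
  let out : Str × Str → Str := fun a =>
    (tabRun p T (scan p T D a.1 (next p T D a.1 (decodeEvents a.2))).1).2
  have h1 := fp_decodeEvents
  have h2 := fp_next (p := p) (T := T) hD
  have h3 := fp_tabRun p T
  have h4 := fp_scan (p := p) (T := T) hD
  have h5 := fp_progress
  have hmax : FP fun x : Str => maxEvents T x := by
    unfold maxEvents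
    fun_prop
  have hsucc : FP succ := by fun_prop
  have hval : FP val := by
    simp only [val, paddedProgress]
    fun_prop
  have hout : FP out := by fun_prop
  have succ_enc : ∀ x l, succ (x, enc l) = enc (next p T D x l) := fun x l => by
    simp [succ, decodeEvents_enc]
  have val_enc : ∀ x l, val (x, enc l) = paddedProgress (maxEvents T x) l := fun x l => by
    simp [val, decodeEvents_enc]
  have out_enc : ∀ x l, out (x, enc l) = (tabRun p T (frame x (next p T D x l))).2 := fun x l => by
    simp [out, decodeEvents_enc, scan_fst]
  have enc_inj : ∀ l l' : List Event, enc l = enc l' → l = l' := fun l l' h => by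
    rw [← decodeEvents_enc l, h, decodeEvents_enc]
  have proper : ∀ x u, succ (x, u) ≠ u → ∃ l, u = enc l ∧ Valid p T D x l := by
    intro x u h
    by_cases hu : enc (decodeEvents u) = u
    · refine ⟨decodeEvents u, hu.symm, ?_⟩
      by_contra hv
      refine h ?_
      rw [← hu, succ_enc, next_of_not_valid hv]
    · exact absurd (by simp [succ, hu]) h
  have hnil : ∀ x, Valid p T D x [] := fun x => rfl
  refine polyReducible_sinkOfDAG (R := R)
    (n := fun x => maxEvents T x * (4 * x.length + 2 * q.eval x.length + 5))
    (m := fun x => 2 * maxEvents T x) (init := fun _ => enc ([] : List Event)) (succ := succ)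
    (val := val) (out := out) (by fun_prop) (by fun_prop) (by fun_prop) hsucc hval hout ?_ ?_ ?_
    ?_ ?_
  · intro x
    simp [enc_nil]
  · intro x u hu
    by_cases h : succ (x, u) = u
    · rwa [h]
    · obtain ⟨l, rfl, hl⟩ := proper x u h
      rw [succ_enc]
      exact (hl.next hDR htot hp).size_le hDR htot hp hq
  · intro x u _
    exact length_paddedProgress _ _
  · intro x h
    rw [succ_enc] at h
    rw [out_enc, enc_inj _ _ h]
    exact solution_of_next_eq hDR htot hp (hnil x) (enc_inj _ _ h)
  · intro x u _ hne h
    obtain ⟨l, rfl, hl⟩ := proper x u hne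
    rw [succ_enc, succ_enc, val_enc, val_enc] at h
    rw [succ_enc] at hne
    rw [out_enc]
    refine solution_of_next_eq hDR htot hp (hl.next hDR htot hp) (enc_inj _ _ (h.resolve_right ?_))
    -- The value grows along every proper edge, so the second kind of solution of Sink-of-DAG does
    -- not occur among the states.
    exact not_le.mpr (progress_lt hDR htot hp hl fun h => hne (by rw [h]))

/-! ### Self-reductions with two queries -/

namespace Prog

/-- Replace the second component of a pair by the answer to it. -/
def ask : Prog := .seq unpair (.seq (.query 0) pairUp)

theorem exec_ask {O : Str → Option Str} (a : α) {q b : Str} (h : O q = some b) :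
    ask.Exec O (St [enc (a, q)]) (11 * size a + 9) (St [enc (a, b)]) := by
  have h2 : (Prog.query 0).Exec O (St [q, (enc a).reverse]) 1 (St [b, (enc a).reverse]) :=
    exec_query h (by rw [update_St _ _ _ (by simp)]; rfl)
  refine ((exec_unpair (enc a) q).seq (h2.seq (exec_pairUp (enc a) b))).mono ?_
  simp only [size]
  omega

end Prog

/-- A problem is downward self-reducible if it is solved with at most two queries to shorter
instances. -/
theorem downwardSelfReducible_of_two_queries {R : SearchProblem} (hR : ∀ x, ∃ y, R x y)
    {q : Polynomial ℕ} (hq : ∀ x y, R x y → y.length ≤ q.eval x.length)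
    {recurse : Str → Bool} (hrec : FP recurse) {direct : Str → Str} (hdir : FP direct)
    {q₁ : Str → Str} (hq₁ : FP q₁) {q₂ : Str × Str → Str} (hq₂ : FP q₂)
    {out : (Str × Str) × Str → Str} (hout : FP out)
    (h0 : ∀ x, recurse x = false → R x (direct x))
    (h1 : ∀ x, recurse x = true → (q₁ x).length < x.length)
    (h2 : ∀ x a, recurse x = true → R (q₁ x) a → (q₂ (x, a)).length < x.length)
    (h3 : ∀ x a b, recurse x = true → R (q₁ x) a → R (q₂ (x, a)) b → R x (out ((x, a), b))) :
    DownwardSelfReducible R := by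
  -- The first bit tells the oracle program whether a query follows or the answer is already there.
  have f0 : FP fun x => bif recurse x then true :: enc (x, q₁ x) else false :: direct x := by
    fun_prop
  have f1 : FP fun c : Str × Str => (c, q₂ c) := by fun_prop
  obtain ⟨p0, m0, ⟨M0, hM0⟩, h0'⟩ := f0
  obtain ⟨p1, m1, ⟨M1, hM1⟩, h1'⟩ := f1
  obtain ⟨p2, m2, ⟨M2, hM2⟩, h2'⟩ := hout
  -- `L1` and `L2` bound the code lengths of `(x, a)` and `((x, a), b)`. The answers have length at
  -- most `q.eval x.length` because the queries are shorter than `x`.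
  let L1 : Polynomial ℕ := 2 * .X + 1 + q
  let L2 : Polynomial ℕ := 2 * L1 + 1 + q
  refine ⟨.seq p0 (.branch 0 .skip (.pop 0) (.seq (.pop 0) (.seq .ask (.seq p1 (.seq .ask p2))))),
    M0 + 22 + 11 * .X + M1.comp L1 + 11 * L1 + M2.comp L2, fun O hO x => ?_⟩
  have hO : ∀ z, R z (O z) := fun z => (hR z).elim fun y hy => hO z y hy
  set O' : Str → Option Str := fun z => if z.length < x.length then some (O z) else none
  have hO' : ∀ z, z.length < x.length → O' z = some (O z) := fun z hz => if_pos hz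
  have e0 := (h0' x).of_none (O := O')
  have hm0 : m0 x ≤ M0.eval x.length := hM0 x
  simp only [Prog.Outputs, initStore_one]
  cases hx : recurse x with
  | false =>
    refine ⟨direct x, h0 x hx, ?_⟩
    simp only [hx, cond_false] at e0
    have e1 : (Prog.pop 0).Exec O' (St [false :: direct x]) 1 (St [direct x]) :=
      Prog.exec_pop (by rw [update_St _ _ _ (by simp)]; rfl)
    obtain ⟨t, ht, hr⟩ := e0.seq (e1.branchCons (r := 0) (c := false) (u := direct x) rfl)
    refine ⟨t, _, ht.trans ?_, hr, rfl⟩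
    simp
    omega
  | true =>
    have ha := hO (q₁ x)
    have hb := hO (q₂ (x, O (q₁ x)))
    have l1 := h1 x hx
    have l2 := h2 x _ hx ha
    refine ⟨_, h3 x _ _ hx ha hb, ?_⟩
    generalize hA : O (q₁ x) = a at *
    generalize hB : O (q₂ (x, a)) = b at *
    simp only [hx, cond_true] at e0
    have e1 : (Prog.pop 0).Exec O' (St [true :: enc (x, q₁ x)]) 1 (St [enc (x, q₁ x)]) :=
      Prog.exec_pop (by rw [update_St _ _ _ (by simp)]; rfl)
    have e2 := Prog.exec_ask x ((hO' _ l1).trans (congrArg some hA))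
    have e3 := (h1' (x, a)).of_none (O := O')
    have e4 := Prog.exec_ask (x, a) ((hO' _ l2).trans (congrArg some hB))
    have e5 := (h2' ((x, a), b)).of_none (O := O')
    obtain ⟨t, ht, hr⟩ := e0.seq ((e1.seq (e2.seq (e3.seq (e4.seq e5)))).branchCons
      (pNil := .skip) (p0 := .pop 0) (r := 0) (c := true) (u := enc (x, q₁ x)) rfl)
    refine ⟨t, _, ht.trans ?_, hr, rfl⟩
    have la := (hq _ _ ha).trans (eval_poly_mono q l1.le)
    have lb := (hq _ _ hb).trans (eval_poly_mono q l2.le)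
    have s1 : size (x, a) ≤ L1.eval x.length := by
      simp only [size_pair, size_str, L1]
      simp
      omega
    have s2 : size ((x, a), b) ≤ L2.eval x.length := by
      rw [size_pair, size_str]
      simp only [L2]
      simp
      omega
    have k1 := (hM1 (x, a)).trans (eval_poly_mono M1 s1)
    have k2 := (hM2 ((x, a), b)).trans (eval_poly_mono M2 s2)
    have k3 : size x = x.length := rfl
    simp
    omega

/-! ### Evaluating encoded instances of Sink-of-DAG -/

/-- The number of leading ones. -/
def lead (u : Str) : ℕ :=
  (u.foldl (fun c b => bif c.2 && b then (c.1 + 1, true) else (c.1, false)) (0, true)).1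

theorem lead_encodeNat_append (n : ℕ) (u : Str) : lead (encodeNat n ++ u) = n := by
  have h1 : ∀ (u : Str) k, u.foldl (fun (c : ℕ × Bool) b =>
      bif c.2 && b then (c.1 + 1, true) else (c.1, false)) (k, false) = (k, false) := by
    intro u k
    induction u with
    | nil => rfl
    | cons b u ih => exact ih
  have h2 : ∀ n k, (encodeNat n ++ u).foldl (fun (c : ℕ × Bool) b =>
      bif c.2 && b then (c.1 + 1, true) else (c.1, false)) (k, true) = (n + k, false) := by
    intro n
    induction n with
    | zero => exact fun k => (h1 u k).trans (by rw [zero_add])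
    | succ n ih => exact fun k => (ih (k + 1)).trans (by rw [Nat.add_right_comm, Nat.add_assoc])
  exact congrArg Prod.fst (h2 n 0)

@[fun_prop] theorem FP.lead {f : α → Str} (hf : FP f) : FP fun a => lead (f a) := by
  refine FP.comp_fst (FP.str_foldl_add (init := fun _ => ((0 : ℕ), true))
    (g := fun _ (c : ℕ × Bool) b => bif c.2 && b then (c.1 + 1, true) else (c.1, false))
    (C := fun _ => 2) hf (by fun_prop) (by fun_prop) (PB.const 2) fun a c b => ?_)
  obtain ⟨k, _ | _⟩ := c <;> cases b <;> simp [size_pair, size_nat, size_bool]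
  omega

attribute [irreducible] lead

theorem drop_encodeNat_append (n : ℕ) (u : Str) : (encodeNat n ++ u).drop (n + 1) = u := by
  rw [List.drop_append_of_le_length (by simp [encodeNat, unary]), List.drop_of_length_le
    (by simp [encodeNat, unary]), List.nil_append]

/-- Read a gate; the result is its value and the rest of the string. -/
def parseGate (u w : Str) : Bool × Str :=
  bif u.headD false then
    (bif u.tail.headD false then
        w.getD (lead u.tail.tail) false ||
          w.getD (lead (u.tail.tail.drop (lead u.tail.tail + 1))) false
      else w.getD (lead u.tail.tail) false &&
          w.getD (lead (u.tail.tail.drop (lead u.tail.tail + 1))) false,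
      (u.tail.tail.drop (lead u.tail.tail + 1)).drop
        (lead (u.tail.tail.drop (lead u.tail.tail + 1)) + 1))
  else bif u.tail.headD false then
    (!w.getD (lead u.tail.tail) false, u.tail.tail.drop (lead u.tail.tail + 1))
  else (u.tail.tail.headD false, u.tail.tail.tail)

theorem parseGate_encode (g : Gate) (u w : Str) : parseGate (g.encode ++ u) w = (g.eval w, u) := by
  cases g <;> simp [parseGate, Gate.encode, Gate.eval, lead_encodeNat_append,
    drop_encodeNat_append]

theorem length_parseGate (u w : Str) : (parseGate u w).2.length ≤ u.length := by
  rw [parseGate]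
  cases u.headD false <;> cases u.tail.headD false <;>
    simp only [cond_true, cond_false, List.length_drop, List.length_tail] <;> omega

/-- Read and evaluate one gate; the components are the remaining string, the values of the wires,
and whether the end of the circuit has been reached. -/
def circuitStep (t : Str × Str × Bool) : Str × Str × Bool :=
  bif t.2.2 then t else bif t.1.headD false then
    ((parseGate t.1.tail t.2.1).2, (parseGate t.1.tail t.2.1).1 :: t.2.1, false)
  else (t.1.tail, t.2.1, true)

/-- Evaluate an encoded circuit; the components are the remaining string and the values of the
wires. -/
def parseCircuit (u x : Str) : Str × Str :=
  ((circuitStep^[u.length] (u, x, false)).1, (circuitStep^[u.length] (u, x, false)).2.1)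

/-- Reading and evaluating are interleaved, so a gate is used as soon as its code is met and no
decoded circuit is stored. Each gate and the end marker consume at least one bit, so the length of
the string is enough fuel. -/
theorem parseCircuit_encode (C : Circuit) (u x : Str) :
    parseCircuit (C.encode ++ u) x = (u, Circuit.wires C x) := by
  have h : ∀ (C : Circuit) x k, (C.encode ++ u).length ≤ k →
      circuitStep^[k] (C.encode ++ u, x, false) = (u, Circuit.wires C x, true) := by
    intro C
    induction C with
    | nil =>
      intro x k hk
      obtain ⟨k, rfl⟩ : ∃ m, k = m + 1 := by
        simp [Circuit.encode] at hk
        exact ⟨k - 1, by omega⟩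
      rw [Function.iterate_succ_apply]
      exact Function.iterate_fixed rfl k
    | cons g C ih =>
      intro x k hk
      simp only [Circuit.encode, List.cons_append, List.append_assoc, List.length_cons,
        List.length_append] at hk ih ⊢
      obtain ⟨k, rfl⟩ : ∃ m, k = m + 1 := ⟨k - 1, by omega⟩
      have h1 : circuitStep (true :: (g.encode ++ (Circuit.encode C ++ u)), x, false) =
          (Circuit.encode C ++ u, g.eval x :: x, false) := by
        simp [circuitStep, parseGate_encode]
      rw [Function.iterate_succ_apply, h1, ih _ _ (by omega)]
      rfl
  rw [parseCircuit, h C x _ le_rfl]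

@[fun_prop] theorem FP.parseCircuit {f g : α → Str} (hf : FP f) (hg : FP g) :
    FP fun a => parseCircuit (f a) (g a) := by
  have hs : FP circuitStep := by
    unfold circuitStep parseGate
    fun_prop
  have h : FP fun a => circuitStep^[(f a).length] (f a, g a, false) := by
    refine FP.iterate_nat (B := fun a => size (f a, g a, false) + size (f a) * 2) (by fun_prop)
      (by fun_prop) hs (FP.pb (by fun_prop : FP fun a => (f a, g a, false)) |>.add
        (hf.pb.mul (PB.const 2))) fun a i hi => ?_
    refine (Prog.size_iterate_le (c := 2) (fun t => ?_) i _).trans ?_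
    · obtain ⟨r, w, f⟩ := t
      have h1 := length_parseGate r.tail w
      rw [circuitStep]
      rw [List.length_tail] at h1
      cases f
      · cases r.headD false
        · simp only [cond_false, size_pair, size_str, size_bool, List.length_tail]
          omega
        · simp only [cond_false, cond_true, size_pair, size_str, size_bool, List.length_cons]
          omega
      · simp
    · have := Nat.mul_le_mul_right 2 hi
      rw [size_str]
      omega
  unfold DSR.parseCircuit
  fun_prop

attribute [irreducible] parseCircuit

/-- The first `n` bits of `w`, padded with zeros if there are fewer. -/
def firstBits (n : ℕ) (w : Str) : Str := (w ++ List.replicate n false).take n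

theorem length_firstBits (n : ℕ) (w : Str) : (firstBits n w).length = n := by
  simp [firstBits]

theorem eval_eq_firstBits (C : Circuit) (m : ℕ) (x : Str) :
    C.eval m x = firstBits m (Circuit.wires C x) := by
  apply List.ext_getElem
  · simp [Circuit.eval, firstBits]
  · intro i h1 h2
    simp [Circuit.eval, firstBits, List.getD_eq_getElem?_getD, List.getElem_append]
    split_ifs with h <;> simp [h]

namespace DAGCode

/-- The number of bits of a vertex. -/
def vertexBits (u : Str) : ℕ := lead u

/-- The number of bits of a value. -/
def valueBits (u : Str) : ℕ := lead (u.drop (vertexBits u + 1))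

/-- The circuits. -/
def body (u : Str) : Str := (u.drop (vertexBits u + 1)).drop (valueBits u + 1)

/-- The successor of `v` in the instance encoded by `u`. -/
def succ (u v : Str) : Str := firstBits (vertexBits u) (parseCircuit (body u) v).2

/-- The value of `v` in the instance encoded by `u`. -/
def value (u v : Str) : Str :=
  -- The inner evaluation, on the empty input, serves only to skip the code of the successor
  -- circuit.
  firstBits (valueBits u) (parseCircuit (parseCircuit (body u) []).1 v).2

theorem length_succ (u v : Str) : (succ u v).length = vertexBits u := length_firstBits _ _

theorem length_value (u v : Str) : (value u v).length = valueBits u := length_firstBits _ _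

theorem vertexBits_encode (I : DAGInstance) : vertexBits I.encode = I.n := by
  rw [vertexBits, DAGInstance.encode, List.append_assoc, List.append_assoc, lead_encodeNat_append]

theorem valueBits_encode (I : DAGInstance) : valueBits I.encode = I.m := by
  rw [valueBits, vertexBits_encode, DAGInstance.encode, List.append_assoc, List.append_assoc,
    drop_encodeNat_append, lead_encodeNat_append]

theorem body_encode (I : DAGInstance) :
    body I.encode = Circuit.encode I.succCircuit ++ Circuit.encode I.valCircuit := by
  rw [body, valueBits_encode, vertexBits_encode, DAGInstance.encode, List.append_assoc,
    List.append_assoc, drop_encodeNat_append, drop_encodeNat_append]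

theorem succ_encode (I : DAGInstance) (v : Str) : succ I.encode v = I.S v := by
  rw [succ, body_encode, parseCircuit_encode, vertexBits_encode, DAGInstance.S, eval_eq_firstBits]

theorem binVal_value_encode (I : DAGInstance) (v : Str) : binVal (value I.encode v) = I.V v := by
  have := parseCircuit_encode I.valCircuit [] v
  rw [List.append_nil] at this
  rw [value, body_encode, parseCircuit_encode, this, valueBits_encode, DAGInstance.V,
    eval_eq_firstBits]

@[fun_prop] theorem fp_vertexBits {f : α → Str} (hf : FP f) : FP fun a => vertexBits (f a) :=
  hf.lead

@[fun_prop] theorem fp_valueBits {f : α → Str} (hf : FP f) : FP fun a => valueBits (f a) := by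
  unfold valueBits
  fun_prop

@[fun_prop] theorem fp_succ {f g : α → Str} (hf : FP f) (hg : FP g) :
    FP fun a => succ (f a) (g a) := by
  unfold succ body firstBits
  fun_prop

@[fun_prop] theorem fp_value {f g : α → Str} (hf : FP f) (hg : FP g) :
    FP fun a => value (f a) (g a) := by
  unfold value body firstBits
  fun_prop

attribute [irreducible] vertexBits valueBits succ value

end DAGCode

/-! ### Sink-of-DAG with a prescribed improvement of the value -/

/-- Comparison of numbers in binary with the same number of digits. -/
def lexLt (a b : Str) : Bool :=
  (a.foldl (fun s c => bif s.2.1 || (c == s.1.headD false) then (s.1.tail, s.2)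
    else (s.1.tail, true, !c)) (b, false, false)).2.2

theorem lexLt_iff {a b : Str} (h : a.length = b.length) :
    lexLt a b = true ↔ binVal a < binVal b := by
  have h1 : ∀ (a b : Str) r, (a.foldl (fun (s : Str × Bool × Bool) c =>
      bif s.2.1 || (c == s.1.headD false) then (s.1.tail, s.2) else (s.1.tail, true, !c))
      (b, true, r)).2.2 = r := by
    intro a
    induction a with
    | nil => exact fun _ _ => rfl
    | cons c a ih => exact fun b r => ih b.tail r
  induction a generalizing b with
  | nil =>
    obtain rfl := List.length_eq_zero_iff.mp h.symm
    simp [lexLt]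
  | cons c a ih =>
    obtain _ | ⟨d, b⟩ := b
    · simp at h
    · simp only [List.length_cons, Nat.add_right_cancel_iff] at h
      have ha := binVal_lt a
      have hb := binVal_lt b
      rw [h] at ha
      have ih := ih h
      rw [binVal_cons, binVal_cons, h]
      rw [lexLt] at ih ⊢
      cases c <;> cases d
      · exact ih.trans (by simp)
      · refine (Eq.congr_left (h1 a b true)).trans ?_
        simp only [Bool.toNat_false, Bool.toNat_true, true_iff]
        omega
      · refine (Eq.congr_left (h1 a b false)).trans ?_
        simp only [Bool.toNat_false, Bool.toNat_true, Bool.false_eq_true, false_iff]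
        omega
      · exact ih.trans (by simp)

@[fun_prop] theorem FP.lexLt {f g : α → Str} (hf : FP f) (hg : FP g) :
    FP fun a => lexLt (f a) (g a) := by
  refine FP.comp_snd (FP.comp_snd (FP.str_foldl_add (init := fun a => (g a, false, false))
    (g := fun _ (s : Str × Bool × Bool) c => bif s.2.1 || (c == s.1.headD false) then
      (s.1.tail, s.2) else (s.1.tail, true, !c))
    (C := fun _ => 0) hf (by fun_prop) (by fun_prop) (PB.const 0) fun a s c => ?_))
  obtain ⟨r, d, e⟩ := s
  cases (d || (c == r.headD false)) <;>
    simp only [cond_true, cond_false, size_pair, size_str, size_bool, List.length_tail] <;> omega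

attribute [irreducible] lexLt

/-- Dropping the last `k` binary digits is division by `2 ^ k`; hence the quotients in `Improves`
are compared by comparing prefixes. -/
theorem binVal_take (x : Str) (k : ℕ) : binVal (x.take (x.length - k)) = binVal x / 2 ^ k := by
  by_cases hk : k ≤ x.length
  · conv_rhs => rw [← List.take_append_drop (x.length - k) x, binVal_append]
    have h : (x.drop (x.length - k)).length = k := by simp; omega
    have := binVal_lt (x.drop (x.length - k))
    rw [h] at this ⊢
    rw [mul_comm, Nat.mul_add_div (by positivity), Nat.div_eq_of_lt this, add_zero]
  · rw [Nat.sub_eq_zero_of_le (by omega), List.take_zero, Nat.div_eq_of_lt]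
    · rfl
    · exact (binVal_lt x).trans_le (Nat.pow_le_pow_right (by omega) (by omega))

namespace DAGCode

/-- The value of a vertex as a number. -/
def num (u v : Str) : ℕ := binVal (value u v)

/-- `v` has no proper successor, or its successor does not have a larger value than `v`. -/
def AtEnd (u v : Str) : Prop := succ u (succ u v) = succ u v ∨ num u (succ u v) ≤ num u v

/-- `y` is a vertex with a proper successor, and it is a solution of the instance encoded by `u` or
improves on the value of `w` in the digits above the last `k`. -/
def Improves (c : ℕ × Str × Str) (y : Str) : Prop :=
  y.length = vertexBits c.2.2 ∧ succ c.2.2 y ≠ y ∧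
    (AtEnd c.2.2 y ∨ num c.2.2 c.2.1 / 2 ^ c.1 < num c.2.2 y / 2 ^ c.1)

/-- Boolean version of `Improves`. -/
def improves (c : ℕ × Str × Str) (y : Str) : Bool :=
  (decide (y.length = vertexBits c.2.2) && !decide (succ c.2.2 y = y)) &&
    ((decide (succ c.2.2 (succ c.2.2 y) = succ c.2.2 y) ||
      !lexLt (value c.2.2 y) (value c.2.2 (succ c.2.2 y))) ||
    lexLt ((value c.2.2 c.2.1).take (valueBits c.2.2 - c.1))
      ((value c.2.2 y).take (valueBits c.2.2 - c.1)))

theorem improves_iff (c : ℕ × Str × Str) (y : Str) : improves c y = true ↔ Improves c y := by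
  have h : ∀ v, binVal ((value c.2.2 v).take (valueBits c.2.2 - c.1)) = num c.2.2 v / 2 ^ c.1 := by
    intro v
    rw [← length_value c.2.2 v, binVal_take, num]
  rw [improves, Improves, AtEnd]
  simp only [Bool.and_eq_true, Bool.or_eq_true, Bool.not_eq_true', decide_eq_true_eq,
    ← Bool.not_eq_true, and_assoc]
  rw [lexLt_iff (by rw [length_value, length_value]),
    lexLt_iff (by rw [List.length_take, List.length_take, length_value, length_value]), h, h,
    not_lt]
  rfl

@[fun_prop] theorem fp_improves {c : α → ℕ × Str × Str} {y : α → Str} (hc : FP c) (hy : FP y) :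
    FP fun a => improves (c a) (y a) := by
  unfold improves
  fun_prop

attribute [irreducible] improves

/-- The solution of an instance with `k = 0`. -/
theorem improves_zero {u w : Str} (hw : w.length = vertexBits u) (hne : succ u w ≠ w) :
    Improves (0, w, u) (bif improves (0, w, u) w then w else succ u w) := by
  cases h : improves (0, w, u) w with
  | true => exact (improves_iff _ _).mp h
  | false =>
    rw [← Bool.not_eq_true, improves_iff] at h
    simp only [Improves, AtEnd, not_and, not_or, not_le] at h
    have := (h hw hne).1
    -- If `w` is not at an end, its successor has a proper successor and a strictly larger value.
    exact ⟨length_succ _ _, this.1, .inr (by simpa using this.2)⟩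

/-- Two improvements above the last `k` digits give one above the last `k + 1` digits. -/
theorem improves_succ {u w y₁ y₂ : Str} {k : ℕ} (h1 : Improves (k, w, u) y₁)
    (h2 : Improves (k, y₁, u) y₂) :
    Improves (k + 1, w, u) (bif improves (k + 1, w, u) y₁ then y₁ else y₂) := by
  cases h : improves (k + 1, w, u) y₁ with
  | true => exact (improves_iff _ _).mp h
  | false =>
    rw [← Bool.not_eq_true, improves_iff] at h
    obtain ⟨a1, a2, a3⟩ := h1
    obtain ⟨b1, b2, b3⟩ := h2
    refine ⟨b1, b2, b3.imp_right fun b3 => ?_⟩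
    have a4 : ¬ AtEnd u y₁ := fun a4 => h ⟨a1, a2, .inl a4⟩
    -- If `y₁` is not at an end, the quotient by `2 ^ k` has grown strictly from `w` to `y₁`. Unless
    -- `y₂` is at an end it grows strictly again, and a total gain of two survives halving.
    have a5 := a3.resolve_left a4
    simp only [pow_succ, ← Nat.div_div_eq_div_mul, cond_false] at a5 b3 ⊢
    omega

/-- The instance of `improvement` given by a string. -/
def decode (z : Str) : ℕ × Str × Str :=
  ((undbl z).1.length, undbl (undbl z).2)

theorem decode_enc (c : ℕ × Str × Str) : decode (enc c) = c := by
  obtain ⟨k, w, u⟩ := c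
  rw [decode, enc_pair, undbl_dbl_append, enc_pair]
  rw [show enc w = w from rfl, show enc u = u from rfl, undbl_dbl_append, enc_nat]
  simp [unary]

@[fun_prop] theorem fp_decode {f : α → Str} (hf : FP f) : FP fun a => decode (f a) := by
  unfold decode
  fun_prop

/-- `c` consists of a number, a vertex with a proper successor, and the code of an instance. -/
def proper (c : ℕ × Str × Str) : Bool :=
  decide (c.2.1.length = vertexBits c.2.2) && !decide (succ c.2.2 c.2.1 = c.2.1)

theorem proper_iff (c : ℕ × Str × Str) :
    proper c = true ↔ c.2.1.length = vertexBits c.2.2 ∧ succ c.2.2 c.2.1 ≠ c.2.1 := by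
  simp [proper]

@[fun_prop] theorem fp_proper {c : α → ℕ × Str × Str} (hc : FP c) : FP fun a => proper (c a) := by
  unfold proper
  fun_prop

/-- The string encodes an instance of `improvement`. -/
def isInstance (z : Str) : Bool := decide (enc (decode z) = z) && proper (decode z)

theorem isInstance_iff (z : Str) : isInstance z = true ↔ ∃ c, enc c = z ∧ proper c = true := by
  simp only [isInstance, Bool.and_eq_true, decide_eq_true_eq]
  constructor
  · exact fun h => ⟨_, h⟩
  · rintro ⟨c, rfl, h⟩
    rw [decode_enc]
    exact ⟨rfl, h⟩

@[fun_prop] theorem fp_isInstance {f : α → Str} (hf : FP f) : FP fun a => isInstance (f a) := by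
  unfold isInstance
  fun_prop

attribute [irreducible] decode proper isInstance

/-- Totality follows from the same recursion as the self-reduction. -/
theorem exists_improves (k : ℕ) : ∀ u w : Str, w.length = vertexBits u → succ u w ≠ w →
    ∃ y, Improves (k, w, u) y := by
  induction k with
  | zero => exact fun u w h h' => ⟨_, improves_zero h h'⟩
  | succ k ih =>
    intro u w h h'
    obtain ⟨y₁, h1⟩ := ih u w h h'
    obtain ⟨y₂, h2⟩ := ih u y₁ h1.1 h1.2.1
    exact ⟨_, improves_succ h1 h2⟩

/-- Find a solution of an instance of Sink-of-DAG or a vertex that improves on the value of a given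
vertex by a given power of two. -/
def improvement : SearchProblem := fun z y =>
  (bif isInstance z then improves (decode z) y else y.isEmpty) = true

theorem improvement_enc {c : ℕ × Str × Str} (hc : proper c = true) (y : Str) :
    improvement (enc c) y ↔ Improves c y := by
  rw [improvement, (isInstance_iff _).mpr ⟨c, rfl, hc⟩, cond_true, decode_enc, improves_iff]

theorem improvement_of_not {z : Str} (h : isInstance z = false) (y : Str) :
    improvement z y ↔ y = [] := by
  rw [improvement, h, cond_false, List.isEmpty_iff]

theorem length_le_of_improvement {z y : Str} (h : improvement z y) : y.length ≤ z.length := by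
  cases hz : isInstance z with
  | false => simp [(improvement_of_not hz y).mp h]
  | true =>
    obtain ⟨c, rfl, hc⟩ := (isInstance_iff z).mp hz
    have h1 := ((improvement_enc hc y).mp h).1
    have h2 := ((proper_iff c).mp hc).1
    have h3 : (enc c).length = _ := size_pair c.1 c.2
    have h4 : size c.2 = _ := size_pair c.2.1 c.2.2
    rw [size_str] at h4
    omega

theorem tfnp_improvement : TFNP improvement := by
  refine ⟨⟨⟨.X, fun x y h => by simpa using length_le_of_improvement h⟩, ?_⟩, fun z => ?_⟩
  · have h : FP fun a : Str × Str =>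
        enc (bif isInstance a.1 then improves (decode a.1) a.2 else a.2.isEmpty) := by fun_prop
    refine ⟨_, h.polyTime_two, fun x y => ?_⟩
    simp [improvement, enc_bool]
  · cases hz : isInstance z with
    | false => exact ⟨[], (improvement_of_not hz []).mpr rfl⟩
    | true =>
      obtain ⟨⟨k, w, u⟩, rfl, hc⟩ := (isInstance_iff z).mp hz
      obtain ⟨h1, h2⟩ := (proper_iff _).mp hc
      obtain ⟨y, hy⟩ := exists_improves k u w h1 h2
      exact ⟨y, (improvement_enc hc y).mpr hy⟩

/-- An instance at level `k + 1` asks for an improvement on `w` at level `k`, then for an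
improvement on the answer at level `k`. Since `k` is in unary, `u` is unchanged and all vertices
have the same length, both queries are shorter. Level 0 and strings that are not instances are
solved directly. -/
theorem downwardSelfReducible_improvement : DownwardSelfReducible improvement := by
  have hpr : ∀ {k k' w u}, proper (k, w, u) = true → proper (k', w, u) = true := by
    intro k k' w u h
    rwa [proper_iff] at h ⊢
  have hpr' : ∀ {k k' w u y}, Improves (k, w, u) y → proper (k', y, u) = true := by
    intro k k' w u y h
    exact (proper_iff _).mpr ⟨h.1, h.2.1⟩
  have hlen : ∀ (k k' : ℕ) (w w' u : Str), k' < k → w'.length = w.length →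
      (enc (k', w', u)).length < (enc (k, w, u)).length := by
    intro k k' w w' u hk hw
    have h1 : ∀ (k : ℕ) (w : Str), (enc (k, w, u)).length =
        2 * k + 1 + (2 * w.length + 1 + u.length) := by
      intro k w
      have h2 : (enc (k, w, u)).length = _ := size_pair k (w, u)
      rw [h2, size_pair, size_nat, size_str, size_str]
    rw [h1, h1]
    omega
  have key : ∀ x, (isInstance x && !decide ((decode x).1 = 0)) = true →
      ∃ k w u, x = enc (k + 1, w, u) ∧ proper (k + 1, w, u) = true := by
    intro x hx
    rw [Bool.and_eq_true, isInstance_iff] at hx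
    obtain ⟨⟨⟨k, w, u⟩, rfl, hc⟩, hk⟩ := hx
    rw [decode_enc] at hk
    obtain ⟨k, rfl⟩ : ∃ m, k = m + 1 := ⟨k - 1, by simp at hk; omega⟩
    exact ⟨k, w, u, rfl, hc⟩
  refine downwardSelfReducible_of_two_queries tfnp_improvement.2 (q := .X)
    (fun x y h => by simpa using length_le_of_improvement h)
    (recurse := fun x => isInstance x && !decide ((decode x).1 = 0)) (by fun_prop)
    (direct := fun x => bif isInstance x then bif improves (decode x) (decode x).2.1 then
      (decode x).2.1 else succ (decode x).2.2 (decode x).2.1 else []) (by fun_prop)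
    (q₁ := fun x => enc ((decode x).1 - 1, (decode x).2.1, (decode x).2.2)) (by fun_prop)
    (q₂ := fun c => enc ((decode c.1).1 - 1, c.2, (decode c.1).2.2)) (by fun_prop)
    (out := fun c => bif improves (decode c.1.1) c.1.2 then c.1.2 else c.2) (by fun_prop)
    ?_ ?_ ?_ ?_
  · intro x hx
    cases hz : isInstance x with
    | false => exact (improvement_of_not hz _).mpr rfl
    | true =>
      obtain ⟨⟨k, w, u⟩, rfl, hc⟩ := (isInstance_iff x).mp hz
      obtain ⟨h1, h2⟩ := (proper_iff _).mp hc
      rw [hz, decode_enc] at hx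
      obtain rfl : k = 0 := by simpa using hx
      rw [decode_enc, improvement_enc hc]
      exact improves_zero h1 h2
  · intro x hx
    obtain ⟨k, w, u, rfl, hc⟩ := key x hx
    simp only [decode_enc]
    exact hlen _ _ _ _ _ (by omega) rfl
  · intro x a hx ha
    obtain ⟨k, w, u, rfl, hc⟩ := key x hx
    simp only [decode_enc, Nat.add_sub_cancel] at ha ⊢
    rw [improvement_enc (hpr hc)] at ha
    exact hlen _ _ _ _ _ (by omega) (ha.1.trans ((proper_iff _).mp hc).1.symm)
  · intro x a b hx ha hb
    obtain ⟨k, w, u, rfl, hc⟩ := key x hx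
    simp only [decode_enc, Nat.add_sub_cancel] at ha hb ⊢
    rw [improvement_enc (hpr hc)] at ha
    rw [improvement_enc (hpr' ha)] at hb
    rw [improvement_enc hc]
    exact improves_succ ha hb

theorem sinkOfDAG_of_not_isInstance {u : Str}
    (h : proper (valueBits u, List.replicate (vertexBits u) false, u) = false) :
    SinkOfDAG u [] := by
  refine .inr ⟨?_, rfl⟩
  rintro ⟨I, rfl, hI⟩
  rw [← Bool.not_eq_true, proper_iff] at h
  refine h ⟨by simp, ?_⟩
  simp only [vertexBits_encode, succ_encode]
  exact hI

/-- The string `u` need not encode a valid instance, and this is not tested; in that case the empty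
string is the solution. The disjunction leaves it to the reduction to try both. -/
theorem sinkOfDAG_of_improves {u y : Str}
    (h : Improves (valueBits u, List.replicate (vertexBits u) false, u) y) :
    SinkOfDAG u y ∨ SinkOfDAG u [] := by
  by_cases hu : ∃ I : DAGInstance, I.encode = u ∧ I.Valid
  · obtain ⟨I, rfl, hI⟩ := hu
    obtain ⟨h1, h2, h3⟩ := h
    -- At this level all binary digits are dropped, so no vertex improves on another and only the
    -- first alternative of `Improves` is left.
    have hv : ∀ v, num I.encode v / 2 ^ valueBits I.encode = 0 := by
      intro v
      rw [Nat.div_eq_zero_iff]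
      right
      have := binVal_lt (value I.encode v)
      rwa [length_value] at this
    simp only [hv, lt_self_iff_false, or_false] at h3
    simp only [AtEnd, num, binVal_value_encode, succ_encode] at h3
    simp only [vertexBits_encode, succ_encode] at h1 h2
    exact .inl (.inl ⟨I, rfl, hI, h1, h2, h3⟩)
  · exact .inr (.inr ⟨hu, rfl⟩)

/-- A local search problem reduces to `improvement`. -/
theorem polyReducible_improvement {R : SearchProblem} (hR : PLS R) :
    PolyReducible R improvement := by
  obtain ⟨⟨⟨-, D, hD, hDR⟩, -⟩, f, g, hf, hg, hfg⟩ := hR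
  have hf : FP f := FP.of_polyTime_one hf
  have hg : FP fun a : Str × Str => g a.1 a.2 := FP.of_polyTime_two hg
  have hD := FP.of_polyTime_two hD
  have hg0 : FP fun a : Str × Str => g a.1 [] := hg.comp (f := fun a : Str × Str => (a.1, []))
    (by fun_prop)
  have h1 : FP fun a : Str × Str => D ![a.1, g a.1 a.2] :=
    hD.comp (f := fun a : Str × Str => (a.1, g a.1 a.2)) (by fun_prop)
  have h2 : FP fun x => enc (valueBits (f x), List.replicate (vertexBits (f x)) false, f x) := by
    fun_prop
  have h3 : FP fun a : Str × Str =>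
      bif decide (D ![a.1, g a.1 a.2] = [true]) then g a.1 a.2 else g a.1 [] :=
    (h1.str_beq (FP.const [true])).cond hg hg0
  -- The search starts at the vertex 0…0 at the top level. One of `y` and the empty string solves `f
  -- x`, and the decision procedure for `R` tells whether `y` yields a solution; otherwise the empty
  -- string is used.
  refine ⟨fun x => enc (valueBits (f x), List.replicate (vertexBits (f x)) false, f x),
    fun x y => bif decide (D ![x, g x y] = [true]) then g x y else g x [],
    h2.polyTime_one, h3.polyTime_two, fun x y hy => ?_⟩
  have h4 : SinkOfDAG (f x) y ∨ SinkOfDAG (f x) [] := by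
    cases hc : proper (valueBits (f x), List.replicate (vertexBits (f x)) false, f x) with
    | false => exact .inr (sinkOfDAG_of_not_isInstance hc)
    | true => exact sinkOfDAG_of_improves ((improvement_enc hc y).mp hy)
  by_cases h5 : D ![x, g x y] = [true]
  · simpa [h5] using (hDR _ _).mp h5
  · simp only [h5, decide_false, cond_false]
    exact h4.elim (fun h4 => absurd ((hDR _ _).mpr (hfg _ _ h4)) h5) (hfg _ _)

end DAGCode

/-! ### Hardness is preserved by reductions -/

theorem WorstCaseHard.of_polyReducible {R S : SearchProblem} (h : PolyReducible R S)
    (hR : WorstCaseHard R) : WorstCaseHard S := by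
  rintro ⟨s, hs, hsol⟩
  obtain ⟨f, g, hf, hg, hfg⟩ := h
  have hs : FP s := FP.of_polyTime_one hs
  have hf : FP f := FP.of_polyTime_one hf
  have hg : FP fun a : Str × Str => g a.1 a.2 := FP.of_polyTime_two hg
  have h1 : FP fun x => g x (s (f x)) := hg.comp (f := fun x => (x, s (f x)))
    (FP.id.pair (hs.comp hf))
  exact hR ⟨_, h1.polyTime_one, fun x => hfg _ _ (hsol _)⟩

theorem successProb_nonneg (R : SearchProblem) (D : PMF Str) (B : Str → PMF Str) :
    0 ≤ successProb R D B := ENNReal.toReal_nonneg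

/-- For every `x`, the event that `B` solves `f x` is contained in the event that `g x` turns the
output of `B` into a solution of `x`. -/
theorem successProb_map_le {R S : SearchProblem} {f : Str → Str} {g : Str → Str → Str}
    (h : ∀ x y, S (f x) y → R x (g x y)) (D : PMF Str) (B : Str → PMF Str) :
    successProb S (D.map f) B ≤ successProb R D fun x => (B (f x)).map (g x) := by
  refine ENNReal.toReal_mono ?_ ?_
  · refine ne_top_of_le_ne_top ENNReal.one_ne_top ?_
    refine (PMF.toOuterMeasure_mono _ (t := Set.univ) (Set.subset_univ _)).trans_eq ?_
    exact (PMF.toOuterMeasure_apply_eq_one_iff _ _).mpr (Set.subset_univ _)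
  · rw [PMF.bind_map, PMF.toOuterMeasure_bind_apply, PMF.toOuterMeasure_bind_apply]
    refine ENNReal.tsum_le_tsum fun x => mul_le_mul_right ?_ _
    rw [Function.comp_apply, PMF.map_comp, PMF.toOuterMeasure_map_apply,
      PMF.toOuterMeasure_map_apply]
    exact PMF.toOuterMeasure_mono _ (Set.inter_subset_left.trans fun y hy => h x y hy)

/-- The hard ensemble for `S` is the image under `f` of the one for `R`. An algorithm for `S`,
preceded by `f` and followed by `g`, is an algorithm for `R` using the same coins and succeeding at
least as often. -/
theorem AverageCaseHard.of_polyReducible {R S : SearchProblem} (h : PolyReducible R S)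
    (hR : AverageCaseHard R) : AverageCaseHard S := by
  obtain ⟨f, g, hf, hg, hfg⟩ := h
  have hf : FP f := FP.of_polyTime_one hf
  have hg : FP fun a : Str × Str => g a.1 a.2 := FP.of_polyTime_two hg
  obtain ⟨D, ⟨F, ℓ, hF, hD⟩, hB⟩ := hR
  have hF := FP.of_polyTime_two hF
  refine ⟨fun n => (D n).map f, ⟨fun v => f (F ![v 0, v 1]), ℓ,
    (hf.comp hF).polyTime_two, fun n => ?_⟩, fun B hB' => ?_⟩
  · exact (congrArg (PMF.map f) (hD n)).trans (PMF.map_comp _ _ _)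
  · obtain ⟨G, ℓ', hG, hGB⟩ := hB'
    have hG := FP.of_polyTime_three hG
    have h1 : FP fun a : Str × Str × Str => G ![a.1, f a.2.1, a.2.2] :=
      hG.comp (f := fun a : Str × Str × Str => (a.1, f a.2.1, a.2.2)) (by fun_prop)
    have h2 : FP fun a : Str × Str × Str => g a.2.1 (G ![a.1, f a.2.1, a.2.2]) :=
      hg.comp (f := fun a : Str × Str × Str => (a.2.1, G ![a.1, f a.2.1, a.2.2]))
        ((FP.comp_fst FP.snd).pair h1)
    refine (hB (fun n x => (B n (f x)).map (g x)) ⟨fun v => g (v 1) (G ![v 0, f (v 1), v 2]), ℓ',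
      h2.polyTime_three, fun n x => ?_⟩).trans_abs_le fun n => ?_
    · exact (congrArg (PMF.map (g x)) (hGB n (f x))).trans (PMF.map_comp _ _ _)
    · rw [abs_of_nonneg (successProb_nonneg _ _ _), abs_of_nonneg (successProb_nonneg _ _ _)]
      exact successProb_map_le hfg _ _

end DSR

/-- Some problem in PLS is hard if and only if some downward self-reducible problem in TFNP is
hard, both for worst-case hardness and for average-case hardness. -/
theorem mainTheorem8 :
    ((∃ R : DSR.SearchProblem, DSR.PLS R ∧ DSR.WorstCaseHard R) ↔
      ∃ R : DSR.SearchProblem, DSR.TFNP R ∧ DSR.DownwardSelfReducible R ∧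
        DSR.WorstCaseHard R) ∧
    ((∃ R : DSR.SearchProblem, DSR.PLS R ∧ DSR.AverageCaseHard R) ↔
      ∃ R : DSR.SearchProblem, DSR.TFNP R ∧ DSR.DownwardSelfReducible R ∧
        DSR.AverageCaseHard R) := by
  refine ⟨⟨?_, ?_⟩, ?_, ?_⟩
  · rintro ⟨R, hR, h⟩
    exact ⟨_, DSR.DAGCode.tfnp_improvement, DSR.DAGCode.downwardSelfReducible_improvement,
      h.of_polyReducible (DSR.DAGCode.polyReducible_improvement hR)⟩
  · rintro ⟨R, hR, hd, h⟩
    exact ⟨R, DSR.pls_of_downwardSelfReducible hR hd, h⟩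
  · rintro ⟨R, hR, h⟩
    exact ⟨_, DSR.DAGCode.tfnp_improvement, DSR.DAGCode.downwardSelfReducible_improvement,
      h.of_polyReducible (DSR.DAGCode.polyReducible_improvement hR)⟩
  · rintro ⟨R, hR, hd, h⟩
    exact ⟨R, DSR.pls_of_downwardSelfReducible hR hd, h⟩
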